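/- **Setting.** Let $D$ be a linear subspace of a real Hilbert space $H$, let $X, Y : D \to D$ be symmetric linear operators (not necessarily commuting), and let $\phi \in D$ be a unit vector (the vacuum). Put $E[g] = \langle g\phi, \phi\rangle$. Random vectors $(X,Y)$ and $(X',Y')$ (with vacuum vectors $\phi$, $\phi'$) are *moment equal* if $E[p(X,Y)] = E'[p(X',Y')]$ for every polynomial $p$ in two non-commuting variables. Let $F_n$ be the span of all $p(X,Y)\phi$ with $\deg p \le n$ ($F_n = 0$ for $n<0$), let $G_n = F_n \ominus F_{n-1}$ and $F = \bigcup_n F_n$. The joint annihilation, preservation and creation (APC) operators $a_x^\varepsilon, a_y^\varepsilon : F \to F$, $\varepsilon \in \{-,0,+\}$, are the linear operators with $a_x^{\varepsilon}u = P_{G_{n+\varepsilon}}Xu$ and $a_y^{\varepsilon}u = P_{G_{n+\varepsilon}}Yu$ for $u \in G_n$, where $P_G$ is the orthogonal projection onto $G$ and $\varepsilon$ is read as $-1, 0, 1$. Let $W(X,Y)$ be the real span of $I$ and these six operators. $(X,Y)$ is a *Meixner random vector of class $\mathcal M_L$* if $W(X,Y)$ is closed under the commutator (hence a Lie algebra);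 it is *centered* if $E[X]=E[Y]=0$, and *non-degenerate* if $\phi, X\phi, Y\phi$ are linearly independent. **Meixner variables.** A real random variable with finite moments of all orders is *Meixner of class $\mathcal M_L$ with parameters $\alpha,\alpha_0,\beta,t$* if either it has infinite support and Szegő–Jacobi parameters $\alpha_n=\alpha n+\alpha_0$, $\omega_n=\beta n^2+(t-\beta)n$, where $\beta \ge 0$, $t>0$, and $\alpha\neq0$ or $\alpha=\beta=0$; or it takes exactly $k$ values with positive probability, its Szegő–Jacobi parameters are given by the same formulas for $n<k$ (and are $0$ for $n \ge k$), $\alpha\ne0$, $t=-\beta(k-1)$, and $t>0$ if $k \ge 2$. **Mixed pairs.** Let $c,d,j,k,p,r,s,v$ be real with $cs+dv=0$ and $jp+kr=0$, and let $T,Z$ be independent Meixner random variables of class $\mathcal M_L$, both with $\alpha=1$, $\alpha_0=0$, $t=1$, and with $\beta_T=\frac12(cp+dr)$ and $\beta_Z=\frac12(js+kv)$. Regard them as multiplication operators on the polynomials in $L^2$ of their joint distribution, with vacuum vector $1$ and joint APC operators $a_t^\varepsilon, a_z^\varepsilon$. The operators $$X''=a_t^-+(p\,a_t^0+s\,a_z^0)+a_t^+,\qquad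 Y''=a_z^-+(r\,a_t^0+v\,a_z^0)+a_z^+$$ are called *two independent Meixner random variables of class $\mathcal M_L$ with mixed preservation operators*. **Theorem.** Let $(X,Y)$ be a non-degenerate centered Meixner random vector of class $\mathcal M_L$. 1. There are an invertible linear map $S$ of $\mathbb R^2$ and a pair $(X'',Y'')$ of independent Meixner random variables of class $\mathcal M_L$ with mixed preservation operators such that $S(X,Y)$ is moment equal to $(X'',Y'')$, the space $W(X'',Y'')$ is closed under the commutator, and $W(X,Y)$ and $W(X'',Y'')$ are isomorphic Lie algebras. 2. The two descriptions are equivalent in the following sense. For every invertible linear map $S=(S_{ij})$ of $\mathbb R^2$ and every such pair $(X'',Y'')$, the vector $S(X,Y)$ is moment equal to $(X'',Y'')$ if and only if $W(X'',Y'')$ is closed under the commutator and there is a Lie algebra isomorphism $W(X,Y)\to W(X'',Y'')$ that sends $I$ to $I$ and, for each $\varepsilon\in\{-,0,+\}$, sends $S_{11}a_x^\varepsilon+S_{12}a_y^\varepsilon$ to $a_{x''}^\varepsilon$ and $S_{21}a_x^\varepsilon+S_{22}a_y^\varepsilon$ to $a_{y''}^\varepsilon$. -/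

import Mathlib

open MeasureTheory
open scoped InnerProductSpace

attribute [local instance] LieRing.ofAssociativeRing

noncomputable section

/-! ## Random vectors, expectation, moment equality

`E` is a real inner product space: the common invariant domain, inside some Hilbert space, of the
operators under consideration.  A (possibly non-commutative) random vector is a finite family of
operators `X : ι → Module.End ℝ E`, with a vacuum vector `φ : E`. -/

section NonCommutative

variable {E : Type*} [NormedAddCommGroup E] [InnerProductSpace ℝ E]
variable {E' : Type*} [NormedAddCommGroup E'] [InnerProductSpace ℝ E']
variable {ι : Type*}

/-- The expectation `E[g] = ⟨g φ, φ⟩`. -/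
def expect (φ : E) (g : Module.End ℝ E) : ℝ := ⟪g φ, φ⟫_ℝ

/-- `p(X₁, …, X_d)` for a polynomial `p` in non-commuting variables. -/
def ncEval (X : ι → Module.End ℝ E) (p : FreeAlgebra ℝ ι) : Module.End ℝ E :=
  FreeAlgebra.lift ℝ X p

/-- Two random vectors are moment equal if all their joint moments agree. -/
def MomentEqual (X : ι → Module.End ℝ E) (φ : E) (X' : ι → Module.End ℝ E') (φ' : E') : Prop :=
  ∀ p : FreeAlgebra ℝ ι, expect φ (ncEval X p) = expect φ' (ncEval X' p)

def IsCentered (X : ι → Module.End ℝ E) (φ : E) : Prop := ∀ i, expect φ (X i) = 0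

/-- `φ`, `Xφ`, `Yφ` are linearly independent. -/
def IsNondegenerate (X : Fin 2 → Module.End ℝ E) (φ : E) : Prop :=
  LinearIndependent ℝ ![φ, X 0 φ, X 1 φ]

/-- The random vector `S(X₁, …, X_d)`, for a matrix `S`. -/
def linTransform [Fintype ι] (S : Matrix ι ι ℝ) (X : ι → Module.End ℝ E) :
    ι → Module.End ℝ E :=
  fun i => ∑ j, S i j • X j

/-! ## Chaos spaces and the minimal joint annihilation-preservation-creation decomposition -/

/-- `F_n`: the span of the vectors `X_{i₁} ⋯ X_{i_m} φ` with `m ≤ n`; it is `0` for `n < 0`. -/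
def chaosFilt (X : ι → Module.End ℝ E) (φ : E) (n : ℤ) : Submodule ℝ E :=
  Submodule.span ℝ {v | ∃ w : List ι, (w.length : ℤ) ≤ n ∧ v = (w.map X).prod φ}

/-- The space of all `p(X₁, …, X_d) φ`, with `p` a polynomial in non-commuting variables. -/
def cyclicSpace (X : ι → Module.End ℝ E) (φ : E) : Submodule ℝ E :=
  LinearMap.range ((LinearMap.applyₗ φ : Module.End ℝ E →ₗ[ℝ] E) ∘ₗ
    (FreeAlgebra.lift ℝ X).toLinearMap)

/-- The homogeneous chaos space `G_n = F_n ⊖ F_{n-1}`; it is `0` for `n < 0`. -/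
def chaos (X : ι → Module.End ℝ E) (φ : E) (n : ℤ) : Submodule ℝ E :=
  chaosFilt X φ n ⊓ (chaosFilt X φ (n - 1))ᗮ

lemma chaosFilt_mono (X : ι → Module.End ℝ E) (φ : E) {m n : ℤ} (h : m ≤ n) :
    chaosFilt X φ m ≤ chaosFilt X φ n := by
  apply Submodule.span_mono
  rintro v ⟨w, hw, rfl⟩
  exact ⟨w, hw.trans h, rfl⟩

lemma chaosFilt_of_neg (X : ι → Module.End ℝ E) (φ : E) {n : ℤ} (h : n < 0) :
    chaosFilt X φ n = ⊥ := by
  rw [chaosFilt, Submodule.span_eq_bot]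
  rintro v ⟨w, hw, rfl⟩
  exact absurd (hw.trans_lt h) (by simp)

lemma word_mem_cyclicSpace (X : ι → Module.End ℝ E) (φ : E) (w : List ι) :
    (w.map X).prod φ ∈ cyclicSpace X φ := by
  refine ⟨(w.map (FreeAlgebra.ι ℝ)).prod, ?_⟩
  change FreeAlgebra.lift ℝ X (w.map (FreeAlgebra.ι ℝ)).prod φ = _
  simp [map_list_prod, Function.comp_def]

lemma chaosFilt_le_cyclicSpace (X : ι → Module.End ℝ E) (φ : E) (n : ℤ) :
    chaosFilt X φ n ≤ cyclicSpace X φ := by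
  rw [chaosFilt, Submodule.span_le]
  rintro v ⟨w, -, rfl⟩
  exact word_mem_cyclicSpace X φ w

lemma vac_mem_cyclicSpace (X : ι → Module.End ℝ E) (φ : E) : φ ∈ cyclicSpace X φ := by
  simpa using word_mem_cyclicSpace X φ []

lemma exists_mem_chaosFilt (X : ι → Module.End ℝ E) (φ : E) {u : E}
    (hu : u ∈ cyclicSpace X φ) : ∃ N : ℤ, u ∈ chaosFilt X φ N := by
  obtain ⟨p, rfl⟩ := hu
  have key : ∀ q : FreeAlgebra ℝ ι, ∀ w : List ι, ∃ N : ℤ,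
      (FreeAlgebra.lift ℝ X q) ((w.map X).prod φ) ∈ chaosFilt X φ N := by
    intro q
    -- multiplying a fixed `F_m` by `q(X)` lands in some `F_N`
    suffices h : ∀ m : ℤ, ∃ N : ℤ, ∀ v ∈ chaosFilt X φ m,
        FreeAlgebra.lift ℝ X q v ∈ chaosFilt X φ N by
      intro w
      obtain ⟨N, hN⟩ := h w.length
      exact ⟨N, hN _ (Submodule.subset_span ⟨w, le_rfl, rfl⟩)⟩
    induction q using FreeAlgebra.induction with
    | grade0 r =>
      intro m
      refine ⟨m, fun v hv => ?_⟩
      simpa [Module.algebraMap_end_apply] using Submodule.smul_mem _ r hv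
    | grade1 i =>
      intro m
      refine ⟨m + 1, fun v hv => ?_⟩
      have hle : chaosFilt X φ m ≤ (chaosFilt X φ (m + 1)).comap (X i) := by
        rw [chaosFilt, Submodule.span_le]
        rintro _ ⟨w, hw, rfl⟩
        refine Submodule.subset_span ⟨i :: w, ?_, ?_⟩
        · simpa using hw
        · simp
      simpa using hle hv
    | mul a b ha hb =>
      intro m
      obtain ⟨N, hN⟩ := hb m
      obtain ⟨M, hM⟩ := ha N
      refine ⟨M, fun v hv => ?_⟩
      simpa using hM _ (hN v hv)
    | add a b ha hb =>
      intro m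
      obtain ⟨N, hN⟩ := ha m
      obtain ⟨M, hM⟩ := hb m
      refine ⟨max N M, fun v hv => ?_⟩
      simpa using Submodule.add_mem _ (chaosFilt_mono X φ (le_max_left N M) (hN v hv))
        (chaosFilt_mono X φ (le_max_right N M) (hM v hv))
  obtain ⟨N, hN⟩ := key p []
  exact ⟨N, by simpa using hN⟩

variable [Finite ι]

instance chaosFilt_finiteDimensional (X : ι → Module.End ℝ E) (φ : E) (n : ℤ) :
    FiniteDimensional ℝ (chaosFilt X φ n) := by
  apply FiniteDimensional.span_of_finite
  have hfin : {w : List ι | w.length ≤ n.toNat}.Finite := List.finite_length_le ι _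
  refine (hfin.image (fun w => (w.map X).prod φ)).subset ?_
  rintro v ⟨w, hw, rfl⟩
  exact ⟨w, by change w.length ≤ n.toNat; omega, rfl⟩

instance chaos_finiteDimensional (X : ι → Module.End ℝ E) (φ : E) (n : ℤ) :
    FiniteDimensional ℝ (chaos X φ n) :=
  Submodule.finiteDimensional_of_le (inf_le_left : chaos X φ n ≤ chaosFilt X φ n)

/-- The orthogonal projection onto the chaos space `G_n`. -/
def chaosProj (X : ι → Module.End ℝ E) (φ : E) (n : ℤ) : E →ₗ[ℝ] E :=
  ((chaos X φ n).starProjection : E →L[ℝ] E)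

lemma chaosProj_mem (X : ι → Module.End ℝ E) (φ : E) (n : ℤ) (u : E) :
    chaosProj X φ n u ∈ cyclicSpace X φ :=
  chaosFilt_le_cyclicSpace X φ n
    (Submodule.starProjection_apply_mem (chaos X φ n) u).1

lemma chaosProj_support_finite (X : ι → Module.End ℝ E) (φ : E) {u : E}
    (hu : u ∈ cyclicSpace X φ) (L : ℤ → E →ₗ[ℝ] E) :
    (Function.support fun n : ℤ => L n (chaosProj X φ n u)).Finite := by
  obtain ⟨N, hN⟩ := exists_mem_chaosFilt X φ hu
  refine (Set.finite_Icc (0 : ℤ) N).subset fun n hn => ?_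
  by_contra hcon
  apply hn
  have hz : chaosProj X φ n u = 0 := by
    rw [Set.mem_Icc, not_and_or, not_le, not_le] at hcon
    rcases hcon with h | h
    · have hmem := (Submodule.starProjection_apply_mem (chaos X φ n) u).1
      rw [chaosFilt_of_neg X φ h] at hmem
      exact (Submodule.mem_bot ℝ).1 hmem
    · refine (Submodule.starProjection_apply_eq_zero_iff (chaos X φ n)).2 ?_
      have h1 : u ∈ chaosFilt X φ (n - 1) := chaosFilt_mono X φ (by omega) hN
      exact fun v hv => by
        rw [real_inner_comm]
        exact hv.2 u h1
  simp [hz]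

/-- The operators of the minimal joint (APC) decomposition, on the space of all `p(X)φ`:
`apc X φ ε i` sends `u ∈ G_n` to the orthogonal projection of `X_i u` on `G_{n + ε}`.
It is the annihilation, preservation or creation operator of `X_i`
for `ε = -1`, `0`, `1` respectively. -/
def apc (X : ι → Module.End ℝ E) (φ : E) (ε : SignType) (i : ι) :
    Module.End ℝ (cyclicSpace X φ) where
  toFun u := ⟨∑ᶠ n : ℤ, chaosProj X φ (n + (ε : ℤ)) (X i (chaosProj X φ n (u : E))),
    finsum_induction (· ∈ cyclicSpace X φ) (Submodule.zero_mem _)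
      (fun _ _ => Submodule.add_mem _) (fun _ => chaosProj_mem X φ _ _)⟩
  map_add' u v := by
    ext
    simp only [Submodule.coe_add, map_add]
    exact finsum_add_distrib
      (chaosProj_support_finite X φ u.2 fun n => chaosProj X φ (n + (ε : ℤ)) ∘ₗ X i)
      (chaosProj_support_finite X φ v.2 fun n => chaosProj X φ (n + (ε : ℤ)) ∘ₗ X i)
  map_smul' r u := by
    ext
    simp only [Submodule.coe_smul, map_smul, RingHom.id_apply]
    exact (smul_finsum r _).symm

/-- The real span `W` of the identity and of the joint (APC) operators. -/
def apcSpan (X : ι → Module.End ℝ E) (φ : E) :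
    Submodule ℝ (Module.End ℝ (cyclicSpace X φ)) :=
  Submodule.span ℝ ({1} ∪ {a | ∃ (ε : SignType) (i : ι), apc X φ ε i = a})

/-- `X` is a Meixner random vector of class `M_L`: the space `W`, with the commutator as a bracket,
is a Lie algebra. -/
def IsMeixnerVector (X : ι → Module.End ℝ E) (φ : E) : Prop :=
  ∀ a ∈ apcSpan X φ, ∀ b ∈ apcSpan X φ, a * b - b * a ∈ apcSpan X φ

/-- The Lie algebra `W` of a Meixner random vector of class `M_L`. -/
def apcLie {X : ι → Module.End ℝ E} {φ : E} (h : IsMeixnerVector X φ) :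
    LieSubalgebra ℝ (Module.End ℝ (cyclicSpace X φ)) :=
  { apcSpan X φ with lie_mem' := fun {a b} ha hb => h a ha b hb }

/-- The identity operator, as an element of the Lie algebra `W`. -/
def apcLie.one {X : ι → Module.End ℝ E} {φ : E} (h : IsMeixnerVector X φ) : apcLie h :=
  ⟨1, Submodule.subset_span (Or.inl rfl)⟩

/-- The joint (APC) operators, as elements of the Lie algebra `W`. -/
def apcLie.op {X : ι → Module.End ℝ E} {φ : E} (h : IsMeixnerVector X φ) (ε : SignType) (i : ι) :
    apcLie h :=
  ⟨apc X φ ε i, Submodule.subset_span (Or.inr ⟨ε, i, rfl⟩)⟩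

end NonCommutative

/-! ## Meixner random variables, through their Szegő–Jacobi parameters -/

/-- The monic polynomials `f_{n+1} = (x - α_n) f_n - ω_n f_{n-1}`, `f_0 = 1`, `f_{-1} = 0`. -/
def jacobiPoly (α ω : ℕ → ℝ) : ℕ → Polynomial ℝ
  | 0 => 1
  | 1 => Polynomial.X - Polynomial.C (α 0)
  | n + 2 => (Polynomial.X - Polynomial.C (α (n + 1))) * jacobiPoly α ω (n + 1)
      - Polynomial.C (ω (n + 1)) * jacobiPoly α ω n

/-- `α`, `ω` are Szegő–Jacobi parameters of the distribution `μ`: the monic polynomials given by the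
recursion are its orthogonal polynomials.  (If `μ` has exactly `k` atoms and no other mass, this
forces `f_k = 0` almost everywhere.) -/
def HasSzegoJacobi (μ : Measure ℝ) (α ω : ℕ → ℝ) : Prop :=
  ∀ m n, m ≠ n → ∫ x, (jacobiPoly α ω m).eval x * (jacobiPoly α ω n).eval x ∂μ = 0

/-- `μ` is carried by exactly `k` points, each of positive probability. -/
def HasExactlyAtoms (μ : Measure ℝ) (k : ℕ) : Prop :=
  ∃ s : Finset ℝ, s.card = k ∧ μ (s : Set ℝ)ᶜ = 0 ∧ ∀ x ∈ s, μ {x} ≠ 0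

/-- Meixner distributions of class `M_{u,f}`. -/
def IsMeixnerUnbounded (μ : Measure ℝ) (α α₀ β t : ℝ) : Prop :=
  (∀ s : Finset ℝ, μ (s : Set ℝ)ᶜ ≠ 0) ∧ 0 ≤ β ∧ 0 < t ∧ (α ≠ 0 ∨ (α = 0 ∧ β = 0)) ∧
    HasSzegoJacobi μ (fun n => α * n + α₀) (fun n => β * n ^ 2 + (t - β) * n)

/-- Meixner distributions of class `M_{b,f}`, taking exactly `k` values
(non-symmetric binomials). -/
def IsMeixnerBounded (μ : Measure ℝ) (k : ℕ) (α α₀ β t : ℝ) : Prop :=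
  HasExactlyAtoms μ k ∧ (2 ≤ k → 0 < t) ∧ α ≠ 0 ∧ t = -β * ((k : ℝ) - 1) ∧
    HasSzegoJacobi μ (fun n => if n < k then α * n + α₀ else 0)
      (fun n => if n < k then β * n ^ 2 + (t - β) * n else 0)

/-- `μ` is the distribution of a Meixner random variable of class `M_L = M_{u,f} ∪ M_{b,f}` with
parameters `α`, `α₀`, `β`, `t`.  Its mean is `α₀`. -/
structure IsMeixnerML (μ : Measure ℝ) (α α₀ β t : ℝ) : Prop where
  prob : IsProbabilityMeasure μ
  moments : ∀ n : ℕ, Integrable (fun x => x ^ n) μ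
  params : IsMeixnerUnbounded μ α α₀ β t ∨ ∃ k, IsMeixnerBounded μ k α α₀ β t

/-! ## Multiplication operators by the coordinates on `L²` -/

section Classical

variable {ι : Type*}

/-- The subspace of polynomial functions of `L²(ℝ^ι, ν)`. -/
def polySpace (ν : Measure (ι → ℝ)) : Submodule ℝ (Lp ℝ 2 ν) where
  carrier := {f | ∃ P : MvPolynomial ι ℝ, f =ᵐ[ν] fun x => MvPolynomial.eval x P}
  zero_mem' := ⟨0, by
    filter_upwards [Lp.coeFn_zero ℝ 2 ν] with x h
    simpa using h⟩
  add_mem' := by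
    rintro f g ⟨P, hP⟩ ⟨Q, hQ⟩
    refine ⟨P + Q, ?_⟩
    filter_upwards [Lp.coeFn_add f g, hP, hQ] with x h1 h2 h3
    rw [map_add, ← h2, ← h3]
    exact h1
  smul_mem' := by
    rintro r f ⟨P, hP⟩
    refine ⟨MvPolynomial.C r * P, ?_⟩
    filter_upwards [Lp.coeFn_smul r f, hP] with x h1 h2
    rw [map_mul, MvPolynomial.eval_C, ← h2]
    exact h1

/-- All polynomial functions are square integrable. -/
def HasPolyMoments (ν : Measure (ι → ℝ)) : Prop :=
  ∀ P : MvPolynomial ι ℝ, MemLp (fun x => MvPolynomial.eval x P) 2 ν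

lemma memLp_coord_mul {ν : Measure (ι → ℝ)} (hν : HasPolyMoments ν) (i : ι) (f : polySpace ν) :
    MemLp (fun x => x i * (f : Lp ℝ 2 ν) x) 2 ν := by
  obtain ⟨f, P, hP⟩ := f
  refine (hν (MvPolynomial.X i * P)).ae_eq ?_
  filter_upwards [hP] with x h
  simp [h]

/-- Multiplication by the coordinate `x_i`, on polynomial functions. -/
def mulCoord {ν : Measure (ι → ℝ)} (hν : HasPolyMoments ν) (i : ι) :
    Module.End ℝ (polySpace ν) where
  toFun f := ⟨(memLp_coord_mul hν i f).toLp _, by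
    obtain ⟨P, hP⟩ := f.2
    refine ⟨MvPolynomial.X i * P, ?_⟩
    filter_upwards [(memLp_coord_mul hν i f).coeFn_toLp, hP] with x h1 h2
    simp [h1, h2]⟩
  map_add' f g := by
    ext1
    apply Lp.ext
    filter_upwards [(memLp_coord_mul hν i (f + g)).coeFn_toLp,
      (memLp_coord_mul hν i f).coeFn_toLp, (memLp_coord_mul hν i g).coeFn_toLp,
      Lp.coeFn_add (f : Lp ℝ 2 ν) g,
      Lp.coeFn_add ((memLp_coord_mul hν i f).toLp _) ((memLp_coord_mul hν i g).toLp _)]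
      with x h1 h2 h3 h4 h5
    simp only [Submodule.coe_add] at *
    rw [h1, h5, Pi.add_apply, h2, h3, h4, Pi.add_apply, mul_add]
  map_smul' r f := by
    ext1
    apply Lp.ext
    filter_upwards [(memLp_coord_mul hν i (r • f)).coeFn_toLp,
      (memLp_coord_mul hν i f).coeFn_toLp, Lp.coeFn_smul r (f : Lp ℝ 2 ν),
      Lp.coeFn_smul r ((memLp_coord_mul hν i f).toLp _)] with x h1 h2 h3 h4
    simp only [Submodule.coe_smul, RingHom.id_apply] at *
    rw [h1, h4, Pi.smul_apply, h2, h3, Pi.smul_apply, smul_eq_mul, smul_eq_mul]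
    ring

/-- The constant function `1`. -/
def polyOne {ν : Measure (ι → ℝ)} (hν : HasPolyMoments ν) : polySpace ν :=
  ⟨(hν 1).toLp _, 1, (hν 1).coeFn_toLp⟩

lemma hasPolyMoments_pi [Fintype ι] (μ : ι → Measure ℝ) (hp : ∀ i, IsProbabilityMeasure (μ i))
    (h : ∀ i, ∀ n : ℕ, Integrable (fun x => x ^ n) (μ i)) : HasPolyMoments (Measure.pi μ) := by
  intro P
  induction P using MvPolynomial.induction_on' with
  | add p q hp hq =>
    have h2 := hp.add hq
    simp only [map_add]
    exact h2
  | monomial u a =>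
    have hmeas : AEStronglyMeasurable (fun x : ι → ℝ => MvPolynomial.eval x
        (MvPolynomial.monomial u a)) (Measure.pi μ) :=
      (MvPolynomial.continuous_eval _).aestronglyMeasurable
    rw [memLp_two_iff_integrable_sq hmeas]
    have hint : Integrable (fun x : ι → ℝ => ∏ i, x i ^ (2 * u i)) (Measure.pi μ) :=
      Integrable.fintype_prod (f := fun i (y : ℝ) => y ^ (2 * u i)) fun i => h i _
    refine (hint.const_mul (a ^ 2)).congr (Filter.Eventually.of_forall fun x => ?_)
    simp [MvPolynomial.eval_monomial, Finsupp.prod_fintype, mul_pow, ← Finset.prod_pow, ← pow_mul,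
      mul_comm]

end Classical

/-! ## Two independent Meixner random variables with mixed preservation operators -/

/-- The data: two distributions `μ 0`, `μ 1`, of centered Meixner random variables `T`, `Z` of class
`M_L`, and the coefficients. -/
structure MixedMeixner where
  (c d j k p r s v : ℝ)
  (μ : Fin 2 → Measure ℝ)
  orth₁ : c * s + d * v = 0
  orth₂ : j * p + k * r = 0
  meixnerT : IsMeixnerML (μ 0) 1 0 ((c * p + d * r) / 2) 1
  meixnerZ : IsMeixnerML (μ 1) 1 0 ((j * s + k * v) / 2) 1

namespace MixedMeixner

variable (M : MixedMeixner)

/-- The joint distribution of the independent random variables `T` and `Z`. -/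
def joint : Measure (Fin 2 → ℝ) := Measure.pi M.μ

lemma polyMoments : HasPolyMoments M.joint :=
  hasPolyMoments_pi M.μ
    (fun i => by
      fin_cases i
      · exact M.meixnerT.prob
      · exact M.meixnerZ.prob)
    (fun i => by
      fin_cases i
      · exact M.meixnerT.moments
      · exact M.meixnerZ.moments)

/-- `T = base 0` and `Z = base 1`, as multiplication operators on the polynomial functions
in `L²(ℝ², joint)`. -/
def base : Fin 2 → Module.End ℝ (polySpace M.joint) := mulCoord M.polyMoments

/-- The space on which the joint (APC) operators of `(T, Z)` act. -/
def Space : Type := cyclicSpace M.base (polyOne M.polyMoments)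

instance : NormedAddCommGroup M.Space :=
  inferInstanceAs (NormedAddCommGroup (cyclicSpace M.base (polyOne M.polyMoments)))

instance : InnerProductSpace ℝ M.Space :=
  inferInstanceAs (InnerProductSpace ℝ (cyclicSpace M.base (polyOne M.polyMoments)))

/-- The vacuum vector: the constant function `1`. -/
def vac : M.Space :=
  (⟨polyOne M.polyMoments, vac_mem_cyclicSpace _ _⟩ :
    cyclicSpace M.base (polyOne M.polyMoments))

/-- The joint (APC) operators of `(T, Z)`. -/
def a (ε : SignType) (i : Fin 2) : Module.End ℝ M.Space :=
  apc M.base (polyOne M.polyMoments) ε i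

/-- The pair with mixed preservation operators:
`X = a_t⁻ + (p a_t⁰ + s a_z⁰) + a_t⁺` and `Y = a_z⁻ + (r a_t⁰ + v a_z⁰) + a_z⁺`. -/
def pair : Fin 2 → Module.End ℝ M.Space :=
  ![M.a (-1) 0 + (M.p • M.a 0 0 + M.s • M.a 0 1) + M.a 1 0,
    M.a (-1) 1 + (M.r • M.a 0 0 + M.v • M.a 0 1) + M.a 1 1]

end MixedMeixner

end

/-!
The idea is that the Lie algebra `W(X, Y)` determines the moments, and that it can be normalized far
enough to be recognized as that of an explicit model.

*Moments and Lie algebras.* For symmetric operators the inner products of the vectors `p(X) φ` are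
moments, so moment equality is the same as an isometry of the cyclic spaces that intertwines the
operators; it then intertwines the chaos spaces and the joint operators as well, and conjugation by
it is an isomorphism of the Lie algebras (`exists_lieEquiv_of_momentEqual`). Conversely, given the
commutation relations and the action of the joint operators on the vacuum, normal ordering brings
every word applied to the vacuum to a combination of words in the creation operators, in the same
way on both sides; and a nonempty word in the creation operators gives a vector orthogonal to the
vacuum. Instead of computing with words, `wordRelation_invariant` shows that a linear relation
between the two spaces is invariant (`momentEqual_of_lieEquiv`). This is the second part.

*Normalization.* The commutator of two joint operators is homogeneous for the grading by the chaos
spaces, so it is a combination of the generators of its own degree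
(`exists_coefficients_of_hasDegree`). Hence the creation operators commute, and the preservation
operators commute: their commutator is skew-adjoint, and self-adjoint as an element of degree `0`.
The latter are therefore simultaneously diagonalizable on the plane of the vectors `X φ`, `Y φ`, and
a linear transformation `S` achieves that this basis consists of eigenvectors
(`exists_isDiagonalMeixner`). The Jacobi identity then shows that `[a_x⁻, a_y⁺]` commutes with both
creation operators, and gives the two orthogonality relations of the coefficients
(`coeff_orthogonal`). So the vectors `(a_x⁺)^m (a_y⁺)^n φ` are eigenvectors of the preservation
operators, and the annihilation operators lower them with coefficients `β m² + (1 - β) m`, where `β`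
depends on the operator.

*The model.* The squared norms of the vectors `(a_x⁺)^m φ` are products of these coefficients; being
nonnegative they force `β ≥ 0`, or `β = -1 / (k - 1)` for an integer `k ≥ 2`
(`meixner_parameter_cases`). For exactly these `β` there are Meixner distributions with `α = t = 1`;
they are constructed from Jacobi matrices (`exists_measure_of_jacobi_pos`,
`exists_truncated_measure`). In the model the products `f_m(t) g_n(z)` of orthogonal polynomials
satisfy the same recursions (`MixedMeixner.exists_grid`), and so the moments agree
(`IsDiagonalMeixner.exists_momentEqual`).
-/

noncomputable section

/-! ### Chaos spaces and the joint operators -/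

section Chaos

variable {E : Type*} [NormedAddCommGroup E] [InnerProductSpace ℝ E] {ι : Type*}
variable {X : ι → Module.End ℝ E} {φ : E}

lemma apply_mem_chaosFilt (i : ι) {n : ℤ} {u : E} (hu : u ∈ chaosFilt X φ n) :
    X i u ∈ chaosFilt X φ (n + 1) := by
  have hle : chaosFilt X φ n ≤ (chaosFilt X φ (n + 1)).comap (X i) := by
    rw [chaosFilt, Submodule.span_le]
    rintro _ ⟨w, hw, rfl⟩
    exact Submodule.subset_span ⟨i :: w, by simpa using hw, by simp⟩
  exact hle hu

lemma apply_mem_cyclicSpace (i : ι) {u : E} (hu : u ∈ cyclicSpace X φ) :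
    X i u ∈ cyclicSpace X φ := by
  obtain ⟨n, hn⟩ := exists_mem_chaosFilt X φ hu
  exact chaosFilt_le_cyclicSpace X φ _ (apply_mem_chaosFilt i hn)

lemma vac_mem_chaosFilt_zero (X : ι → Module.End ℝ E) (φ : E) : φ ∈ chaosFilt X φ 0 :=
  Submodule.subset_span ⟨[], by simp, by simp⟩

lemma vac_mem_chaos_zero (X : ι → Module.End ℝ E) (φ : E) : φ ∈ chaos X φ 0 := by
  refine ⟨vac_mem_chaosFilt_zero X φ, ?_⟩
  rw [chaosFilt_of_neg X φ (by norm_num)]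
  simp

lemma inner_chaosFilt_chaos {m n : ℤ} (h : m < n) {u v : E} (hu : u ∈ chaosFilt X φ m)
    (hv : v ∈ chaos X φ n) : ⟪u, v⟫_ℝ = 0 :=
  hv.2 u (chaosFilt_mono X φ (by omega) hu)

lemma inner_chaos_of_ne {m n : ℤ} (h : m ≠ n) {u v : E} (hu : u ∈ chaos X φ m)
    (hv : v ∈ chaos X φ n) : ⟪u, v⟫_ℝ = 0 := by
  rcases h.lt_or_gt with h | h
  · exact inner_chaosFilt_chaos h hu.1 hv
  · rw [real_inner_comm]
    exact inner_chaosFilt_chaos h hv.1 hu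

lemma chaosFilt_zero : chaosFilt X φ 0 = Submodule.span ℝ {φ} := by
  refine le_antisymm ?_ ?_
  · rw [chaosFilt, Submodule.span_le]
    rintro _ ⟨w, hw, rfl⟩
    have : w = [] := List.length_eq_zero_iff.1 (by omega)
    subst this
    simp
  · rw [Submodule.span_singleton_le_iff_mem]
    exact vac_mem_chaosFilt_zero X φ

lemma apply_vac_mem_chaos_one (hc : IsCentered X φ) (i : ι) : X i φ ∈ chaos X φ 1 := by
  refine ⟨by simpa using apply_mem_chaosFilt i (vac_mem_chaosFilt_zero X φ), ?_⟩
  rw [sub_self, chaosFilt_zero]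
  refine Submodule.mem_orthogonal_singleton_iff_inner_right.2 ?_
  rw [real_inner_comm]
  exact hc i

variable [Finite ι]

lemma chaosProj_mem_chaos (n : ℤ) (u : E) : chaosProj X φ n u ∈ chaos X φ n :=
  Submodule.starProjection_apply_mem (chaos X φ n) u

lemma chaosProj_of_mem {n : ℤ} {u : E} (hu : u ∈ chaos X φ n) : chaosProj X φ n u = u :=
  Submodule.starProjection_eq_self_iff.2 hu

lemma chaosProj_of_orthogonal {n : ℤ} {u : E} (hu : ∀ v ∈ chaos X φ n, ⟪v, u⟫_ℝ = 0) :
    chaosProj X φ n u = 0 :=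
  (Submodule.starProjection_apply_eq_zero_iff (chaos X φ n)).2 hu

lemma chaosProj_of_mem_of_ne {m n : ℤ} (h : m ≠ n) {u : E} (hu : u ∈ chaos X φ m) :
    chaosProj X φ n u = 0 :=
  chaosProj_of_orthogonal fun _ hv => inner_chaos_of_ne h.symm hv hu

lemma chaosProj_of_mem_chaosFilt {m n : ℤ} (h : m < n) {u : E} (hu : u ∈ chaosFilt X φ m) :
    chaosProj X φ n u = 0 :=
  chaosProj_of_orthogonal fun _ hv => by
    rw [real_inner_comm]
    exact inner_chaosFilt_chaos h hu hv

lemma inner_chaosProj_left (n : ℤ) (u : E) {v : E} (hv : v ∈ chaos X φ n) :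
    ⟪chaosProj X φ n u, v⟫_ℝ = ⟪u, v⟫_ℝ := by
  have h := Submodule.inner_starProjection_left_eq_right (chaos X φ n) u v
  change ⟪chaosProj X φ n u, v⟫_ℝ = ⟪u, chaosProj X φ n v⟫_ℝ at h
  rw [h, chaosProj_of_mem hv]

/-- Splitting off the top chaos component of an element of `F_n` leaves an element of `F_{n-1}`. -/
lemma sub_chaosProj_mem_chaosFilt {n : ℤ} {u : E} (hu : u ∈ chaosFilt X φ n) :
    u - chaosProj X φ n u ∈ chaosFilt X φ (n - 1) := by
  set P := (chaosFilt X φ (n - 1)).starProjection u with hP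
  have hPm : P ∈ chaosFilt X φ (n - 1) := Submodule.starProjection_apply_mem _ _
  have h1 : u - P ∈ chaos X φ n :=
    ⟨Submodule.sub_mem _ hu (chaosFilt_mono X φ (by omega) hPm),
      Submodule.sub_starProjection_mem_orthogonal u⟩
  have h2 : chaosProj X φ n u = u - P := by
    have h3 := chaosProj_of_mem h1
    rwa [map_sub, chaosProj_of_mem_chaosFilt (by omega) hPm, sub_zero] at h3
  rw [h2, sub_sub_cancel]
  exact hPm

/-- The chaos spaces span the cyclic space. -/
lemma cyclicSpace_le_of_chaos_le {K : Submodule ℝ E} (h : ∀ n, chaos X φ n ≤ K) :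
    cyclicSpace X φ ≤ K := by
  have key : ∀ N : ℕ, chaosFilt X φ ((N : ℤ) - 1) ≤ K := by
    intro N
    induction N with
    | zero => rw [chaosFilt_of_neg X φ (by norm_num)]; exact bot_le
    | succ N ih =>
      intro u hu
      have h1 := sub_chaosProj_mem_chaosFilt hu
      have h2 : u - chaosProj X φ ((N + 1 : ℕ) - 1 : ℤ) u ∈ K :=
        ih (chaosFilt_mono X φ (by push_cast; omega) h1)
      simpa using Submodule.add_mem _ h2 (h _ (chaosProj_mem_chaos ((N + 1 : ℕ) - 1 : ℤ) u))
  intro u hu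
  obtain ⟨N, hN⟩ := exists_mem_chaosFilt X φ hu
  exact key (N + 1).toNat (chaosFilt_mono X φ (by omega) hN)

/-- Two linear maps that agree on every chaos space are equal. -/
lemma cyclicSpace_hom_ext {M : Type*} [AddCommGroup M] [Module ℝ M]
    {T T' : cyclicSpace X φ →ₗ[ℝ] M}
    (h : ∀ (n : ℤ) (u : cyclicSpace X φ), (u : E) ∈ chaos X φ n → T u = T' u) : T = T' := by
  have hle : cyclicSpace X φ ≤ (LinearMap.eqLocus T T').map (cyclicSpace X φ).subtype := by
    refine cyclicSpace_le_of_chaos_le fun n u hu => ?_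
    have hu' := chaosFilt_le_cyclicSpace X φ n hu.1
    exact ⟨⟨u, hu'⟩, h n ⟨u, hu'⟩ hu, rfl⟩
  ext u
  obtain ⟨v, hv, hvu⟩ := hle u.2
  have : v = u := Subtype.ext hvu
  exact this ▸ hv

lemma apc_apply_of_mem_chaos (ε : SignType) (i : ι) {n : ℤ} {u : cyclicSpace X φ}
    (hu : (u : E) ∈ chaos X φ n) :
    (apc X φ ε i u : E) = chaosProj X φ (n + (ε : ℤ)) (X i u) := by
  change ∑ᶠ m : ℤ, chaosProj X φ (m + (ε : ℤ)) (X i (chaosProj X φ m (u : E))) = _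
  rw [finsum_eq_single _ n, chaosProj_of_mem hu]
  intro m hm
  rw [chaosProj_of_mem_of_ne hm.symm hu, map_zero, map_zero]

lemma apc_mem_chaos (ε : SignType) (i : ι) {n : ℤ} {u : cyclicSpace X φ}
    (hu : (u : E) ∈ chaos X φ n) : (apc X φ ε i u : E) ∈ chaos X φ (n + (ε : ℤ)) := by
  rw [apc_apply_of_mem_chaos ε i hu]
  exact chaosProj_mem_chaos _ _

/-- A creation operator produces vectors orthogonal to the vacuum. -/
lemma inner_apc_one_vac (i : ι) (u : cyclicSpace X φ) : ⟪(apc X φ 1 i u : E), φ⟫_ℝ = 0 := by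
  have h : (innerₗ E φ ∘ₗ (cyclicSpace X φ).subtype ∘ₗ apc X φ 1 i) = 0 := by
    refine cyclicSpace_hom_ext fun n u hu => ?_
    change ⟪φ, (apc X φ 1 i u : E)⟫_ℝ = 0
    rcases lt_or_ge n 0 with hn | hn
    · have h0 : (u : E) = 0 := by
        have h1 : (u : E) ∈ chaosFilt X φ n := hu.1
        rwa [chaosFilt_of_neg X φ hn, Submodule.mem_bot] at h1
      have h0' : u = 0 := Subtype.ext h0
      simp [h0']
    · refine inner_chaosFilt_chaos (m := 0) ?_ (vac_mem_chaosFilt_zero X φ)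
        (apc_mem_chaos 1 i hu)
      simp only [SignType.coe_one]; omega
  rw [real_inner_comm]
  exact LinearMap.congr_fun h u

/-- The vacuum, as a vector of the cyclic space. -/
abbrev cyclicVac (X : ι → Module.End ℝ E) (φ : E) : cyclicSpace X φ :=
  ⟨φ, vac_mem_cyclicSpace X φ⟩

lemma apc_neg_one_vac (i : ι) : apc X φ (-1) i (cyclicVac X φ) = 0 := by
  have h := apc_mem_chaos (-1) i (u := cyclicVac X φ) (vac_mem_chaos_zero X φ)
  have h' : (apc X φ (-1) i (cyclicVac X φ) : E) ∈ chaosFilt X φ (0 + ((-1 : SignType) : ℤ)) := h.1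
  rw [chaosFilt_of_neg X φ (by simp), Submodule.mem_bot] at h'
  exact Subtype.ext h'

lemma apc_one_vac (hc : IsCentered X φ) (i : ι) : (apc X φ 1 i (cyclicVac X φ) : E) = X i φ := by
  rw [apc_apply_of_mem_chaos 1 i (vac_mem_chaos_zero X φ)]
  exact chaosProj_of_mem (by simpa using apply_vac_mem_chaos_one hc i)

lemma apc_zero_vac (hc : IsCentered X φ) (i : ι) : apc X φ 0 i (cyclicVac X φ) = 0 := by
  apply Subtype.ext
  rw [apc_apply_of_mem_chaos 0 i (vac_mem_chaos_zero X φ)]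
  exact chaosProj_of_mem_of_ne (m := 1) (by simp) (apply_vac_mem_chaos_one hc i)

/-- By symmetry `X_i` maps `G_n` into `G_{n-1} ⊕ G_n ⊕ G_{n+1}`; so `X_i` is the sum of its
annihilation, preservation and creation operators. -/
lemma apc_add_add (hs : ∀ i, (X i).IsSymmetric) (i : ι) (u : cyclicSpace X φ) :
    ((apc X φ (-1) i + apc X φ 0 i + apc X φ 1 i) u : E) = X i u := by
  have h : (cyclicSpace X φ).subtype ∘ₗ (apc X φ (-1) i + apc X φ 0 i + apc X φ 1 i)
      = X i ∘ₗ (cyclicSpace X φ).subtype := by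
    refine cyclicSpace_hom_ext fun n u hu => ?_
    change (apc X φ (-1) i u : E) + (apc X φ 0 i u : E) + (apc X φ 1 i u : E) = X i u
    rw [apc_apply_of_mem_chaos _ i hu, apc_apply_of_mem_chaos _ i hu,
      apc_apply_of_mem_chaos _ i hu]
    simp only [SignType.coe_one, SignType.coe_zero, SignType.coe_neg, add_zero]
    rw [← sub_eq_add_neg]
    set w := X i (u : E) with hw
    -- the components of degrees `n + 1`, `n`, `n - 1` are split off; the rest `z` is in `F_{n-2}`,
    -- and `⟪z, X_i u⟫ = ⟪X_i z, u⟫ = 0`, as `X_i z` has degree at most `n - 1`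
    have h3 : w ∈ chaosFilt X φ (n + 1) := apply_mem_chaosFilt i hu.1
    have h2 := sub_chaosProj_mem_chaosFilt h3
    rw [add_sub_cancel_right] at h2
    have h1 := sub_chaosProj_mem_chaosFilt h2
    rw [map_sub, chaosProj_of_mem_of_ne (by omega) (chaosProj_mem_chaos (n + 1) w),
      sub_zero] at h1
    have h0 := sub_chaosProj_mem_chaosFilt h1
    rw [map_sub, map_sub, chaosProj_of_mem_of_ne (by omega) (chaosProj_mem_chaos (n + 1) w),
      chaosProj_of_mem_of_ne (by omega) (chaosProj_mem_chaos n w), sub_zero, sub_zero] at h0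
    set z := w - chaosProj X φ (n + 1) w - chaosProj X φ n w - chaosProj X φ (n - 1) w with hz
    have hz0 : z = 0 := by
      rw [← inner_self_eq_zero (𝕜 := ℝ)]
      have e1 : ⟪z, w⟫_ℝ = 0 := by
        rw [hw, ← hs i z u]
        exact inner_chaosFilt_chaos (by omega) (apply_mem_chaosFilt i h0) hu
      have e2 := inner_chaosFilt_chaos (by omega) h0 (chaosProj_mem_chaos (n + 1) w)
      have e3 := inner_chaosFilt_chaos (by omega) h0 (chaosProj_mem_chaos n w)
      have e4 := inner_chaosFilt_chaos (by omega) h0 (chaosProj_mem_chaos (n - 1) w)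
      nth_rewrite 2 [hz]
      rw [inner_sub_right, inner_sub_right, inner_sub_right, e1, e2, e3, e4]
      simp
    rw [hz, sub_sub, sub_sub, sub_eq_zero] at hz0
    exact (hz0.trans (by abel)).symm
  exact LinearMap.congr_fun h u

/-- The operators `a^ε` and `a^{-ε}` are formal adjoints of each other. -/
lemma inner_apc_left (hs : ∀ i, (X i).IsSymmetric) (ε : SignType) (i : ι)
    (u v : cyclicSpace X φ) :
    ⟪apc X φ ε i u, v⟫_ℝ = ⟪u, apc X φ (-ε) i v⟫_ℝ := by
  have h : (innerₗ (cyclicSpace X φ)) ∘ₗ apc X φ ε i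
      = (LinearMap.lcomp ℝ ℝ (apc X φ (-ε) i)) ∘ₗ innerₗ (cyclicSpace X φ) := by
    refine cyclicSpace_hom_ext fun n u hu => cyclicSpace_hom_ext fun m v hv => ?_
    change ⟪(apc X φ ε i u : E), v⟫_ℝ = ⟪(u : E), apc X φ (-ε) i v⟫_ℝ
    have hcoe : ((-ε : SignType) : ℤ) = -(ε : ℤ) := by cases ε <;> rfl
    by_cases hnm : n + (ε : ℤ) = m
    · have hmn : m + ((-ε : SignType) : ℤ) = n := by rw [hcoe]; omega
      rw [apc_apply_of_mem_chaos ε i hu, apc_apply_of_mem_chaos (-ε) i hv, hnm, hmn,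
        inner_chaosProj_left m _ hv, real_inner_comm, real_inner_comm _ (u : E),
        inner_chaosProj_left n _ hu, real_inner_comm, hs i, real_inner_comm]
    · rw [inner_chaos_of_ne hnm (apc_mem_chaos ε i hu) hv,
        inner_chaos_of_ne _ hu (apc_mem_chaos (-ε) i hv)]
      rw [hcoe]; omega
  exact LinearMap.congr_fun (LinearMap.congr_fun h u) v

end Chaos

/-! ### Moment equality and isometries -/

section Transport

variable {E : Type*} [NormedAddCommGroup E] [InnerProductSpace ℝ E]
variable {E' : Type*} [NormedAddCommGroup E'] [InnerProductSpace ℝ E']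
variable {ι : Type*}
variable {X : ι → Module.End ℝ E} {φ : E} {X' : ι → Module.End ℝ E'} {φ' : E'}

/-- The adjoint of `p(X)` is obtained by reversing the words of `p`, which is the star operation of
the free algebra. -/
lemma inner_ncEval_left (hs : ∀ i, (X i).IsSymmetric) (p : FreeAlgebra ℝ ι) (u v : E) :
    ⟪ncEval X p u, v⟫_ℝ = ⟪u, ncEval X (star p) v⟫_ℝ := by
  induction p using FreeAlgebra.induction generalizing u v with
  | grade0 r =>
    simp [ncEval, Module.algebraMap_end_apply, inner_smul_left, inner_smul_right]
  | grade1 i => simpa [ncEval] using hs i u v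
  | mul a b ha hb =>
    simp only [ncEval, map_mul, star_mul, Module.End.mul_apply] at *
    rw [ha, hb]
  | add a b ha hb =>
    simp only [ncEval, map_add, star_add, LinearMap.add_apply] at *
    rw [inner_add_left, inner_add_right, ha, hb]

lemma inner_ncEval_ncEval (hs : ∀ i, (X i).IsSymmetric) (p q : FreeAlgebra ℝ ι) :
    ⟪ncEval X p φ, ncEval X q φ⟫_ℝ = expect φ (ncEval X (star q * p)) := by
  have h : ncEval X (star q * p) = ncEval X (star q) * ncEval X p := by simp [ncEval]
  have h' := inner_ncEval_left hs (star q) (ncEval X p φ) φ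
  rw [star_star] at h'
  rw [expect, h, Module.End.mul_apply, h']

lemma ncEval_mem_cyclicSpace (X : ι → Module.End ℝ E) (φ : E) (p : FreeAlgebra ℝ ι) :
    ncEval X p φ ∈ cyclicSpace X φ := ⟨p, rfl⟩

lemma exists_eq_ncEval (u : cyclicSpace X φ) :
    ∃ p, u = ⟨ncEval X p φ, ncEval_mem_cyclicSpace X φ p⟩ := by
  obtain ⟨p, hp⟩ := u.2
  exact ⟨p, Subtype.ext hp.symm⟩

/-- The linear map `p ↦ p(X) φ`, whose range is the cyclic space. -/
def ncOrbit (X : ι → Module.End ℝ E) (φ : E) : FreeAlgebra ℝ ι →ₗ[ℝ] E :=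
  (LinearMap.applyₗ φ : Module.End ℝ E →ₗ[ℝ] E) ∘ₗ (FreeAlgebra.lift ℝ X).toLinearMap

/-- The inner products of the vectors `p(X) φ` are moments, so moment equality makes
`p(X) φ ↦ p(X') φ'` a well-defined isometry. -/
lemma exists_isometry_of_momentEqual (hs : ∀ i, (X i).IsSymmetric)
    (hs' : ∀ i, (X' i).IsSymmetric) (h : MomentEqual X φ X' φ') :
    ∃ U : cyclicSpace X φ ≃ₗ[ℝ] cyclicSpace X' φ',
      (∀ u v, ⟪U u, U v⟫_ℝ = ⟪u, v⟫_ℝ) ∧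
      ∀ p : FreeAlgebra ℝ ι,
        (U ⟨ncEval X p φ, ncEval_mem_cyclicSpace X φ p⟩ : E') = ncEval X' p φ' := by
  have hin : ∀ p q, ⟪ncEval X p φ, ncEval X q φ⟫_ℝ = ⟪ncEval X' p φ', ncEval X' q φ'⟫_ℝ := by
    intro p q
    rw [inner_ncEval_ncEval hs, inner_ncEval_ncEval hs', h]
  have hker : LinearMap.ker (ncOrbit X φ) = LinearMap.ker (ncOrbit X' φ') := by
    ext p
    rw [LinearMap.mem_ker, LinearMap.mem_ker]
    change ncEval X p φ = 0 ↔ ncEval X' p φ' = 0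
    rw [← inner_self_eq_zero (𝕜 := ℝ), hin, inner_self_eq_zero]
  let U : cyclicSpace X φ ≃ₗ[ℝ] cyclicSpace X' φ' :=
    (ncOrbit X φ).quotKerEquivRange.symm ≪≫ₗ Submodule.quotEquivOfEq _ _ hker ≪≫ₗ
      (ncOrbit X' φ').quotKerEquivRange
  have hU : ∀ p : FreeAlgebra ℝ ι,
      (U ⟨ncEval X p φ, ncEval_mem_cyclicSpace X φ p⟩ : E') = ncEval X' p φ' := by
    intro p
    have hp := ncEval_mem_cyclicSpace X φ p
    have := LinearMap.quotKerEquivRange_symm_apply_image (ncOrbit X φ) p hp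
    change ((ncOrbit X' φ').quotKerEquivRange (Submodule.quotEquivOfEq _ _ hker
      ((ncOrbit X φ).quotKerEquivRange.symm ⟨ncOrbit X φ p, hp⟩)) : E') = _
    rw [this]
    rfl
  refine ⟨U, ?_, hU⟩
  intro u v
  obtain ⟨p, rfl⟩ := exists_eq_ncEval u
  obtain ⟨q, rfl⟩ := exists_eq_ncEval v
  rw [Submodule.coe_inner, Submodule.coe_inner, hU, hU, ← hin]

lemma word_eq_ncEval (X : ι → Module.End ℝ E) (w : List ι) :
    (w.map X).prod = ncEval X (w.map (FreeAlgebra.ι ℝ)).prod := by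
  simp [ncEval, map_list_prod, Function.comp_def]

variable [Finite ι]

/-- The operators of the joint decomposition, recognized from the degrees of the three parts of
`X_i u`. -/
lemma apc_eq_of_decomposition {i : ι} {n : ℤ} {u : cyclicSpace X φ} (hu : (u : E) ∈ chaos X φ n)
    (A : SignType → E) (hA : ∀ ε : SignType, A ε ∈ chaos X φ (n + (ε : ℤ)))
    (h : X i u = A (-1) + A 0 + A 1) (ε : SignType) : (apc X φ ε i u : E) = A ε := by
  have hne : ∀ δ : SignType, δ ≠ ε → chaosProj X φ (n + (ε : ℤ)) (A δ) = 0 := by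
    intro δ hδ
    refine chaosProj_of_mem_of_ne (fun h' => hδ ?_) (hA δ)
    revert h'; revert hδ
    cases δ <;> cases ε <;> simp
  rw [apc_apply_of_mem_chaos ε i hu, h, map_add, map_add]
  have h0 := chaosProj_of_mem (hA ε)
  cases ε
  · rw [hne (-1) (by decide), hne 1 (by decide)]
    rw [zero_add, add_zero]; exact h0
  · rw [hne 0 (by decide), hne 1 (by decide)]
    rw [add_zero, add_zero]; exact h0
  · rw [hne 0 (by decide), hne (-1) (by decide)]
    rw [zero_add, zero_add]; exact h0

/-- An isometry that intertwines the actions of all polynomials in `X` and `X'` on the vacuum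
vectors intertwines the joint decompositions. -/
lemma isometry_apc (hs : ∀ i, (X i).IsSymmetric)
    (U : cyclicSpace X φ ≃ₗ[ℝ] cyclicSpace X' φ') (hin : ∀ u v, ⟪U u, U v⟫_ℝ = ⟪u, v⟫_ℝ)
    (hU : ∀ p : FreeAlgebra ℝ ι,
        (U ⟨ncEval X p φ, ncEval_mem_cyclicSpace X φ p⟩ : E') = ncEval X' p φ')
    (ε : SignType) (i : ι) (u : cyclicSpace X φ) : U (apc X φ ε i u) = apc X' φ' ε i (U u) := by
  -- `U` preserves the filtrations, hence, being isometric, their orthogonal differences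
  have hword : ∀ w : List ι, (U ⟨_, word_mem_cyclicSpace X φ w⟩ : E') = (w.map X').prod φ' := by
    intro w
    have h : (⟨_, word_mem_cyclicSpace X φ w⟩ : cyclicSpace X φ)
        = ⟨_, ncEval_mem_cyclicSpace X φ (w.map (FreeAlgebra.ι ℝ)).prod⟩ :=
      Subtype.ext (LinearMap.congr_fun (word_eq_ncEval X w) φ)
    rw [h, hU, ← word_eq_ncEval]
  have hfilt : ∀ (n : ℤ) (u : cyclicSpace X φ), (u : E) ∈ chaosFilt X φ n →
      (U u : E') ∈ chaosFilt X' φ' n := by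
    intro n u hu
    have hle : chaosFilt X φ n ≤ ((chaosFilt X' φ' n).comap
        ((cyclicSpace X' φ').subtype ∘ₗ U.toLinearMap)).map (cyclicSpace X φ).subtype := by
      rw [chaosFilt, Submodule.span_le]
      rintro _ ⟨w, hw, rfl⟩
      refine ⟨⟨_, word_mem_cyclicSpace X φ w⟩, ?_, rfl⟩
      change (U ⟨_, word_mem_cyclicSpace X φ w⟩ : E') ∈ chaosFilt X' φ' n
      rw [hword]
      exact Submodule.subset_span ⟨w, hw, rfl⟩
    obtain ⟨v, hv, hvu⟩ := hle hu
    have : v = u := Subtype.ext hvu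
    exact this ▸ hv
  have hchaos : ∀ (n : ℤ) (u : cyclicSpace X φ), (u : E) ∈ chaos X φ n →
      (U u : E') ∈ chaos X' φ' n := by
    intro n u hu
    refine ⟨hfilt n u hu.1, ?_⟩
    have hle : chaosFilt X' φ' (n - 1) ≤ (ℝ ∙ (U u : E'))ᗮ := by
      rw [chaosFilt, Submodule.span_le]
      rintro _ ⟨w, hw, rfl⟩
      refine Submodule.mem_orthogonal_singleton_iff_inner_right.2 ?_
      rw [← hword]
      refine (hin u ⟨_, word_mem_cyclicSpace X φ w⟩).trans ?_
      rw [real_inner_comm]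
      exact hu.2 _ (Submodule.subset_span ⟨w, hw, rfl⟩)
    exact fun v hv => Submodule.mem_orthogonal_singleton_iff_inner_left.1 (hle hv)
  have hX : ∀ u : cyclicSpace X φ, (U ⟨X i u, apply_mem_cyclicSpace i u.2⟩ : E') = X' i (U u) := by
    intro u
    obtain ⟨p, rfl⟩ := exists_eq_ncEval u
    have h : ∀ (v : E) (hv : v ∈ cyclicSpace X φ), v = ncEval X (FreeAlgebra.ι ℝ i * p) φ →
        (U ⟨v, hv⟩ : E') = ncEval X' (FreeAlgebra.ι ℝ i * p) φ' := by
      rintro _ _ rfl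
      exact hU _
    rw [h, hU]
    · simp [ncEval]
    · simp [ncEval]
  refine LinearMap.congr_fun (f := U.toLinearMap ∘ₗ apc X φ ε i)
    (g := apc X' φ' ε i ∘ₗ U.toLinearMap) (cyclicSpace_hom_ext fun n u hu => ?_) u
  apply Subtype.ext
  refine (apc_eq_of_decomposition (hchaos n u hu) (fun ε : SignType => (U (apc X φ ε i u) : E'))
    (fun ε => hchaos _ _ (apc_mem_chaos ε i hu)) ?_ ε).symm
  rw [← hX]
  have h := apc_add_add hs i u
  have h' : (⟨X i u, apply_mem_cyclicSpace i u.2⟩ : cyclicSpace X φ)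
      = apc X φ (-1) i u + apc X φ 0 i u + apc X φ 1 i u := Subtype.ext h.symm
  rw [h', map_add, map_add]
  rfl

end Transport

/-! ### Linear transformations of a random vector -/

section LinTransform

variable {E : Type*} [NormedAddCommGroup E] [InnerProductSpace ℝ E]
variable {ι : Type*} [Fintype ι]

lemma linTransform_apply (S : Matrix ι ι ℝ) (X : ι → Module.End ℝ E) (i : ι) (u : E) :
    linTransform S X i u = ∑ j, S i j • X j u := by
  simp [linTransform, LinearMap.sum_apply]

lemma isSymmetric_linTransform {X : ι → Module.End ℝ E} (hs : ∀ i, (X i).IsSymmetric)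
    (S : Matrix ι ι ℝ) (i : ι) : (linTransform S X i).IsSymmetric := by
  intro u v
  simp only [linTransform_apply, sum_inner, inner_sum, inner_smul_left, inner_smul_right, hs _ u v]
  rfl

lemma isCentered_linTransform {X : ι → Module.End ℝ E} {φ : E} (hc : IsCentered X φ)
    (S : Matrix ι ι ℝ) : IsCentered (linTransform S X) φ := by
  intro i
  rw [expect, linTransform_apply, sum_inner]
  refine Finset.sum_eq_zero fun j _ => ?_
  have := hc j
  rw [expect] at this
  rw [inner_smul_left, this, mul_zero]

lemma chaosFilt_linTransform_le (S : Matrix ι ι ℝ) (X : ι → Module.End ℝ E) (φ : E) (n : ℤ) :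
    chaosFilt (linTransform S X) φ n ≤ chaosFilt X φ n := by
  have key : ∀ w : List ι, (w.map (linTransform S X)).prod φ ∈ chaosFilt X φ w.length := by
    intro w
    induction w with
    | nil => simpa using vac_mem_chaosFilt_zero X φ
    | cons i w ih =>
      rw [List.map_cons, List.prod_cons, Module.End.mul_apply, linTransform_apply]
      refine Submodule.sum_mem _ fun j _ => Submodule.smul_mem _ _ ?_
      simpa using apply_mem_chaosFilt j ih
  conv_lhs => rw [chaosFilt]
  rw [Submodule.span_le]
  rintro _ ⟨w, hw, rfl⟩
  exact chaosFilt_mono X φ hw (key w)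

lemma linTransform_linTransform (S T : Matrix ι ι ℝ) (X : ι → Module.End ℝ E) :
    linTransform S (linTransform T X) = linTransform (S * T) X := by
  funext i
  simp only [linTransform, Finset.smul_sum, Matrix.mul_apply, Finset.sum_smul, smul_smul]
  exact Finset.sum_comm

variable [DecidableEq ι]

lemma linTransform_one (X : ι → Module.End ℝ E) : linTransform 1 X = X := by
  funext i
  simp [linTransform, Matrix.one_apply, ite_smul]

variable (S : GL ι ℝ) (X : ι → Module.End ℝ E) (φ : E)

lemma chaosFilt_linTransform (n : ℤ) :
    chaosFilt (linTransform (S : Matrix ι ι ℝ) X) φ n = chaosFilt X φ n := by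
  refine le_antisymm (chaosFilt_linTransform_le _ X φ n) ?_
  have h := chaosFilt_linTransform_le ((S⁻¹ : GL ι ℝ) : Matrix ι ι ℝ)
    (linTransform (S : Matrix ι ι ℝ) X) φ n
  rwa [linTransform_linTransform, ← Units.val_mul, inv_mul_cancel, Units.val_one,
    linTransform_one] at h

lemma chaos_linTransform (n : ℤ) :
    chaos (linTransform (S : Matrix ι ι ℝ) X) φ n = chaos X φ n := by
  rw [chaos, chaosFilt_linTransform, chaosFilt_linTransform]
  rfl

lemma cyclicSpace_linTransform :
    cyclicSpace (linTransform (S : Matrix ι ι ℝ) X) φ = cyclicSpace X φ := by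
  apply le_antisymm
  · intro u hu
    obtain ⟨N, hN⟩ := exists_mem_chaosFilt _ φ hu
    rw [chaosFilt_linTransform] at hN
    exact chaosFilt_le_cyclicSpace X φ N hN
  · intro u hu
    obtain ⟨N, hN⟩ := exists_mem_chaosFilt _ φ hu
    rw [← chaosFilt_linTransform S] at hN
    exact chaosFilt_le_cyclicSpace _ φ N hN

lemma chaosProj_linTransform (n : ℤ) (u : E) :
    chaosProj (linTransform (S : Matrix ι ι ℝ) X) φ n u = chaosProj X φ n u := by
  symm
  refine Submodule.eq_starProjection_of_mem_of_inner_eq_zero ?_ ?_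
  · rw [← chaos_linTransform S]; exact chaosProj_mem_chaos n u
  · intro w hw
    rw [← chaos_linTransform S] at hw
    rw [inner_sub_left, inner_chaosProj_left n u hw, sub_self]

/-- The joint operators of `S(X)` are the linear combinations of those of `X` with the
coefficients of `S`. -/
lemma apc_linTransform (ε : SignType) (i : ι) (u : cyclicSpace X φ)
    (hu : (u : E) ∈ cyclicSpace (linTransform (S : Matrix ι ι ℝ) X) φ) :
    (apc (linTransform (S : Matrix ι ι ℝ) X) φ ε i ⟨u, hu⟩ : E)
      = ∑ j, (S : Matrix ι ι ℝ) i j • (apc X φ ε j u : E) := by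
  let V := LinearEquiv.ofEq _ _ (cyclicSpace_linTransform S X φ)
  have h : (cyclicSpace _ φ).subtype ∘ₗ
        apc (linTransform (S : Matrix ι ι ℝ) X) φ ε i ∘ₗ V.symm.toLinearMap
      = (cyclicSpace X φ).subtype ∘ₗ ∑ j, (S : Matrix ι ι ℝ) i j • apc X φ ε j := by
    refine cyclicSpace_hom_ext fun n u hu => ?_
    have hVu : ((V.symm u : cyclicSpace (linTransform (S : Matrix ι ι ℝ) X) φ) : E)
      ∈ chaos (linTransform (S : Matrix ι ι ℝ) X) φ n := by rwa [chaos_linTransform]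
    simp only [LinearMap.comp_apply, LinearMap.sum_apply, LinearMap.smul_apply, map_sum,
      Submodule.subtype_apply, Submodule.coe_smul, LinearEquiv.coe_coe]
    rw [apc_apply_of_mem_chaos ε i hVu, chaosProj_linTransform]
    simp only [apc_apply_of_mem_chaos ε _ hu]
    change chaosProj X φ _ (linTransform (S : Matrix ι ι ℝ) X i (u : E)) = _
    rw [linTransform_apply, map_sum]
    simp only [map_smul]
  have h' := LinearMap.congr_fun h u
  simp only [LinearMap.comp_apply, LinearMap.sum_apply, LinearMap.smul_apply, map_sum,
      Submodule.subtype_apply, Submodule.coe_smul, LinearEquiv.coe_coe] at h'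
  exact h'

end LinTransform

/-! ### Words in a Lie algebra acting on a pair of vectors -/

section WordRelation

variable {L F F' ι : Type*} [LieRing L] [LieAlgebra ℝ L] [AddCommGroup F] [Module ℝ F]
  [AddCommGroup F'] [Module ℝ F']

/-- Given two representations of a Lie algebra and a family `c` of its elements, the span of the
pairs obtained by applying the words in `c` to a pair of vectors. -/
def wordRelation (ρ : L →ₗ⁅ℝ⁆ Module.End ℝ F) (ρ' : L →ₗ⁅ℝ⁆ Module.End ℝ F') (c : ι → L)
    (v : F) (v' : F') : Submodule ℝ (F × F') :=
  Submodule.span ℝ (Set.range fun w : List ι =>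
    ((w.map fun i => ρ (c i)).prod v, (w.map fun i => ρ' (c i)).prod v'))

/-- If the Lie algebra maps the pair of vectors into the span of the words in `c`, then it leaves
this span invariant: a general element can be moved past the letters of a word, at the price of
commutators acting on shorter words. -/
lemma wordRelation_invariant (ρ : L →ₗ⁅ℝ⁆ Module.End ℝ F) (ρ' : L →ₗ⁅ℝ⁆ Module.End ℝ F')
    (c : ι → L) (v : F) (v' : F') (h : ∀ g, (ρ g v, ρ' g v') ∈ wordRelation ρ ρ' c v v')
    (g : L) : ∀ x ∈ wordRelation ρ ρ' c v v', (ρ g x.1, ρ' g x.2) ∈ wordRelation ρ ρ' c v v' := by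
  set R := wordRelation ρ ρ' c v v' with hR
  have hRC : ∀ i, R ≤ R.comap ((ρ (c i)).prodMap (ρ' (c i))) := by
    intro i
    conv_lhs => rw [hR, wordRelation]
    rw [Submodule.span_le]
    rintro _ ⟨w, rfl⟩
    exact Submodule.subset_span ⟨i :: w, by simp⟩
  have hRg : ∀ (w : List ι) (g : L), (ρ g ((w.map fun i => ρ (c i)).prod v),
      ρ' g ((w.map fun i => ρ' (c i)).prod v')) ∈ R := by
    intro w
    induction w with
    | nil => exact fun g => by simpa using h g
    | cons i w ih =>
      intro g
      have h1 := R.add_mem (hRC i (ih g)) (ih ⁅g, c i⁆)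
      convert h1 using 1
      ext <;> simp [LieRing.of_associative_ring_bracket]
  have hle : R ≤ R.comap ((ρ g).prodMap (ρ' g)) := by
    conv_lhs => rw [hR, wordRelation]
    rw [Submodule.span_le]
    rintro _ ⟨w, rfl⟩
    exact hRg w g
  exact fun x hx => hle hx

end WordRelation

/-! ### Moment equality and isomorphisms of the Lie algebras -/

section LieTransport

variable {E : Type*} [NormedAddCommGroup E] [InnerProductSpace ℝ E]
variable {E' : Type*} [NormedAddCommGroup E'] [InnerProductSpace ℝ E']
variable {ι : Type*} [Fintype ι]
variable {X : ι → Module.End ℝ E} {φ : E} {X' : ι → Module.End ℝ E'} {φ' : E'}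

lemma apc_mem_apcSpan (X : ι → Module.End ℝ E) (φ : E) (ε : SignType) (i : ι) :
    apc X φ ε i ∈ apcSpan X φ :=
  Submodule.subset_span (Or.inr ⟨ε, i, rfl⟩)

lemma one_mem_apcSpan (X : ι → Module.End ℝ E) (φ : E) : 1 ∈ apcSpan X φ :=
  Submodule.subset_span (Or.inl rfl)

/-- A linear relation between the two spaces which contains the pair of vacuum vectors, is
invariant under the two random vectors, and respects the vacuum functionals, shows that the two
random vectors are moment equal. -/
lemma momentEqual_of_relation {ι : Type*} {X : ι → Module.End ℝ E} {X' : ι → Module.End ℝ E'}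
    (R : Submodule ℝ (E × E')) (h0 : (φ, φ') ∈ R)
    (hX : ∀ i, ∀ x ∈ R, (X i x.1, X' i x.2) ∈ R)
    (hE : ∀ x ∈ R, ⟪x.1, φ⟫_ℝ = ⟪x.2, φ'⟫_ℝ) : MomentEqual X φ X' φ' := by
  have hp : ∀ p : FreeAlgebra ℝ ι, ∀ x ∈ R, (ncEval X p x.1, ncEval X' p x.2) ∈ R := by
    intro p
    induction p using FreeAlgebra.induction with
    | grade0 r =>
      intro x hx
      have h : (ncEval X (algebraMap ℝ _ r) x.1, ncEval X' (algebraMap ℝ _ r) x.2) = r • x := by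
        ext <;> simp [ncEval, Module.algebraMap_end_apply]
      rw [h]
      exact R.smul_mem r hx
    | grade1 i => simpa [ncEval] using hX i
    | mul a b ha hb =>
      intro x hx
      simpa [ncEval] using ha _ (hb x hx)
    | add a b ha hb =>
      intro x hx
      simpa [ncEval] using R.add_mem (ha x hx) (hb x hx)
  exact fun p => hE _ (hp p _ h0)

/-- The action of `X_i` on the cyclic space, as an element of `W`. -/
def apcLie.gen (hX : IsMeixnerVector X φ) (i : ι) : apcLie hX :=
  apcLie.op hX (-1) i + apcLie.op hX 0 i + apcLie.op hX 1 i

lemma apcLie.coe_gen_apply (hs : ∀ i, (X i).IsSymmetric) (hX : IsMeixnerVector X φ) (i : ι)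
    (u : cyclicSpace X φ) : ((apcLie.gen hX i : Module.End ℝ (cyclicSpace X φ)) u : E) = X i u :=
  apc_add_add hs i u

lemma apcLie.coe_sum_smul_apply (hX : IsMeixnerVector X φ) (c : ι → ℝ) (g : ι → apcLie hX)
    (u : cyclicSpace X φ) :
    (((∑ j, c j • g j : apcLie hX) : Module.End ℝ (cyclicSpace X φ)) u : E)
      = ∑ j, c j • ((g j : Module.End ℝ (cyclicSpace X φ)) u : E) := by
  rw [AddSubmonoidClass.coe_finsetSum, LinearMap.sum_apply, Submodule.coe_sum]
  rfl

variable [DecidableEq ι]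

/-- Inverting an invertible change of variables `∑ j, S i j • x j = y i`. -/
lemma eq_sum_inv_smul {M : Type*} [AddCommGroup M] [Module ℝ M] (S : GL ι ℝ) {x y : ι → M}
    (h : ∀ i, ∑ j, (S : Matrix ι ι ℝ) i j • x j = y i) (j : ι) :
    x j = ∑ i, ((S⁻¹ : GL ι ℝ) : Matrix ι ι ℝ) j i • y i := by
  have hS : ((S⁻¹ : GL ι ℝ) : Matrix ι ι ℝ) * (S : Matrix ι ι ℝ) = 1 := by
    rw [← Units.val_mul, inv_mul_cancel, Units.val_one]
  simp only [← h, Finset.smul_sum, smul_smul]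
  rw [Finset.sum_comm]
  simp only [← Finset.sum_smul, ← Matrix.mul_apply, hS]
  simp [Matrix.one_apply, ite_smul]

/-- Conjugation by a linear equivalence which intertwines the joint operators of `S(X)` and `X'`
identifies the Lie algebras `W`. -/
lemma exists_lieEquiv_of_intertwining (S : GL ι ℝ)
    (U : cyclicSpace X φ ≃ₗ[ℝ] cyclicSpace X' φ')
    (hU : ∀ ε i u, U (∑ j, (S : Matrix ι ι ℝ) i j • apc X φ ε j u) = apc X' φ' ε i (U u))
    (hX : IsMeixnerVector X φ) :
    ∃ (hX' : IsMeixnerVector X' φ') (e : apcLie hX ≃ₗ⁅ℝ⁆ apcLie hX'),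
      e (apcLie.one hX) = apcLie.one hX' ∧
      ∀ (ε : SignType) (i : ι),
        ∑ j, (S : Matrix ι ι ℝ) i j • e (apcLie.op hX ε j) = apcLie.op hX' ε i := by
  have hone : U.conj 1 = 1 := U.conj_id
  have hconj : ∀ ε i, ∑ j, (S : Matrix ι ι ℝ) i j • U.conj (apc X φ ε j) = apc X' φ' ε i := by
    intro ε i
    ext1 v
    have h := hU ε i (U.symm v)
    rw [LinearEquiv.apply_symm_apply] at h
    rw [← h]
    simp [LinearMap.sum_apply, LinearEquiv.conj_apply, map_sum]
  have hmap : (apcSpan X φ).map (U.conj : Module.End ℝ _ →ₗ[ℝ] Module.End ℝ _)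
      = apcSpan X' φ' := by
    apply le_antisymm
    · rw [Submodule.map_le_iff_le_comap, apcSpan, Submodule.span_le]
      rintro _ (rfl | ⟨ε, i, rfl⟩)
      · change U.conj 1 ∈ apcSpan X' φ'
        rw [hone]
        exact one_mem_apcSpan X' φ'
      · change U.conj (apc X φ ε i) ∈ apcSpan X' φ'
        rw [eq_sum_inv_smul S (hconj ε) i]
        exact Submodule.sum_mem _ fun j _ => Submodule.smul_mem _ _ (apc_mem_apcSpan X' φ' ε j)
    · rw [apcSpan, Submodule.span_le]
      rintro _ (rfl | ⟨ε, i, rfl⟩)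
      · exact ⟨1, one_mem_apcSpan X φ, hone⟩
      · refine ⟨∑ j, (S : Matrix ι ι ℝ) i j • apc X φ ε j,
          Submodule.sum_mem _ fun j _ => Submodule.smul_mem _ _ (apc_mem_apcSpan X φ ε j), ?_⟩
        rw [← hconj]
        simp [map_sum]
  have hX' : IsMeixnerVector X' φ' := by
    intro a ha b hb
    rw [← hmap] at ha hb ⊢
    obtain ⟨a, ha, rfl⟩ := ha
    obtain ⟨b, hb, rfl⟩ := hb
    refine ⟨a * b - b * a, hX a ha b hb, ?_⟩
    change U.conj (a * b - b * a) = U.conj a * U.conj b - U.conj b * U.conj a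
    rw [map_sub]
    exact congrArg₂ (· - ·) (U.conj_comp b a) (U.conj_comp a b)
  refine ⟨hX', U.lieConj.ofSubalgebras (apcLie hX) (apcLie hX') ?_, ?_, ?_⟩
  · ext a
    exact SetLike.ext_iff.1 hmap a
  · exact Subtype.ext hone
  · intro ε i
    apply Subtype.ext
    refine Eq.trans ?_ (hconj ε i)
    rw [AddSubmonoidClass.coe_finsetSum]
    rfl

/-- Moment equality of `S(X)` and `X'` gives an isomorphism of the Lie algebras `W`. -/
lemma exists_lieEquiv_of_momentEqual (hs : ∀ i, (X i).IsSymmetric)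
    (hs' : ∀ i, (X' i).IsSymmetric) (S : GL ι ℝ)
    (h : MomentEqual (linTransform (S : Matrix ι ι ℝ) X) φ X' φ') (hX : IsMeixnerVector X φ) :
    ∃ (hX' : IsMeixnerVector X' φ') (e : apcLie hX ≃ₗ⁅ℝ⁆ apcLie hX'),
      e (apcLie.one hX) = apcLie.one hX' ∧
      ∀ (ε : SignType) (i : ι),
        ∑ j, (S : Matrix ι ι ℝ) i j • e (apcLie.op hX ε j) = apcLie.op hX' ε i := by
  obtain ⟨U, hin, hU⟩ := exists_isometry_of_momentEqual (isSymmetric_linTransform hs _) hs' h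
  refine exists_lieEquiv_of_intertwining S
    ((LinearEquiv.ofEq _ _ (cyclicSpace_linTransform S X φ)).symm ≪≫ₗ U) (fun ε i u => ?_) hX
  rw [LinearEquiv.trans_apply, LinearEquiv.trans_apply,
    ← isometry_apc (isSymmetric_linTransform hs _) U hin hU]
  congr 1
  apply Subtype.ext
  have hu : (u : E) ∈ cyclicSpace (linTransform (S : Matrix ι ι ℝ) X) φ := by
    rw [cyclicSpace_linTransform]; exact u.2
  refine Eq.trans ?_ (apc_linTransform S X φ ε i u hu).symm
  change ((∑ j, (S : Matrix ι ι ℝ) i j • apc X φ ε j u : cyclicSpace X φ) : E) = _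
  simp

/-- `S(X)` is moment equal to itself, so its space `W` is isomorphic to that of `X`. -/
lemma isMeixnerVector_linTransform (hs : ∀ i, (X i).IsSymmetric) (S : GL ι ℝ)
    (hX : IsMeixnerVector X φ) : IsMeixnerVector (linTransform (S : Matrix ι ι ℝ) X) φ :=
  (exists_lieEquiv_of_momentEqual hs (isSymmetric_linTransform hs (S : Matrix ι ι ℝ)) S
    (fun _ => rfl) hX).1

/-- The joint operators of `X`, transported by `e`, are combinations of those of `X'` of the same
degree. -/
lemma coe_lieEquiv_op_apply (S : GL ι ℝ) (hX : IsMeixnerVector X φ) (hX' : IsMeixnerVector X' φ')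
    (e : apcLie hX ≃ₗ⁅ℝ⁆ apcLie hX')
    (hop : ∀ (ε : SignType) (i : ι),
      ∑ j, (S : Matrix ι ι ℝ) i j • e (apcLie.op hX ε j) = apcLie.op hX' ε i)
    (ε : SignType) (j : ι) (x : cyclicSpace X' φ') :
    ((e (apcLie.op hX ε j) : Module.End ℝ (cyclicSpace X' φ')) x : E')
      = ∑ i, ((S⁻¹ : GL ι ℝ) : Matrix ι ι ℝ) j i • (apc X' φ' ε i x : E') := by
  rw [eq_sum_inv_smul S (hop ε) j]
  exact apcLie.coe_sum_smul_apply hX' _ _ x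

/-- The moments are determined by the commutation relations: normal ordering turns every word in
the joint operators, applied to the vacuum, into a combination of words in the creation operators,
and the coefficients depend only on the Lie algebra. -/
lemma momentEqual_of_lieEquiv (hs : ∀ i, (X i).IsSymmetric) (hs' : ∀ i, (X' i).IsSymmetric)
    (hc : IsCentered X φ) (hc' : IsCentered X' φ') (hφ : ‖φ‖ = 1) (hφ' : ‖φ'‖ = 1)
    (S : GL ι ℝ) (hX : IsMeixnerVector X φ) (hX' : IsMeixnerVector X' φ')
    (e : apcLie hX ≃ₗ⁅ℝ⁆ apcLie hX') (hone : e (apcLie.one hX) = apcLie.one hX')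
    (hop : ∀ (ε : SignType) (i : ι),
      ∑ j, (S : Matrix ι ι ℝ) i j • e (apcLie.op hX ε j) = apcLie.op hX' ε i) :
    MomentEqual (linTransform (S : Matrix ι ι ℝ) X) φ X' φ' := by
  let ρ := (apcLie hX).incl
  let ρ' := (apcLie hX').incl.comp (e : apcLie hX →ₗ⁅ℝ⁆ apcLie hX')
  let R := wordRelation ρ ρ' (apcLie.op hX 1) (cyclicVac X φ) (cyclicVac X' φ')
  have h0 : (cyclicVac X φ, cyclicVac X' φ') ∈ R := Submodule.subset_span ⟨[], rfl⟩
  have hzero : ∀ ε i, (∀ j, apc X' φ' ε j (cyclicVac X' φ') = 0) →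
      (e (apcLie.op hX ε i) : Module.End ℝ (cyclicSpace X' φ')) (cyclicVac X' φ') = 0 := by
    intro ε i h
    apply Subtype.ext
    rw [coe_lieEquiv_op_apply S hX hX' e hop]
    simp [h]
  -- every generator maps the pair of vacuum vectors to `0`, to itself, or to a word of length `1`
  have hbase : ∀ g : apcLie hX, (ρ g (cyclicVac X φ), ρ' g (cyclicVac X' φ')) ∈ R := by
    rintro ⟨g, hg⟩
    induction hg using Submodule.span_induction with
    | mem g hg =>
      rcases hg with rfl | ⟨ε, i, rfl⟩
      · have h1 : ρ' ⟨1, one_mem_apcSpan X φ⟩ = 1 := congrArg Subtype.val hone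
        have h2 : ρ ⟨1, one_mem_apcSpan X φ⟩ = 1 := rfl
        rw [h1, h2]
        exact h0
      · change (apc X φ ε i (cyclicVac X φ),
          (e (apcLie.op hX ε i) : Module.End ℝ (cyclicSpace X' φ')) (cyclicVac X' φ')) ∈ R
        cases ε with
        | zero =>
          have h1 := hzero 0 i (apc_zero_vac hc')
          have h2 := apc_zero_vac hc i
          rw [SignType.zero_eq_zero, h1, h2]
          exact R.zero_mem
        | neg =>
          have h1 := hzero (-1) i apc_neg_one_vac
          have h2 := apc_neg_one_vac (X := X) (φ := φ) i
          rw [SignType.neg_eq_neg_one, h1, h2]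
          exact R.zero_mem
        | pos => exact Submodule.subset_span ⟨[i], rfl⟩
    | zero =>
      have h0 : (⟨0, Submodule.zero_mem _⟩ : apcLie hX) = 0 := rfl
      rw [h0, map_zero, map_zero]
      exact R.zero_mem
    | add g g' hg hg' ih ih' =>
      have h0 : (⟨g + g', Submodule.add_mem _ hg hg'⟩ : apcLie hX) = ⟨g, hg⟩ + ⟨g', hg'⟩ := rfl
      rw [h0, map_add, map_add]
      exact R.add_mem ih ih'
    | smul r g hg ih =>
      have h0 : (⟨r • g, Submodule.smul_mem _ r hg⟩ : apcLie hX) = r • ⟨g, hg⟩ := rfl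
      rw [h0, map_smul, map_smul]
      exact R.smul_mem r ih
  have hRg := wordRelation_invariant ρ ρ' (apcLie.op hX 1) _ _ hbase
  refine momentEqual_of_relation
    (R.map ((cyclicSpace X φ).subtype.prodMap (cyclicSpace X' φ').subtype)) ⟨_, h0, rfl⟩ ?_ ?_
  · rintro i _ ⟨x, hx, rfl⟩
    have heg : e (∑ j, (S : Matrix ι ι ℝ) i j • apcLie.gen hX j) = apcLie.gen hX' i := by
      simp only [map_sum, map_smul, apcLie.gen, map_add, smul_add, Finset.sum_add_distrib, hop]
    refine ⟨_, hRg (∑ j, (S : Matrix ι ι ℝ) i j • apcLie.gen hX j) x hx, Prod.ext ?_ ?_⟩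
    · refine (apcLie.coe_sum_smul_apply hX _ _ _).trans ?_
      simp only [apcLie.coe_gen_apply hs]
      exact (linTransform_apply _ X i x.1).symm
    · exact (congrArg (fun g : apcLie hX' => ((g : Module.End ℝ (cyclicSpace X' φ')) x.2 : E'))
        heg).trans (apcLie.coe_gen_apply hs' hX' i x.2)
  · -- on both sides nonempty words in the creation operators give vectors orthogonal to the vacuum
    rintro _ ⟨x, hx, rfl⟩
    change ⟪(x.1 : E), φ⟫_ℝ = ⟪(x.2 : E'), φ'⟫_ℝ
    induction hx using Submodule.span_induction with
    | mem x hx =>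
      obtain ⟨w, rfl⟩ := hx
      cases w with
      | nil =>
        change ⟪φ, φ⟫_ℝ = ⟪φ', φ'⟫_ℝ
        rw [real_inner_self_eq_norm_sq, real_inner_self_eq_norm_sq, hφ, hφ']
      | cons i w =>
        simp only [List.map_cons, List.prod_cons]
        refine (inner_apc_one_vac i _).trans ?_
        refine Eq.symm ((congrArg (fun z => ⟪z, φ'⟫_ℝ)
          (coe_lieEquiv_op_apply S hX hX' e hop 1 i _)).trans ?_)
        rw [sum_inner]
        refine Finset.sum_eq_zero fun k _ => ?_
        rw [inner_smul_left, inner_apc_one_vac, mul_zero]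
    | zero => simp
    | add x y _ _ hx hy =>
      simp only [Prod.fst_add, Prod.snd_add, Submodule.coe_add, inner_add_left, hx, hy]
    | smul r x _ hx =>
      simp only [Prod.smul_fst, Prod.smul_snd, Submodule.coe_smul, inner_smul_left, hx]

end LieTransport

/-! ### Weak limits of measures with bounded second moments -/

section MomentLimit

open Filter Topology

lemma integrable_of_integrable_sq {α : Type*} [MeasurableSpace α] {μ : Measure α}
    [IsFiniteMeasure μ] {f : α → ℝ} (hf : AEStronglyMeasurable f μ)
    (h : Integrable (fun x => f x ^ 2) μ) : Integrable f μ :=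
  ((memLp_two_iff_integrable_sq hf).2 h).integrable (by norm_num)

/-- Truncating `f` at height `K` costs at most `C / K` in the integral if `∫ f² ≤ C`. -/
lemma abs_integral_sub_integral_clamp_le {μ : Measure ℝ} [IsProbabilityMeasure μ] {f : ℝ → ℝ}
    (hf : Continuous f) {C K : ℝ} (hK : 0 < K) (hint : Integrable (fun x => f x ^ 2) μ)
    (hC : ∫ x, f x ^ 2 ∂μ ≤ C) :
    |∫ x, f x ∂μ - ∫ x, max (-K) (min (f x) K) ∂μ| ≤ C / K := by
  have hfi := integrable_of_integrable_sq hf.aestronglyMeasurable hint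
  have hg : Integrable (fun x => max (-K) (min (f x) K)) μ := by
    refine Integrable.of_bound (by fun_prop) K (Eventually.of_forall fun x => ?_)
    rw [Real.norm_eq_abs, abs_le]
    exact ⟨le_max_left _ _, max_le (by linarith) (min_le_right _ _)⟩
  rw [← integral_sub hfi hg]
  refine (abs_integral_le_integral_abs).trans ?_
  -- where the truncation changes `f`, the difference is at most `|f| ≤ f² / K`
  calc ∫ x, |f x - max (-K) (min (f x) K)| ∂μ
      ≤ ∫ x, f x ^ 2 / K ∂μ := by
        refine integral_mono (hfi.sub hg).abs (hint.div_const K) fun x => ?_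
        simp only
        rw [le_div_iff₀ hK]
        rcases le_total (f x) K with h1 | h1
        · rw [min_eq_left h1]
          rcases le_total (-K) (f x) with h2 | h2
          · rw [max_eq_right h2, sub_self, abs_zero, zero_mul]; positivity
          · rw [max_eq_left h2, abs_of_nonpos (by linarith)]
            nlinarith
        · rw [min_eq_right h1, max_eq_right (by linarith), abs_of_nonneg (by linarith)]
          nlinarith
    _ ≤ C / K := by
        rw [integral_div]
        gcongr

/-- Weak convergence and a uniform bound on second moments give convergence of the means of a
continuous function. -/
lemma tendsto_integral_of_integral_sq_le {μs : ℕ → ProbabilityMeasure ℝ} {μ : ProbabilityMeasure ℝ}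
    (hμ : Tendsto μs atTop (𝓝 μ)) {f : ℝ → ℝ} (hf : Continuous f) {C : ℝ}
    (hC : ∀ᶠ N in atTop, Integrable (fun x => f x ^ 2) (μs N : Measure ℝ) ∧
      ∫ x, f x ^ 2 ∂(μs N : Measure ℝ) ≤ C) :
    Integrable (fun x => f x ^ 2) (μ : Measure ℝ) ∧
      Tendsto (fun N => ∫ x, f x ∂(μs N : Measure ℝ)) atTop (𝓝 (∫ x, f x ∂(μ : Measure ℝ))) := by
  have hlin : ∫⁻ x, ENNReal.ofReal (f x ^ 2) ∂(μ : Measure ℝ) ≤ ENNReal.ofReal C := by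
    refine (lintegral_le_liminf_lintegral_of_forall_isOpen_measure_le_liminf_measure
      (μs := fun N => (μs N : Measure ℝ)) (f := fun x => f x ^ 2) (hf.pow 2) (fun x => sq_nonneg _)
      (fun G hG => ProbabilityMeasure.le_liminf_measure_open_of_tendsto hμ hG)).trans ?_
    refine liminf_le_of_frequently_le' (Eventually.frequently ?_)
    filter_upwards [hC] with N hN
    rw [← ofReal_integral_eq_lintegral_ofReal hN.1 (Eventually.of_forall fun x => sq_nonneg _)]
    exact ENNReal.ofReal_le_ofReal hN.2
  have hint : Integrable (fun x => f x ^ 2) (μ : Measure ℝ) := by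
    refine ⟨by fun_prop, ?_⟩
    rw [hasFiniteIntegral_iff_ofReal (Eventually.of_forall fun x => sq_nonneg _)]
    exact hlin.trans_lt ENNReal.ofReal_lt_top
  have hle : ∫ x, f x ^ 2 ∂(μ : Measure ℝ) ≤ C := by
    obtain ⟨N, hN⟩ := hC.exists
    have hC0 : 0 ≤ C := (integral_nonneg fun x => sq_nonneg _).trans hN.2
    rw [← ofReal_integral_eq_lintegral_ofReal hint (Eventually.of_forall fun x => sq_nonneg _)]
      at hlin
    exact (ENNReal.ofReal_le_ofReal_iff hC0).1 hlin
  refine ⟨hint, ?_⟩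
  rw [Metric.tendsto_nhds]
  intro ε hε
  have hC0 : 0 ≤ C := (integral_nonneg fun x => sq_nonneg _).trans hle
  -- truncation at this height changes each of the two integrals by less than `ε / 3`
  set K : ℝ := 3 * (C + 1) / ε with hKdef
  have hK : 0 < K := by positivity
  have hCK : C / K < ε / 3 := by
    rw [hKdef, div_div_eq_mul_div, div_lt_div_iff₀ (by positivity) (by norm_num)]
    nlinarith
  let g : BoundedContinuousFunction ℝ ℝ := BoundedContinuousFunction.ofNormedAddCommGroup
    (fun x => max (-K) (min (f x) K)) (by fun_prop) K (fun x => by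
      rw [Real.norm_eq_abs, abs_le]
      exact ⟨le_max_left _ _, max_le (by linarith) (min_le_right _ _)⟩)
  have hg := (ProbabilityMeasure.tendsto_iff_forall_integral_tendsto.1 hμ) g
  rw [Metric.tendsto_nhds] at hg
  filter_upwards [hC, hg (ε / 3) (by positivity)] with N h1 h2
  have e1 := abs_integral_sub_integral_clamp_le hf hK h1.1 h1.2
  have e2 := abs_integral_sub_integral_clamp_le hf hK hint hle
  change |∫ x, max (-K) (min (f x) K) ∂(μs N : Measure ℝ)
    - ∫ x, max (-K) (min (f x) K) ∂(μ : Measure ℝ)| < ε / 3 at h2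
  rw [Real.dist_eq]
  rw [abs_lt] at h2 ⊢
  rw [abs_le] at e1 e2
  constructor <;> linarith [h2.1, h2.2, e1.1, e1.2, e2.1, e2.2]

/-- A sequence of probability measures on the line with bounded second moments has a weakly
convergent subsequence. -/
lemma exists_tendsto_subseq_of_sq_le {μs : ℕ → ProbabilityMeasure ℝ} {C : ℝ}
    (hC : ∀ N, Integrable (fun x => x ^ 2) (μs N : Measure ℝ) ∧
      ∫ x, x ^ 2 ∂(μs N : Measure ℝ) ≤ C) :
    ∃ (μ : ProbabilityMeasure ℝ) (k : ℕ → ℕ), StrictMono k ∧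
      Tendsto (μs ∘ k) atTop (𝓝 μ) := by
  let u : ℕ → NNReal := fun n => Real.toNNReal (C / ((n : ℝ) + 1) ^ 2)
  have hu : Tendsto u atTop (𝓝 0) := by
    have h1 : Tendsto (fun n : ℕ => C / ((n : ℝ) + 1) ^ 2) atTop (𝓝 0) := by
      refine Tendsto.div_atTop tendsto_const_nhds ?_
      exact (tendsto_pow_atTop two_ne_zero).comp
        (tendsto_atTop_add_const_right _ 1 tendsto_natCast_atTop_atTop)
    have h2 := (continuous_real_toNNReal.tendsto 0).comp h1
    rwa [Real.toNNReal_zero] at h2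
  let K : ℕ → Set ℝ := fun n => Metric.closedBall 0 ((n : ℝ) + 1)
  -- Prokhorov's theorem, with the tail bound `C / (n + 1)²` outside `[-(n + 1), n + 1]`
  have hcomp := isCompact_setOfPred_probabilityMeasure_mass_eq_compl_isCompact_le (E := ℝ) hu
    (K := K) (fun n => isCompact_closedBall 0 _) (Or.inl inferInstance)
  have hmem : ∀ N, μs N ∈ {μ : ProbabilityMeasure ℝ | ∀ n, μ (K n)ᶜ ≤ u n} := by
    intro N n
    have hn : (0 : ℝ) < ((n : ℝ) + 1) ^ 2 := by positivity
    have h1 : (K n)ᶜ ⊆ {x : ℝ | ((n : ℝ) + 1) ^ 2 ≤ x ^ 2} := by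
      intro x hx
      simp only [K, Set.mem_compl_iff, Metric.mem_closedBall, dist_zero_right, Real.norm_eq_abs,
        not_le] at hx
      simp only [Set.mem_ofPred_eq]
      rw [← sq_abs x]
      gcongr
    have h2 := mul_meas_ge_le_integral_of_nonneg (μ := (μs N : Measure ℝ))
      (f := fun x : ℝ => x ^ 2) (Eventually.of_forall fun x => sq_nonneg x) (hC N).1
      (((n : ℝ) + 1) ^ 2)
    have h3 : (μs N : Measure ℝ).real (K n)ᶜ ≤ C / ((n : ℝ) + 1) ^ 2 := by
      rw [le_div_iff₀ hn, mul_comm]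
      refine (mul_le_mul_of_nonneg_left (measureReal_mono h1) hn.le).trans (h2.trans (hC N).2)
    rw [← NNReal.coe_le_coe]
    exact h3.trans (Real.le_coe_toNNReal _)
  obtain ⟨μ, -, k, hk, hlim⟩ := hcomp.tendsto_subseq hmem
  exact ⟨μ, k, hk, hlim⟩

end MomentLimit

/-! ### Spectral measures of symmetric operators -/

section SpectralMeasure

variable {V : Type*} [NormedAddCommGroup V] [InnerProductSpace ℝ V] [FiniteDimensional ℝ V]

/-- The distribution of a symmetric operator on a finite-dimensional space, in the state given by a
unit vector. -/
lemma exists_spectral_measure {T : Module.End ℝ V} (hT : T.IsSymmetric) {v : V} (hv : ‖v‖ = 1) :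
    ∃ (μ : Measure ℝ) (s : Finset ℝ), IsProbabilityMeasure μ ∧ s.card ≤ Module.finrank ℝ V ∧
      μ (s : Set ℝ)ᶜ = 0 ∧ (∀ f : ℝ → ℝ, Integrable f μ) ∧
      ∀ p : Polynomial ℝ, ∫ x, p.eval x ∂μ = ⟪Polynomial.aeval T p v, v⟫_ℝ := by
  set n := Module.finrank ℝ V with hn
  let b := hT.eigenvectorBasis hn.symm
  let l := hT.eigenvalues hn.symm
  let c : Fin n → ℝ := fun i => ⟪b i, v⟫_ℝ ^ 2
  have hc : ∀ i, 0 ≤ c i := fun i => sq_nonneg _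
  let μ : Measure ℝ := ∑ i, ENNReal.ofReal (c i) • Measure.dirac (l i)
  have hint : ∀ f : ℝ → ℝ, Integrable f μ := by
    intro f
    refine integrable_finsetSum_measure.2 fun i _ => ?_
    exact (integrable_dirac (by simp)).smul_measure ENNReal.ofReal_ne_top
  have hI : ∀ f : ℝ → ℝ, ∫ x, f x ∂μ = ∑ i, c i * f (l i) := by
    intro f
    rw [integral_finsetSum_measure fun i _ =>
      (integrable_dirac (by simp)).smul_measure ENNReal.ofReal_ne_top]
    refine Finset.sum_congr rfl fun i _ => ?_
    rw [integral_smul_measure, integral_dirac, ENNReal.toReal_ofReal (hc i), smul_eq_mul]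
  have hsum : ∑ i, c i = 1 := by
    have := b.sum_sq_norm_inner_right v
    rw [hv] at this
    simpa [c] using this
  have haeval : ∀ (p : Polynomial ℝ) i, Polynomial.aeval T p (b i) = p.eval (l i) • b i := by
    intro p i
    exact Module.End.aeval_apply_of_hasEigenvector (hT.hasEigenvector_eigenvectorBasis hn.symm i)
  refine ⟨μ, Finset.univ.image l, ⟨?_⟩, ?_, ?_, hint, ?_⟩
  · simp only [μ, Measure.coe_finsetSum, Finset.sum_apply, Measure.smul_apply, measure_univ,
      smul_eq_mul, mul_one]
    rw [← ENNReal.ofReal_sum_of_nonneg fun i _ => hc i, hsum, ENNReal.ofReal_one]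
  · exact Finset.card_image_le.trans (by simp)
  · simp only [μ, Measure.coe_finsetSum, Finset.sum_apply, Measure.smul_apply, smul_eq_mul]
    refine Finset.sum_eq_zero fun i _ => ?_
    rw [Measure.dirac_apply]
    simp
  · intro p
    rw [hI]
    have h1 : Polynomial.aeval T p v = ∑ i, (⟪b i, v⟫_ℝ * p.eval (l i)) • b i := by
      conv_lhs => rw [← b.sum_repr' v]
      simp only [map_sum, map_smul, haeval, smul_smul]
    rw [h1, sum_inner]
    refine Finset.sum_congr rfl fun i _ => ?_
    rw [inner_smul_left]
    simp only [c, conj_trivial]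
    ring

lemma aeval_isSymmetric {V : Type*} [NormedAddCommGroup V] [InnerProductSpace ℝ V]
    {T : Module.End ℝ V} (hT : T.IsSymmetric) (p : Polynomial ℝ) :
    (Polynomial.aeval T p).IsSymmetric := by
  induction p using Polynomial.induction_on' with
  | add p q hp hq => rw [map_add]; exact hp.add hq
  | monomial n a =>
    rw [Polynomial.aeval_monomial, Algebra.algebraMap_eq_smul_one, smul_mul_assoc, one_mul]
    exact (hT.pow n).smul rfl

end SpectralMeasure

/-! ### Jacobi matrices and Favard's theorem -/

section Jacobi

lemma jacobiPoly_monic_natDegree (α ω : ℕ → ℝ) (n : ℕ) :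
    (jacobiPoly α ω n).Monic ∧ (jacobiPoly α ω n).natDegree = n := by
  induction n using Nat.twoStepInduction with
  | zero => simp [jacobiPoly]
  | one =>
    simp only [jacobiPoly]
    exact ⟨Polynomial.monic_X_sub_C _, Polynomial.natDegree_X_sub_C _⟩
  | more n ih1 ih2 =>
    rw [jacobiPoly]
    have hm : ((Polynomial.X - Polynomial.C (α (n + 1))) * jacobiPoly α ω (n + 1)).Monic :=
      (Polynomial.monic_X_sub_C _).mul ih2.1
    have hd : ((Polynomial.X - Polynomial.C (α (n + 1))) * jacobiPoly α ω (n + 1)).natDegree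
        = n + 2 := by
      rw [(Polynomial.monic_X_sub_C _).natDegree_mul ih2.1, Polynomial.natDegree_X_sub_C, ih2.2]
      omega
    have hlt : (Polynomial.C (ω (n + 1)) * jacobiPoly α ω n).natDegree
        < ((Polynomial.X - Polynomial.C (α (n + 1))) * jacobiPoly α ω (n + 1)).natDegree := by
      rw [hd]
      exact (Polynomial.natDegree_C_mul_le _ _).trans_lt (by omega)
    exact ⟨hm.sub_of_left (Polynomial.degree_lt_degree hlt),
      by rw [Polynomial.natDegree_sub_eq_left_of_natDegree_lt hlt, hd]⟩

lemma span_jacobiPoly (α ω : ℕ → ℝ) :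
    Submodule.span ℝ (Set.range (jacobiPoly α ω)) = ⊤ := by
  let S : Polynomial.Sequence ℝ := ⟨jacobiPoly α ω, fun i => by
    rw [Polynomial.degree_eq_natDegree (jacobiPoly_monic_natDegree α ω i).1.ne_zero,
      (jacobiPoly_monic_natDegree α ω i).2]⟩
  refine S.span fun i => ?_
  have h : (S i).leadingCoeff = 1 := (jacobiPoly_monic_natDegree α ω i).1
  rw [h]
  exact isUnit_one

variable (α ω : ℕ → ℝ) (N : ℕ)

/-- The `m`-th coordinate vector; it is `0` for `m ≥ N`. -/
def coordVec (m : ℕ) : EuclideanSpace ℝ (Fin N) :=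
  WithLp.toLp 2 fun i => if (i : ℕ) = m then 1 else 0

/-- The truncated Jacobi matrix, with diagonal `α` and off-diagonal entries `√ω`. -/
def jacobiMatrix : Matrix (Fin N) (Fin N) ℝ := fun i j =>
  if (i : ℕ) = j then α i else if (i : ℕ) = j + 1 then √(ω i) else
    if (j : ℕ) = i + 1 then √(ω j) else 0

lemma jacobiMatrix_isSymmetric :
    (Matrix.toEuclideanLin (jacobiMatrix α ω N)).IsSymmetric := by
  rw [Matrix.isSymmetric_toEuclideanLin_iff]
  ext i j
  simp only [Matrix.conjTranspose_apply, star_trivial, jacobiMatrix]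
  grind

lemma jacobiMatrix_coordVec {m : ℕ} (hm : m < N) :
    Matrix.toEuclideanLin (jacobiMatrix α ω N) (coordVec N m)
      = √(ω (m + 1)) • coordVec N (m + 1) + α m • coordVec N m
        + (if m = 0 then 0 else √(ω m) • coordVec N (m - 1)) := by
  ext i
  have h : ∀ j : Fin N, ((j : ℕ) = m) = (j = ⟨m, hm⟩) := fun j => by simp [Fin.ext_iff]
  simp only [Matrix.toEuclideanLin, coordVec]
  simp [Matrix.mulVec, dotProduct, h, jacobiMatrix]
  split_ifs <;> simp <;> grind

/-- The recursion of the polynomials is that of the Jacobi matrix, up to the normalization of the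
coordinate vectors; for `m = N` the coordinate vector is `0`, in accordance with the theorem of
Cayley and Hamilton. -/
lemma aeval_jacobiPoly_coordVec (hω : ∀ m, 0 < m → m < N → 0 ≤ ω m) {m : ℕ} (hm : m ≤ N)
    (hN : 0 < N) :
    Polynomial.aeval (Matrix.toEuclideanLin (jacobiMatrix α ω N)) (jacobiPoly α ω m) (coordVec N 0)
      = (∏ i ∈ Finset.range m, √(ω (i + 1))) • coordVec N m := by
  induction m using Nat.twoStepInduction with
  | zero => simp [jacobiPoly]
  | one =>
    simp [jacobiPoly, jacobiMatrix_coordVec α ω N hN, Algebra.algebraMap_eq_smul_one]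
  | more m ih1 ih2 =>
    have h1 := ih1 (by omega)
    have h2 := ih2 (by omega)
    have hsq : √(ω (m + 1)) * √(ω (m + 1)) = ω (m + 1) :=
      Real.mul_self_sqrt (hω _ (by omega) (by omega))
    rw [jacobiPoly]
    simp only [map_sub, map_mul, Polynomial.aeval_X, Polynomial.aeval_C, LinearMap.sub_apply,
      Module.End.mul_apply, h1, h2, Algebra.algebraMap_eq_smul_one, LinearMap.smul_apply,
      Module.End.one_apply, map_smul, jacobiMatrix_coordVec α ω N (show m + 1 < N by omega)]
    rw [Finset.prod_range_succ _ (m + 1), Finset.prod_range_succ _ m]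
    simp only [Nat.succ_ne_zero, if_false, Nat.add_sub_cancel, smul_smul]
    have h3 : ∀ c : ℝ, c * ω (m + 1) = c * √(ω (m + 1)) * √(ω (m + 1)) := fun c => by
      rw [mul_assoc, hsq]
    rw [h3]
    module

lemma inner_coordVec (m n : ℕ) :
    ⟪coordVec N m, coordVec N n⟫_ℝ = if m = n ∧ m < N then 1 else 0 := by
  simp only [coordVec, PiLp.inner_apply]
  split_ifs with h
  · obtain ⟨rfl, hm⟩ := h
    rw [Finset.sum_eq_single ⟨m, hm⟩]
    · simp
    · intro i _ hi
      have : (i : ℕ) ≠ m := fun h => hi (Fin.ext h)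
      simp [this]
    · simp
  · refine Finset.sum_eq_zero fun i _ => ?_
    have := i.2
    by_cases h1 : (i : ℕ) = m
    · by_cases h2 : (i : ℕ) = n
      · exact absurd ⟨h1.symm.trans h2, h1 ▸ i.2⟩ h
      · simp [h2]
    · simp [h1]

/-- The spectral distribution of the truncated Jacobi matrix in the state of the first coordinate
vector: its first `N` orthogonal polynomials are the given ones, and the next one vanishes. -/
lemma exists_truncated_measure (hω : ∀ m, 0 < m → m < N → 0 ≤ ω m) (hN : 0 < N) :
    ∃ (μ : Measure ℝ) (s : Finset ℝ), IsProbabilityMeasure μ ∧ s.card ≤ N ∧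
      μ (s : Set ℝ)ᶜ = 0 ∧ (∀ f : ℝ → ℝ, Integrable f μ) ∧
      ∀ m n, m ≤ N → n ≤ N →
        ∫ x, (jacobiPoly α ω m).eval x * (jacobiPoly α ω n).eval x ∂μ
          = if m = n ∧ m < N then ∏ i ∈ Finset.range m, ω (i + 1) else 0 := by
  have hs := jacobiMatrix_isSymmetric α ω N
  have hv : ‖coordVec N 0‖ = 1 := by
    have h := real_inner_self_eq_norm_sq (coordVec N 0)
    rw [inner_coordVec, if_pos ⟨rfl, hN⟩] at h
    exact (pow_eq_one_iff_of_nonneg (norm_nonneg _) two_ne_zero).1 h.symm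
  obtain ⟨μ, s, h1, h2, h3, h4, h5⟩ := exists_spectral_measure hs hv
  refine ⟨μ, s, h1, by simpa using h2, h3, h4, fun m n hm hn => ?_⟩
  have h6 := h5 (jacobiPoly α ω m * jacobiPoly α ω n)
  simp only [Polynomial.eval_mul, map_mul, Module.End.mul_apply] at h6
  rw [h6, aeval_isSymmetric hs, aeval_jacobiPoly_coordVec α ω N hω hm hN,
    aeval_jacobiPoly_coordVec α ω N hω hn hN, inner_smul_left, inner_smul_right, inner_coordVec]
  by_cases h : m = n
  · subst h
    by_cases h' : m < N
    · simp only [h', and_self, if_true, conj_trivial, mul_one, ← Finset.prod_mul_distrib]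
      refine Finset.prod_congr rfl fun i hi => Real.mul_self_sqrt (hω _ (by omega) ?_)
      rw [Finset.mem_range] at hi
      omega
    · simp [h']
  · have h' : ¬ n = m := fun h' => h h'.symm
    simp [h, h']

open Filter Topology

/-- **Favard's theorem**: positive parameters are Szegő–Jacobi parameters of a probability measure.
It is a weak limit of the spectral distributions of the truncated Jacobi matrices, whose moments of
each order are eventually constant. -/
lemma exists_measure_of_jacobi_pos (hω : ∀ m, 0 < m → 0 < ω m) :
    ∃ μ : Measure ℝ, IsProbabilityMeasure μ ∧
      (∀ p : Polynomial ℝ, Integrable (fun x => p.eval x) μ) ∧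
      ∀ m n, ∫ x, (jacobiPoly α ω m).eval x * (jacobiPoly α ω n).eval x ∂μ
          = if m = n then ∏ i ∈ Finset.range m, ω (i + 1) else 0 := by
  have h0 := fun N : ℕ => exists_truncated_measure α ω (N + 1)
    (fun m hm _ => (hω m hm).le) (by omega)
  choose ν s hν _ _ hint horth using h0
  -- each Jacobi polynomial has the same integral for all `N` beyond its degree, and they span
  have hconst : ∀ p : Polynomial ℝ, ∃ c, ∀ᶠ N in atTop, ∫ x, p.eval x ∂(ν N) = c := by
    intro p
    have hp : p ∈ Submodule.span ℝ (Set.range (jacobiPoly α ω)) := by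
      rw [span_jacobiPoly]; trivial
    induction hp using Submodule.span_induction with
    | mem p hp =>
      obtain ⟨m, rfl⟩ := hp
      refine ⟨if m = 0 then ∏ i ∈ Finset.range m, ω (i + 1) else 0, ?_⟩
      filter_upwards [eventually_ge_atTop m] with N hN
      have := horth N m 0 (by omega) (by omega)
      simp only [jacobiPoly, Polynomial.eval_one, mul_one] at this
      rw [this]
      have : m < N + 1 := by omega
      simp [this]
    | zero => exact ⟨0, by simp⟩
    | add p q _ _ hp hq =>
      obtain ⟨c, hc⟩ := hp
      obtain ⟨d, hd⟩ := hq
      refine ⟨c + d, ?_⟩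
      filter_upwards [hc, hd] with N h1 h2
      simp only [Polynomial.eval_add]
      rw [integral_add (hint N _) (hint N _), h1, h2]
    | smul r p _ hp =>
      obtain ⟨c, hc⟩ := hp
      refine ⟨r * c, ?_⟩
      filter_upwards [hc] with N h1
      simp only [Polynomial.eval_smul, smul_eq_mul]
      rw [integral_const_mul, h1]
  obtain ⟨C, hC⟩ := hconst (Polynomial.X ^ 2)
  obtain ⟨N₀, hN₀⟩ := eventually_atTop.1 hC
  let μs : ℕ → ProbabilityMeasure ℝ := fun N => ⟨ν (N + N₀), hν _⟩
  have hμs : ∀ N, Integrable (fun x => x ^ 2) (μs N : Measure ℝ) ∧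
      ∫ x, x ^ 2 ∂(μs N : Measure ℝ) ≤ C := by
    intro N
    refine ⟨hint _ _, le_of_eq ?_⟩
    have := hN₀ (N + N₀) (by omega)
    simp only [Polynomial.eval_pow, Polynomial.eval_X] at this
    exact this
  obtain ⟨μ, k, hk, hlim⟩ := exists_tendsto_subseq_of_sq_le hμs
  have hkt : Tendsto (fun N => k N + N₀) atTop atTop :=
    tendsto_atTop_mono (fun N => Nat.le_add_right _ _) hk.tendsto_atTop
  have hpoly : ∀ p : Polynomial ℝ, Integrable (fun x => p.eval x ^ 2) (μ : Measure ℝ) ∧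
      Tendsto (fun N => ∫ x, p.eval x ∂(ν (k N + N₀))) atTop (𝓝 (∫ x, p.eval x ∂μ)) := by
    intro p
    obtain ⟨c, hc⟩ := hconst (p ^ 2)
    refine tendsto_integral_of_integral_sq_le hlim (C := c) p.continuous ?_
    filter_upwards [hkt.eventually hc] with N hN
    refine ⟨hint _ _, le_of_eq ?_⟩
    simp only [Polynomial.eval_pow] at hN
    exact hN
  refine ⟨μ, inferInstance, fun p => integrable_of_integrable_sq
    p.continuous.aestronglyMeasurable (hpoly p).1, fun m n => ?_⟩
  have h1 := (hpoly (jacobiPoly α ω m * jacobiPoly α ω n)).2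
  simp only [Polynomial.eval_mul] at h1
  refine tendsto_nhds_unique h1 (tendsto_const_nhds.congr' ?_)
  filter_upwards [hkt.eventually (eventually_ge_atTop (max m n))] with N hN
  rw [horth _ m n ((le_max_left m n).trans (by omega)) ((le_max_right m n).trans (by omega))]
  have : m < k N + N₀ + 1 := by have := le_max_left m n; omega
  simp [this]

/-- Orthogonal functions of nonzero norm are at most as many as the points that carry `μ`. -/
lemma le_card_of_orthogonal {μ : Measure ℝ} [IsFiniteMeasure μ] {s : Finset ℝ}
    (hs : μ (s : Set ℝ)ᶜ = 0) {f : ℕ → ℝ → ℝ} {m : ℕ}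
    (hne : ∀ i < m, ∫ x, f i x * f i x ∂μ ≠ 0)
    (horth : ∀ i < m, ∀ j < m, i ≠ j → ∫ x, f i x * f j x ∂μ = 0) : m ≤ s.card := by
  have hI : ∀ g : ℝ → ℝ, ∫ x, g x ∂μ = ∑ x ∈ s, μ.real {x} * g x := by
    intro g
    have h1 : μ = μ.restrict s := by
      rw [Measure.restrict_eq_self_of_ae_mem]
      exact hs
    conv_lhs => rw [h1]
    rw [setIntegral_finset]
    · simp
    · exact IntegrableOn.finset
  let v : Fin m → EuclideanSpace ℝ s := fun i =>
    WithLp.toLp 2 fun x => √(μ.real {(x : ℝ)}) * f i x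
  have hv : ∀ i j, ⟪v i, v j⟫_ℝ = ∫ x, f i x * f j x ∂μ := by
    intro i j
    rw [hI, ← Finset.sum_coe_sort, PiLp.inner_apply]
    refine Finset.sum_congr rfl fun x _ => ?_
    have h := Real.mul_self_sqrt (measureReal_nonneg (μ := μ) (s := {(x : ℝ)}))
    simp only [v, RCLike.inner_apply, conj_trivial]
    linear_combination (f i x * f j x) * h
  have hli : LinearIndependent ℝ v := by
    refine linearIndependent_of_ne_zero_of_inner_eq_zero (fun i hi => hne i i.2 ?_)
      (fun i j hij => ?_)
    · rw [← hv, hi, inner_zero_left]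
    · refine (hv i j).trans ?_
      exact horth i i.2 j j.2 fun h => hij (Fin.ext h)
  have := hli.fintype_card_le_finrank
  simpa using this

end Jacobi

/-! ### Existence of the Meixner distributions -/

section Meixner

/-- `meixnerOmega β n = ω_n = β n² + (1 - β) n`. -/
def meixnerOmega (β : ℝ) (n : ℕ) : ℝ := β * (n : ℝ) ^ 2 + (1 - β) * n

lemma meixnerOmega_eq (β : ℝ) (n : ℕ) : meixnerOmega β n = n * (1 + β * (n - 1)) := by
  rw [meixnerOmega]; ring

lemma meixnerOmega_succ (β : ℝ) (n : ℕ) :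
    meixnerOmega β (n + 1) = meixnerOmega β n + (1 + 2 * β * n) := by
  simp only [meixnerOmega]; push_cast; ring

/-- A sequence of polynomials, starting with `1`, that is orthogonal for `μ` and satisfies, almost
everywhere, the three-term recursion with `α_n = n` and `ω_n = β n² + (1 - β) n`. -/
structure IsMeixnerSequence (μ : Measure ℝ) (β : ℝ) (f : ℕ → Polynomial ℝ) : Prop where
  zero : f 0 = 1
  orth : ∀ m n, m ≠ n → ∫ x, (f m).eval x * (f n).eval x ∂μ = 0
  rec_zero : ∀ᵐ x ∂μ, x = (f 1).eval x
  rec_succ : ∀ n : ℕ, ∀ᵐ x ∂μ, x * (f (n + 1)).eval x = (f (n + 2)).eval x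
    + ((n : ℝ) + 1) * (f (n + 1)).eval x + meixnerOmega β (n + 1) * (f n).eval x

lemma meixnerOmega_pos_of_nonneg {β : ℝ} (hβ : 0 ≤ β) {n : ℕ} (hn : 0 < n) :
    0 < meixnerOmega β n := by
  have h1 : (1 : ℝ) ≤ n := by exact_mod_cast hn
  rw [meixnerOmega_eq]
  have : 0 ≤ β * ((n : ℝ) - 1) := mul_nonneg hβ (by linarith)
  exact mul_pos (by linarith) (by linarith)

lemma meixnerOmega_pos_of_lt {β : ℝ} {k : ℕ} (hk : 2 ≤ k) (hβ : β * ((k : ℝ) - 1) = -1) {n : ℕ}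
    (hn : 0 < n) (hnk : n < k) : 0 < meixnerOmega β n := by
  have h1 : (1 : ℝ) ≤ n := by exact_mod_cast hn
  have h2 : (n : ℝ) < k := by exact_mod_cast hnk
  have h3 : (2 : ℝ) ≤ k := by exact_mod_cast hk
  rw [meixnerOmega_eq]
  have h4 : β < 0 := by nlinarith
  exact mul_pos (by linarith) (by nlinarith)

/-- For `β ≥ 0` all `ω_n` are positive and Favard's theorem applies. The orthogonal polynomials have
nonzero norms, so no finite set carries the measure. -/
lemma exists_meixner_of_nonneg {β : ℝ} (hβ : 0 ≤ β) :
    ∃ μ f, IsMeixnerML μ 1 0 β 1 ∧ IsMeixnerSequence μ β f := by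
  let α : ℕ → ℝ := fun n => 1 * n + 0
  let ω : ℕ → ℝ := fun n => β * n ^ 2 + (1 - β) * n
  have hω : ∀ m, 0 < m → 0 < ω m := fun m hm => meixnerOmega_pos_of_nonneg hβ hm
  obtain ⟨μ, hμ, hint, horth⟩ := exists_measure_of_jacobi_pos α ω hω
  have hne : ∀ m n, m ≠ n →
      ∫ x, (jacobiPoly α ω m).eval x * (jacobiPoly α ω n).eval x ∂μ = 0 := by
    intro m n h
    rw [horth, if_neg h]
  refine ⟨μ, jacobiPoly α ω, ⟨hμ, fun n => ?_, Or.inl ⟨fun s hs => ?_, hβ, one_pos,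
    Or.inl one_ne_zero, hne⟩⟩, ⟨rfl, hne, ?_, ?_⟩⟩
  · simpa using hint (Polynomial.X ^ n)
  · have := le_card_of_orthogonal hs (m := s.card + 1)
      (f := fun i x => (jacobiPoly α ω i).eval x) (fun i _ => ?_) (fun i _ j _ h => hne i j h)
    · omega
    · rw [horth, if_pos rfl]
      exact (Finset.prod_pos fun i _ => hω (i + 1) (by omega)).ne'
  · refine Filter.Eventually.of_forall fun x => ?_
    simp [jacobiPoly, α]
  · refine fun n => Filter.Eventually.of_forall fun x => ?_
    simp only [jacobiPoly, Polynomial.eval_sub, Polynomial.eval_mul, Polynomial.eval_X,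
      Polynomial.eval_C, α, ω, meixnerOmega]
    push_cast
    ring

/-- For `β = -1 / (k - 1)` the `ω_n` with `0 < n < k` are positive and `ω_k = 0`. The spectral
distribution of the `k × k` Jacobi matrix has at most `k` atoms, and exactly `k` as it has `k`
orthogonal polynomials of nonzero norm. -/
lemma exists_meixner_of_finite {β : ℝ} {k : ℕ} (hk : 2 ≤ k) (hβ : β * ((k : ℝ) - 1) = -1) :
    ∃ μ f, IsMeixnerML μ 1 0 β 1 ∧ IsMeixnerSequence μ β f := by
  let α : ℕ → ℝ := fun n => if n < k then 1 * (n : ℝ) + 0 else 0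
  let ω : ℕ → ℝ := fun n => if n < k then β * (n : ℝ) ^ 2 + (1 - β) * n else 0
  have hω' : ∀ m, m < k → ω m = meixnerOmega β m := fun m hm => by simp [ω, hm, meixnerOmega]
  have hω : ∀ m, 0 < m → m < k → 0 < ω m := fun m hm hmk => by
    rw [hω' m hmk]; exact meixnerOmega_pos_of_lt hk hβ hm hmk
  obtain ⟨μ, s, hμ, hcard, hs, hint, horth⟩ :=
    exists_truncated_measure α ω k (fun m h1 h2 => (hω m h1 h2).le) (by omega)
  set f := jacobiPoly α ω with hf
  have hzk : ∀ᵐ x ∂μ, (f k).eval x = 0 := by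
    have h := horth k k le_rfl le_rfl
    simp only [lt_irrefl, and_false, if_false] at h
    rw [integral_eq_zero_iff_of_nonneg (fun x => mul_self_nonneg _) (hint _)] at h
    filter_upwards [h] with x hx
    exact mul_self_eq_zero.1 hx
  -- all further polynomials are multiples of the one of degree `k`
  have hz : ∀ n, ∀ᵐ x ∂μ, (f (k + n)).eval x = 0 := by
    intro n
    induction n with
    | zero => exact hzk
    | succ n ih =>
      filter_upwards [ih] with x hx
      obtain ⟨l, hl⟩ : ∃ l, k + n = l + 1 := ⟨k + n - 1, by omega⟩
      have hlk : ¬ l + 1 < k := by omega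
      rw [← add_assoc, hl]
      rw [hl] at hx
      have hω0 : ω (l + 1) = 0 := by simp only [ω, if_neg hlk]
      rw [hf] at hx ⊢
      simp [jacobiPoly, hx, hω0]
  have hz' : ∀ n, k ≤ n → ∀ᵐ x ∂μ, (f n).eval x = 0 := by
    intro n hn
    obtain ⟨l, rfl⟩ := Nat.exists_eq_add_of_le hn
    exact hz l
  have hne : ∀ m n, m ≠ n → ∫ x, (f m).eval x * (f n).eval x ∂μ = 0 := by
    intro m n h
    rcases lt_or_ge m k with hm | hm
    · rcases lt_or_ge n k with hn | hn
      · rw [horth m n hm.le hn.le, if_neg (fun h' => h h'.1)]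
      · exact integral_eq_zero_of_ae (by filter_upwards [hz' n hn] with x hx; simp [hx])
    · exact integral_eq_zero_of_ae (by filter_upwards [hz' m hm] with x hx; simp [hx])
  have hk1 : (1 : ℝ) < k := by exact_mod_cast (by omega : 1 < k)
  have hωk : meixnerOmega β k = 0 := by
    rw [meixnerOmega_eq, hβ]; ring
  refine ⟨μ, f, ⟨hμ, fun n => hint _, Or.inr ⟨k, ?_, fun _ => one_pos, one_ne_zero, by linarith,
    hne⟩⟩, ⟨rfl, hne, ?_, ?_⟩⟩
  · classical
    have hs' : μ ((s.filter fun x => μ {x} ≠ 0 : Finset ℝ) : Set ℝ)ᶜ = 0 := by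
      have hsub : ((s.filter fun x => μ {x} ≠ 0 : Finset ℝ) : Set ℝ)ᶜ
          ⊆ (s : Set ℝ)ᶜ ∪ ((s.filter fun x => μ {x} = 0 : Finset ℝ) : Set ℝ) := by
        intro x hx
        by_cases hxs : x ∈ s
        · right
          simp only [Finset.coe_filter, Set.mem_compl_iff, Set.mem_ofPred_eq, not_and,
            not_not] at hx ⊢
          exact ⟨hxs, hx hxs⟩
        · left; exact hxs
      refine measure_mono_null hsub (measure_union_null hs ?_)
      rw [← Set.biUnion_of_singleton (((s.filter fun x => μ {x} = 0 : Finset ℝ)) : Set ℝ)]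
      exact (measure_biUnion_null_iff (Finset.countable_toSet _)).2 fun x hx =>
        (Finset.mem_filter.1 hx).2
    refine ⟨s.filter fun x => μ {x} ≠ 0, le_antisymm ((Finset.card_filter_le _ _).trans hcard) ?_,
      hs', fun x hx => (Finset.mem_filter.1 hx).2⟩
    refine le_card_of_orthogonal hs' (f := fun i x => (f i).eval x) (fun i hi => ?_)
      (fun i _ j _ h => hne i j h)
    rw [horth i i hi.le hi.le, if_pos ⟨rfl, hi⟩]
    refine (Finset.prod_pos fun j hj => hω (j + 1) (by omega) ?_).ne'
    rw [Finset.mem_range] at hj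
    omega
  · refine Filter.Eventually.of_forall fun x => ?_
    simp [hf, jacobiPoly, α]
  · intro n
    rcases lt_or_ge (n + 1) k with hn | hn
    · refine Filter.Eventually.of_forall fun x => ?_
      simp only [hf, jacobiPoly, Polynomial.eval_sub, Polynomial.eval_mul, Polynomial.eval_X,
        Polynomial.eval_C, α, hω' (n + 1) hn, if_pos hn]
      push_cast
      ring
    · filter_upwards [hz' (n + 1) hn, hz' (n + 2) (by omega), hz' (max n k) (le_max_right _ _)]
        with x h1 h2 h3
      rcases Nat.lt_or_ge n k with h | h
      · have : n + 1 = k := by omega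
        rw [h1, h2, this, hωk]; ring
      · rw [max_eq_left h] at h3
        rw [h1, h2, h3]; ring

end Meixner

/-! ### Doubly indexed three-term recursions -/

section Grid

variable {E : Type*} [NormedAddCommGroup E] [InnerProductSpace ℝ E]
variable {X : Fin 2 → Module.End ℝ E} {φ : E} {e : ℕ → ℕ → E} {a b w w' : ℕ → ℝ}

/-- A doubly indexed orthogonal family on which the two operators act by three-term recursions is
adapted to the chaos spaces. -/
lemma mem_chaos_of_recursion (h0 : e 0 0 = φ)
    (horth : ∀ m n m' n', m + n ≠ m' + n' → ⟪e m n, e m' n'⟫_ℝ = 0)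
    (h1 : ∀ m n, X 0 (e m n) = e (m + 1) n + a m • e m n + w m • e (m - 1) n)
    (h2 : ∀ m n, X 1 (e m n) = e m (n + 1) + b n • e m n + w' n • e m (n - 1))
    (m n : ℕ) : e m n ∈ chaos X φ ((m : ℤ) + n) := by
  let L : ℕ → Submodule ℝ E := fun N =>
    Submodule.span ℝ {v | ∃ m n, m + n ≤ N ∧ v = e m n}
  have hL : ∀ m n N, m + n ≤ N → e m n ∈ L N := fun m n N h =>
    Submodule.subset_span ⟨m, n, h, rfl⟩
  -- words of length `≤ N` lie in the span of the vectors of degree `≤ N`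
  have hXL : ∀ i N v, v ∈ L N → X i v ∈ L (N + 1) := by
    intro i N v hv
    have hle : L N ≤ (L (N + 1)).comap (X i) := by
      rw [Submodule.span_le]
      rintro _ ⟨m, n, hmn, rfl⟩
      change X i (e m n) ∈ L (N + 1)
      fin_cases i
      · change X 0 (e m n) ∈ L (N + 1)
        rw [h1]
        exact Submodule.add_mem _ (Submodule.add_mem _ (hL _ _ _ (by omega))
          (Submodule.smul_mem _ _ (hL _ _ _ (by omega))))
          (Submodule.smul_mem _ _ (hL _ _ _ (by omega)))
      · change X 1 (e m n) ∈ L (N + 1)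
        rw [h2]
        exact Submodule.add_mem _ (Submodule.add_mem _ (hL _ _ _ (by omega))
          (Submodule.smul_mem _ _ (hL _ _ _ (by omega))))
          (Submodule.smul_mem _ _ (hL _ _ _ (by omega)))
    exact hle hv
  have hword : ∀ v : List (Fin 2), (v.map X).prod φ ∈ L v.length := by
    intro v
    induction v with
    | nil => simpa [h0] using hL 0 0 0 le_rfl
    | cons i v ih => simpa using hXL i _ _ ih
  have hfilt : ∀ m n : ℕ, e m n ∈ chaosFilt X φ ((m : ℤ) + n) := by
    have key : ∀ N m n : ℕ, m + n = N → e m n ∈ chaosFilt X φ ((m : ℤ) + n) := by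
      intro N
      induction N using Nat.strong_induction_on with
      | _ N ih =>
        intro m n hmn
        rcases m with _ | m
        · rcases n with _ | n
          · rw [h0]; simpa using vac_mem_chaosFilt_zero X φ
          · have e1 := ih n (by omega) 0 n (by omega)
            have e2 := ih (n - 1) (by omega) 0 (n - 1) (by omega)
            have e3 : e 0 (n + 1) = X 1 (e 0 n) - b n • e 0 n - w' n • e 0 (n - 1) := by
              rw [h2]; abel
            rw [e3]
            refine Submodule.sub_mem _ (Submodule.sub_mem _ ?_ (Submodule.smul_mem _ _ ?_))
              (Submodule.smul_mem _ _ ?_)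
            · rw [show ((0 : ℕ) : ℤ) + (n + 1 : ℕ) = (0 : ℕ) + n + 1 by push_cast; ring]
              exact apply_mem_chaosFilt 1 e1
            · exact chaosFilt_mono X φ (by push_cast; omega) e1
            · exact chaosFilt_mono X φ (by push_cast; omega) e2
        · have e1 := ih (m + n) (by omega) m n (by omega)
          have e2 : w m • e (m - 1) n ∈ chaosFilt X φ ((m + 1 : ℕ) + n : ℤ) := by
            refine Submodule.smul_mem _ _ ?_
            exact chaosFilt_mono X φ (by push_cast; omega) (ih (m - 1 + n) (by omega) _ _ rfl)
          have e3 : e (m + 1) n = X 0 (e m n) - a m • e m n - w m • e (m - 1) n := by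
            rw [h1]; abel
          rw [e3]
          refine Submodule.sub_mem _ (Submodule.sub_mem _ ?_ (Submodule.smul_mem _ _ ?_)) e2
          · rw [show ((m + 1 : ℕ) : ℤ) + n = m + n + 1 by push_cast; ring]
            exact apply_mem_chaosFilt 0 e1
          · exact chaosFilt_mono X φ (by push_cast; omega) e1
    exact fun m n => key _ m n rfl
  refine ⟨hfilt m n, ?_⟩
  have hle : chaosFilt X φ ((m : ℤ) + n - 1) ≤ (ℝ ∙ e m n)ᗮ := by
    rw [chaosFilt, Submodule.span_le]
    rintro _ ⟨v, hv, rfl⟩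
    have hle' : L v.length ≤ (ℝ ∙ e m n)ᗮ := by
      rw [Submodule.span_le]
      rintro _ ⟨m', n', h, rfl⟩
      exact Submodule.mem_orthogonal_singleton_iff_inner_right.2 (horth _ _ _ _ (by omega))
    exact hle' (hword v)
  exact fun v hv => Submodule.mem_orthogonal_singleton_iff_inner_left.1 (hle hv)

/-- The three parts of `X_i u` according to their degrees. -/
lemma apc_eq_of_add_add {i : Fin 2} {n : ℤ} {u x y z : E} (hu : u ∈ chaos X φ n)
    (hx : x ∈ chaos X φ (n + 1)) (hy : y ∈ chaos X φ n) (hz : z ∈ chaos X φ (n - 1))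
    (h : X i u = x + y + z) (hc : u ∈ cyclicSpace X φ) :
    (apc X φ 1 i ⟨u, hc⟩ : E) = x ∧ (apc X φ 0 i ⟨u, hc⟩ : E) = y ∧
      (apc X φ (-1) i ⟨u, hc⟩ : E) = z := by
  let A : SignType → E := fun ε => match ε with
    | .pos => x
    | .zero => y
    | .neg => z
  have key := apc_eq_of_decomposition (i := i) (u := ⟨u, hc⟩) hu A ?_ ?_
  · exact ⟨key 1, key 0, key (-1)⟩
  · intro ε
    cases ε
    · simpa using hy
    · simpa [← sub_eq_add_neg] using hz
    · simpa using hx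
  · change X i u = z + y + x
    rw [h]; abel

lemma apc_of_recursion_zero (h0 : e 0 0 = φ)
    (horth : ∀ m n m' n', m + n ≠ m' + n' → ⟪e m n, e m' n'⟫_ℝ = 0)
    (h1 : ∀ m n, X 0 (e m n) = e (m + 1) n + a m • e m n + w m • e (m - 1) n)
    (h2 : ∀ m n, X 1 (e m n) = e m (n + 1) + b n • e m n + w' n • e m (n - 1))
    (hw : w 0 = 0) (m n : ℕ) (hc : e m n ∈ cyclicSpace X φ) :
    (apc X φ 1 0 ⟨e m n, hc⟩ : E) = e (m + 1) n ∧ (apc X φ 0 0 ⟨e m n, hc⟩ : E) = a m • e m n ∧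
      (apc X φ (-1) 0 ⟨e m n, hc⟩ : E) = w m • e (m - 1) n := by
  have hm := mem_chaos_of_recursion h0 horth h1 h2
  refine apc_eq_of_add_add (hm m n) ?_ (Submodule.smul_mem _ _ (hm m n)) ?_ (h1 m n) hc
  · rw [show (m : ℤ) + n + 1 = (m + 1 : ℕ) + n by push_cast; ring]
    exact hm (m + 1) n
  · rcases m with _ | m
    · simp [hw]
    · rw [show ((m + 1 : ℕ) : ℤ) + n - 1 = m + n by push_cast; ring]
      exact Submodule.smul_mem _ (w (m + 1)) (hm m n)

lemma apc_of_recursion_one (h0 : e 0 0 = φ)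
    (horth : ∀ m n m' n', m + n ≠ m' + n' → ⟪e m n, e m' n'⟫_ℝ = 0)
    (h1 : ∀ m n, X 0 (e m n) = e (m + 1) n + a m • e m n + w m • e (m - 1) n)
    (h2 : ∀ m n, X 1 (e m n) = e m (n + 1) + b n • e m n + w' n • e m (n - 1))
    (hw : w' 0 = 0) (m n : ℕ) (hc : e m n ∈ cyclicSpace X φ) :
    (apc X φ 1 1 ⟨e m n, hc⟩ : E) = e m (n + 1) ∧ (apc X φ 0 1 ⟨e m n, hc⟩ : E) = b n • e m n ∧
      (apc X φ (-1) 1 ⟨e m n, hc⟩ : E) = w' n • e m (n - 1) := by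
  have hm := mem_chaos_of_recursion h0 horth h1 h2
  refine apc_eq_of_add_add (hm m n) ?_ (Submodule.smul_mem _ _ (hm m n)) ?_ (h2 m n) hc
  · rw [show (m : ℤ) + n + 1 = m + (n + 1 : ℕ) by push_cast; ring]
    exact hm m (n + 1)
  · rcases n with _ | n
    · simp [hw]
    · rw [show (m : ℤ) + (n + 1 : ℕ) - 1 = m + n by push_cast; ring]
      exact Submodule.smul_mem _ (w' (n + 1)) (hm m n)

end Grid

/-! ### Polynomial functions in `L²` -/

section PolyFun

variable {ι : Type*} {ν : Measure (ι → ℝ)} (hν : HasPolyMoments ν)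

/-- A polynomial in the coordinates, as an element of `L²`. -/
def polyFun (P : MvPolynomial ι ℝ) : polySpace ν := ⟨(hν P).toLp _, P, (hν P).coeFn_toLp⟩

lemma polyFun_congr {P Q : MvPolynomial ι ℝ}
    (h : ∀ᵐ x ∂ν, MvPolynomial.eval x P = MvPolynomial.eval x Q) : polyFun hν P = polyFun hν Q :=
  Subtype.ext (MemLp.toLp_congr (hν P) (hν Q) h)

lemma exists_eq_polyFun (f : polySpace ν) : ∃ P, f = polyFun hν P := by
  obtain ⟨f, P, hP⟩ := f
  exact ⟨P, Subtype.ext (Lp.ext (hP.trans (hν P).coeFn_toLp.symm))⟩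

lemma mulCoord_polyFun (i : ι) (P : MvPolynomial ι ℝ) :
    mulCoord hν i (polyFun hν P) = polyFun hν (MvPolynomial.X i * P) := by
  apply Subtype.ext
  refine MemLp.toLp_congr (memLp_coord_mul hν i _) (hν (MvPolynomial.X i * P)) ?_
  filter_upwards [(hν P).coeFn_toLp] with x hx
  simp only [map_mul, MvPolynomial.eval_X]
  rw [← hx]
  rfl

lemma polyFun_add (P Q : MvPolynomial ι ℝ) :
    polyFun hν (P + Q) = polyFun hν P + polyFun hν Q := by
  apply Subtype.ext
  refine (MemLp.toLp_congr (hν (P + Q)) ((hν P).add (hν Q)) ?_).trans (MemLp.toLp_add (hν P) (hν Q))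
  exact Filter.Eventually.of_forall fun x => by simp

lemma polyFun_C_mul (r : ℝ) (P : MvPolynomial ι ℝ) :
    polyFun hν (MvPolynomial.C r * P) = r • polyFun hν P := by
  apply Subtype.ext
  refine (MemLp.toLp_congr (hν (MvPolynomial.C r * P)) ((hν P).const_smul r) ?_).trans
    (MemLp.toLp_const_smul r (hν P))
  exact Filter.Eventually.of_forall fun x => by simp

lemma inner_polyFun (P Q : MvPolynomial ι ℝ) :
    ⟪polyFun hν P, polyFun hν Q⟫_ℝ = ∫ x, MvPolynomial.eval x P * MvPolynomial.eval x Q ∂ν := by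
  rw [Submodule.coe_inner, L2.inner_def]
  refine integral_congr_ae ?_
  filter_upwards [(hν P).coeFn_toLp, (hν Q).coeFn_toLp] with x h1 h2
  change ⟪((hν P).toLp _ : (ι → ℝ) → ℝ) x, ((hν Q).toLp _ : (ι → ℝ) → ℝ) x⟫_ℝ = _
  rw [h1, h2]
  exact mul_comm _ _

lemma mulCoord_isSymmetric (i : ι) : (mulCoord hν i).IsSymmetric := by
  intro f g
  obtain ⟨P, rfl⟩ := exists_eq_polyFun hν f
  obtain ⟨Q, rfl⟩ := exists_eq_polyFun hν g
  rw [mulCoord_polyFun, mulCoord_polyFun, inner_polyFun, inner_polyFun]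
  refine integral_congr_ae (Filter.Eventually.of_forall fun x => ?_)
  simp only [map_mul]
  ring

end PolyFun

/-! ### The pair with mixed preservation operators -/

section Model

lemma meixnerOmega_zero (β : ℝ) : meixnerOmega β 0 = 0 := by simp [meixnerOmega]

lemma IsMeixnerSequence.recursion {μ : Measure ℝ} {β : ℝ} {f : ℕ → Polynomial ℝ}
    (hf : IsMeixnerSequence μ β f) (n : ℕ) : ∀ᵐ x ∂μ, x * (f n).eval x = (f (n + 1)).eval x
      + (n : ℝ) * (f n).eval x + meixnerOmega β n * (f (n - 1)).eval x := by
  rcases n with _ | n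
  · filter_upwards [hf.rec_zero] with x hx
    simp [hf.zero, meixnerOmega_zero, ← hx]
  · filter_upwards [hf.rec_succ n] with x hx
    rw [hx]
    push_cast
    rfl

lemma IsMeixnerML.integral_id_eq_zero {μ : Measure ℝ} {β : ℝ} (h : IsMeixnerML μ 1 0 β 1) :
    ∫ x, x ∂μ = 0 := by
  rcases h.params with ⟨-, -, -, -, h⟩ | ⟨k, -, -, -, -, h⟩
  · simpa [jacobiPoly] using h 1 0 one_ne_zero
  · simpa [jacobiPoly] using h 1 0 one_ne_zero

namespace MixedMeixner

variable (M : MixedMeixner)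

lemma isMeixner (i : Fin 2) : ∃ β, IsMeixnerML (M.μ i) 1 0 β 1 := by
  fin_cases i
  · exact ⟨_, M.meixnerT⟩
  · exact ⟨_, M.meixnerZ⟩

instance (i : Fin 2) : IsProbabilityMeasure (M.μ i) := (M.isMeixner i).choose_spec.prob

lemma integral_mul_coord (f g : ℝ → ℝ) :
    ∫ x, f (x 0) * g (x 1) ∂M.joint = (∫ t, f t ∂M.μ 0) * ∫ z, g z ∂M.μ 1 := by
  have h := integral_fintype_prod_eq_prod (μ := M.μ) (fun i : Fin 2 => (![f, g] i : ℝ → ℝ))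
  simp only [Fin.prod_univ_two] at h
  exact h

lemma base_isSymmetric (i : Fin 2) : (M.base i).IsSymmetric := mulCoord_isSymmetric _ i

lemma polyOne_eq : polyOne M.polyMoments = polyFun M.polyMoments 1 := rfl

lemma base_isCentered : IsCentered M.base (polyOne M.polyMoments) := by
  intro i
  have h0 := M.meixnerT.integral_id_eq_zero
  have h1 := M.meixnerZ.integral_id_eq_zero
  have e0 := M.integral_mul_coord (fun x => x) (fun _ => 1)
  have e1 := M.integral_mul_coord (fun _ => 1) (fun x => x)
  rw [h0, zero_mul] at e0
  rw [h1, mul_zero] at e1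
  rw [expect, base, polyOne_eq, mulCoord_polyFun, inner_polyFun]
  fin_cases i
  · simpa using e0
  · simpa using e1

lemma inner_a_left (ε : SignType) (i : Fin 2) (u v : M.Space) :
    ⟪M.a ε i u, v⟫_ℝ = ⟪u, M.a (-ε) i v⟫_ℝ :=
  inner_apc_left M.base_isSymmetric ε i u v

lemma pair_zero : M.pair 0
    = M.a (-1) 0 + (M.p • M.a 0 0 + M.s • M.a 0 1) + M.a 1 0 := rfl

lemma pair_one : M.pair 1
    = M.a (-1) 1 + (M.r • M.a 0 0 + M.v • M.a 0 1) + M.a 1 1 := rfl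

lemma pair_isSymmetric (i : Fin 2) : (M.pair i).IsSymmetric := by
  intro u v
  have h1 := fun i u v => M.inner_a_left (-1) i u v
  have h2 := fun i u v => M.inner_a_left 0 i u v
  have h3 := fun i u v => M.inner_a_left 1 i u v
  simp only [neg_neg, neg_zero] at h1 h2
  fin_cases i
  · change ⟪M.pair 0 u, v⟫_ℝ = ⟪u, M.pair 0 v⟫_ℝ
    simp only [pair_zero, LinearMap.add_apply, LinearMap.smul_apply, inner_add_left,
      inner_add_right, inner_smul_left, inner_smul_right, h1, h2, h3, conj_trivial]
    ring
  · change ⟪M.pair 1 u, v⟫_ℝ = ⟪u, M.pair 1 v⟫_ℝ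
    simp only [pair_one, LinearMap.add_apply, LinearMap.smul_apply, inner_add_left,
      inner_add_right, inner_smul_left, inner_smul_right, h1, h2, h3, conj_trivial]
    ring

lemma norm_vac : ‖M.vac‖ = 1 := by
  have h : ⟪M.vac, M.vac⟫_ℝ = 1 := by
    change ⟪polyFun M.polyMoments 1, polyFun M.polyMoments 1⟫_ℝ = 1
    rw [inner_polyFun]
    have := M.integral_mul_coord (fun _ => 1) (fun _ => 1)
    simpa using this
  rw [real_inner_self_eq_norm_sq] at h
  exact (pow_eq_one_iff_of_nonneg (norm_nonneg _) two_ne_zero).1 h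

lemma pair_isCentered : IsCentered M.pair M.vac := by
  have h1 : ∀ i, M.a (-1) i M.vac = 0 := fun i => apc_neg_one_vac i
  have h2 : ∀ i, M.a 0 i M.vac = 0 := fun i => apc_zero_vac M.base_isCentered i
  have h3 : ∀ i, ⟪M.a 1 i M.vac, M.vac⟫_ℝ = 0 := fun i =>
    inner_apc_one_vac (X := M.base) i (cyclicVac M.base (polyOne M.polyMoments))
  intro i
  rw [expect]
  fin_cases i
  · change ⟪M.pair 0 M.vac, M.vac⟫_ℝ = 0
    simp [pair_zero, h1, h2, h3]
  · change ⟪M.pair 1 M.vac, M.vac⟫_ℝ = 0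
    simp [pair_one, h1, h2, h3]

/-- The products `f_m(t) g_n(z)` of orthogonal polynomials, on which the pair with mixed
preservation operators acts by explicit recursions. -/
lemma exists_grid {f g : ℕ → Polynomial ℝ}
    (hf : IsMeixnerSequence (M.μ 0) ((M.c * M.p + M.d * M.r) / 2) f)
    (hg : IsMeixnerSequence (M.μ 1) ((M.j * M.s + M.k * M.v) / 2) g) :
    ∃ e : ℕ → ℕ → M.Space, e 0 0 = M.vac ∧
      (∀ m n, m + n ≠ 0 → ⟪e m n, M.vac⟫_ℝ = 0) ∧
      (∀ m n, M.pair 0 (e m n) = e (m + 1) n + (M.p * m + M.s * n) • e m n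
        + meixnerOmega ((M.c * M.p + M.d * M.r) / 2) m • e (m - 1) n) ∧
      (∀ m n, M.pair 1 (e m n) = e m (n + 1) + (M.r * m + M.v * n) • e m n
        + meixnerOmega ((M.j * M.s + M.k * M.v) / 2) n • e m (n - 1)) := by
  set β := (M.c * M.p + M.d * M.r) / 2 with hβ
  set γ := (M.j * M.s + M.k * M.v) / 2 with hγ
  let P : ℕ → ℕ → MvPolynomial (Fin 2) ℝ := fun m n =>
    Polynomial.aeval (MvPolynomial.X 0) (f m) * Polynomial.aeval (MvPolynomial.X 1) (g n)
  have hP : ∀ m n x, MvPolynomial.eval x (P m n) = (f m).eval (x 0) * (g n).eval (x 1) := by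
    intro m n x
    have h : ∀ (i : Fin 2) (q : Polynomial ℝ), MvPolynomial.eval x
        (Polynomial.aeval (MvPolynomial.X i : MvPolynomial (Fin 2) ℝ) q) = q.eval (x i) := by
      intro i q
      induction q using Polynomial.induction_on' with
      | add p q hp hq => simp [hp, hq]
      | monomial n a => simp [Polynomial.aeval_monomial, MvPolynomial.algebraMap_eq]
    simp only [P, map_mul, h]
  let E : ℕ → ℕ → polySpace M.joint := fun m n => polyFun M.polyMoments (P m n)
  have h0 : E 0 0 = polyOne M.polyMoments := by
    rw [polyOne_eq]
    simp [E, P, hf.zero, hg.zero]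
  have hin : ∀ m n m' n', ⟪E m n, E m' n'⟫_ℝ
      = (∫ t, (f m).eval t * (f m').eval t ∂M.μ 0)
        * ∫ z, (g n).eval z * (g n').eval z ∂M.μ 1 := by
    intro m n m' n'
    rw [inner_polyFun, ← M.integral_mul_coord]
    refine integral_congr_ae (Filter.Eventually.of_forall fun x => ?_)
    simp only [hP]
    ring
  have horth : ∀ m n m' n', m + n ≠ m' + n' → ⟪E m n, E m' n'⟫_ℝ = 0 := by
    intro m n m' n' h
    rw [hin]
    by_cases hm : m = m'
    · rw [hg.orth n n' (by omega), mul_zero]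
    · rw [hf.orth m m' hm, zero_mul]
  have hae : ∀ (i : Fin 2) {p : ℝ → Prop}, (∀ᵐ t ∂M.μ i, p t) → ∀ᵐ x ∂M.joint, p (x i) :=
    fun i p h => (Measure.tendsto_eval_ae_ae (μ := M.μ) (i := i)).eventually h
  have h1 : ∀ m n, M.base 0 (E m n)
      = E (m + 1) n + (m : ℝ) • E m n + meixnerOmega β m • E (m - 1) n := by
    intro m n
    simp only [E, base, mulCoord_polyFun, ← polyFun_C_mul, ← polyFun_add]
    refine polyFun_congr _ ?_
    filter_upwards [hae 0 (hf.recursion m)] with x hx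
    simp only [map_mul, map_add, hP, MvPolynomial.eval_X, MvPolynomial.eval_C]
    linear_combination (g n).eval (x 1) * hx
  have h2 : ∀ m n, M.base 1 (E m n)
      = E m (n + 1) + (n : ℝ) • E m n + meixnerOmega γ n • E m (n - 1) := by
    intro m n
    simp only [E, base, mulCoord_polyFun, ← polyFun_C_mul, ← polyFun_add]
    refine polyFun_congr _ ?_
    filter_upwards [hae 1 (hg.recursion n)] with x hx
    simp only [map_mul, map_add, hP, MvPolynomial.eval_X, MvPolynomial.eval_C]
    linear_combination (f m).eval (x 0) * hx
  have hmem : ∀ m n, E m n ∈ cyclicSpace M.base (polyOne M.polyMoments) := fun m n =>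
    chaosFilt_le_cyclicSpace _ _ _ (mem_chaos_of_recursion h0 horth h1 h2 m n).1
  have a1 := fun m n => apc_of_recursion_zero h0 horth h1 h2 (meixnerOmega_zero _) m n (hmem m n)
  have a2 := fun m n => apc_of_recursion_one h0 horth h1 h2 (meixnerOmega_zero _) m n (hmem m n)
  let e : ℕ → ℕ → M.Space := fun m n =>
    (⟨E m n, hmem m n⟩ : cyclicSpace M.base (polyOne M.polyMoments))
  have b1 : ∀ m n, M.a 1 0 (e m n) = e (m + 1) n := fun m n => Subtype.ext (a1 m n).1
  have b2 : ∀ m n, M.a 0 0 (e m n) = (m : ℝ) • e m n := fun m n => Subtype.ext (a1 m n).2.1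
  have b3 : ∀ m n, M.a (-1) 0 (e m n) = meixnerOmega β m • e (m - 1) n :=
    fun m n => Subtype.ext (a1 m n).2.2
  have b4 : ∀ m n, M.a 1 1 (e m n) = e m (n + 1) := fun m n => Subtype.ext (a2 m n).1
  have b5 : ∀ m n, M.a 0 1 (e m n) = (n : ℝ) • e m n := fun m n => Subtype.ext (a2 m n).2.1
  have b6 : ∀ m n, M.a (-1) 1 (e m n) = meixnerOmega γ n • e m (n - 1) :=
    fun m n => Subtype.ext (a2 m n).2.2
  have he0 : e 0 0 = M.vac := Subtype.ext h0
  refine ⟨e, he0, fun m n h => ?_, fun m n => ?_, fun m n => ?_⟩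
  · rw [← he0]
    exact horth m n 0 0 (by omega)
  · simp only [pair_zero, LinearMap.add_apply, LinearMap.smul_apply, b1, b2, b3, b5]
    module
  · simp only [pair_one, LinearMap.add_apply, LinearMap.smul_apply, b4, b2, b6, b5]
    module

end MixedMeixner

end Model

/-! ### The grading of the Lie algebra -/

section Degree

variable {E : Type*} [NormedAddCommGroup E] [InnerProductSpace ℝ E]
variable {ι : Type*} {X : ι → Module.End ℝ E} {φ : E}

/-- An operator of degree `d` maps `G_n` into `G_{n+d}`. -/
def HasDegree (X : ι → Module.End ℝ E) (φ : E) (d : ℤ)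
    (T : Module.End ℝ (cyclicSpace X φ)) : Prop :=
  ∀ (n : ℤ) (u : cyclicSpace X φ), (u : E) ∈ chaos X φ n → (T u : E) ∈ chaos X φ (n + d)

lemma HasDegree.mul {d d' : ℤ} {T T' : Module.End ℝ (cyclicSpace X φ)} (h : HasDegree X φ d T)
    (h' : HasDegree X φ d' T') : HasDegree X φ (d + d') (T * T') := by
  intro n u hu
  have := h _ _ (h' n u hu)
  rwa [add_assoc, add_comm d' d] at this

lemma HasDegree.sub {d : ℤ} {T T' : Module.End ℝ (cyclicSpace X φ)} (h : HasDegree X φ d T)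
    (h' : HasDegree X φ d T') : HasDegree X φ d (T - T') :=
  fun n u hu => Submodule.sub_mem _ (h n u hu) (h' n u hu)

variable [Finite ι]

lemma hasDegree_apc (ε : SignType) (i : ι) : HasDegree X φ ε (apc X φ ε i) :=
  fun _ _ hu => apc_mem_chaos ε i hu

/-- The commutator of two joint operators has the sum of their degrees. -/
lemma hasDegree_commutator (ε δ : SignType) (i j : ι) :
    HasDegree X φ ((ε : ℤ) + δ) (apc X φ ε i * apc X φ δ j - apc X φ δ j * apc X φ ε i) := by
  refine ((hasDegree_apc ε i).mul (hasDegree_apc δ j)).sub ?_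
  rw [add_comm]
  exact (hasDegree_apc δ j).mul (hasDegree_apc ε i)

end Degree

section Grading

variable {E : Type*} [NormedAddCommGroup E] [InnerProductSpace ℝ E]
variable {ι : Type*} [Fintype ι] {X : ι → Module.End ℝ E} {φ : E}

lemma exists_coefficients {T : Module.End ℝ (cyclicSpace X φ)} (hT : T ∈ apcSpan X φ) :
    ∃ (γ : ℝ) (c : SignType → ι → ℝ), T = γ • 1 + ∑ ε : SignType, ∑ i, c ε i • apc X φ ε i := by
  classical
  induction hT using Submodule.span_induction with
  | mem T hT =>
    rcases hT with rfl | ⟨ε, i, rfl⟩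
    · exact ⟨1, 0, by simp⟩
    · refine ⟨0, Pi.single ε (Pi.single i 1), ?_⟩
      rw [Finset.sum_eq_single ε (fun δ _ h => by simp [h]) (by simp),
        Finset.sum_eq_single i (fun j _ h => by simp [h]) (by simp)]
      simp
  | zero => exact ⟨0, 0, by simp⟩
  | add T T' _ _ h h' =>
    obtain ⟨γ, c, rfl⟩ := h
    obtain ⟨γ', c', rfl⟩ := h'
    refine ⟨γ + γ', c + c', ?_⟩
    simp only [Pi.add_apply, add_smul, Finset.sum_add_distrib]
    abel
  | smul r T _ h =>
    obtain ⟨γ, c, rfl⟩ := h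
    refine ⟨r * γ, r • c, ?_⟩
    simp only [Pi.smul_apply, smul_eq_mul, mul_smul, smul_add, Finset.smul_sum]

/-- The space `W` is graded: an element of degree `d` is a combination of the generators of
degree `d`. -/
lemma exists_coefficients_of_hasDegree {d : ℤ} {T : Module.End ℝ (cyclicSpace X φ)}
    (hT : T ∈ apcSpan X φ) (hd : HasDegree X φ d T) :
    ∃ (γ : ℝ) (c : SignType → ι → ℝ), T = (if d = 0 then γ else 0) • 1
      + ∑ ε : SignType, ∑ i, (if (ε : ℤ) = d then c ε i else 0) • apc X φ ε i := by
  obtain ⟨γ, c, hγ⟩ := exists_coefficients hT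
  refine ⟨γ, c, cyclicSpace_hom_ext fun n u hu => Subtype.ext ?_⟩
  have h1 : chaosProj X φ (n + d) u = (if d = 0 then (1 : ℝ) else 0) • (u : E) := by
    split_ifs with h
    · rw [h, add_zero, chaosProj_of_mem hu, one_smul]
    · rw [chaosProj_of_mem_of_ne (by omega) hu, zero_smul]
  have h2 : ∀ (ε : SignType) i, chaosProj X φ (n + d) (apc X φ ε i u)
      = (if (ε : ℤ) = d then (1 : ℝ) else 0) • (apc X φ ε i u : E) := by
    intro ε i
    have := apc_mem_chaos ε i hu
    split_ifs with h
    · rw [h] at this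
      rw [chaosProj_of_mem this, one_smul]
    · rw [chaosProj_of_mem_of_ne (by omega) this, zero_smul]
  have h3 := chaosProj_of_mem (hd n u hu)
  rw [← h3, hγ]
  simp only [LinearMap.add_apply, LinearMap.smul_apply, Module.End.one_apply, LinearMap.sum_apply,
    Submodule.coe_add, Submodule.coe_smul, Submodule.coe_sum, map_add, map_sum, map_smul, h1, h2,
    smul_smul, mul_ite, mul_one, mul_zero]

lemma eq_zero_of_hasDegree_two {T : Module.End ℝ (cyclicSpace X φ)}
    (hT : T ∈ apcSpan X φ) (hd : HasDegree X φ 2 T) : T = 0 := by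
  obtain ⟨γ, c, h⟩ := exists_coefficients_of_hasDegree hT hd
  have h2 : ∀ ε : SignType, ¬ (ε : ℤ) = 2 := by decide
  simpa [h2] using h

lemma exists_eq_of_hasDegree_one {T : Module.End ℝ (cyclicSpace X φ)}
    (hT : T ∈ apcSpan X φ) (hd : HasDegree X φ 1 T) :
    ∃ c : ι → ℝ, T = ∑ i, c i • apc X φ 1 i := by
  obtain ⟨γ, c, h⟩ := exists_coefficients_of_hasDegree hT hd
  refine ⟨c 1, ?_⟩
  rw [h, Finset.sum_eq_single 1]
  · simp
  · intro ε _ hε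
    have : ∀ ε : SignType, ε ≠ 1 → ¬ (ε : ℤ) = 1 := by decide
    simp [this ε hε]
  · simp

lemma exists_eq_of_hasDegree_zero {T : Module.End ℝ (cyclicSpace X φ)}
    (hT : T ∈ apcSpan X φ) (hd : HasDegree X φ 0 T) :
    ∃ (γ : ℝ) (c : ι → ℝ), T = γ • 1 + ∑ i, c i • apc X φ 0 i := by
  obtain ⟨γ, c, h⟩ := exists_coefficients_of_hasDegree hT hd
  refine ⟨γ, c 0, ?_⟩
  rw [h, Finset.sum_eq_single 0]
  · simp
  · intro ε _ hε
    have : ∀ ε : SignType, ε ≠ 0 → ¬ (ε : ℤ) = 0 := by decide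
    simp [this ε hε]
  · simp

end Grading

/-! ### Ladder operators -/

section Ladder

variable {F : Type*} [AddCommGroup F] [Module ℝ F]

lemma apply_pow_of_commutator {T B : Module.End ℝ F} {μ : ℝ} (h : T * B - B * T = μ • B)
    (m : ℕ) (x : F) : T ((B ^ m) x) = (B ^ m) (T x) + (m * μ) • (B ^ m) x := by
  have h' : ∀ y, T (B y) = B (T y) + μ • B y := fun y => by
    have := LinearMap.congr_fun h y
    simp only [LinearMap.sub_apply, Module.End.mul_apply, LinearMap.smul_apply] at this
    rw [← this]; abel
  induction m with
  | zero => simp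
  | succ m ih =>
    rw [pow_succ', Module.End.mul_apply, h', ih, map_add, map_smul, Module.End.mul_apply]
    push_cast
    module

/-- The lowering operator `A` acts on the vectors `B^m (B')^n v` by the coefficients `ω_m`, if its
commutator with `B` has the eigenvalues `1 + 2 β m` and it commutes with `B'` on these vectors. -/
lemma lowering_apply {A B B' : Module.End ℝ F} {v : F} {β : ℝ} (hv : A v = 0)
    (hB : ∀ m n : ℕ, A (B ((B ^ m) ((B' ^ n) v)))
      = B (A ((B ^ m) ((B' ^ n) v))) + (1 + 2 * β * m) • (B ^ m) ((B' ^ n) v))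
    (hB' : ∀ n : ℕ, A (B' ((B' ^ n) v)) = B' (A ((B' ^ n) v))) (m n : ℕ) :
    A ((B ^ m) ((B' ^ n) v)) = meixnerOmega β m • (B ^ (m - 1)) ((B' ^ n) v) := by
  induction m with
  | zero =>
    rw [meixnerOmega_zero, zero_smul, pow_zero, Module.End.one_apply]
    induction n with
    | zero => simpa using hv
    | succ n ih => rw [pow_succ', Module.End.mul_apply, hB', ih, map_zero]
  | succ m ih =>
    rw [pow_succ', Module.End.mul_apply, hB, ih, meixnerOmega_succ, add_smul, map_smul,
      Nat.add_sub_cancel]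
    rcases m with _ | m
    · simp [meixnerOmega_zero]
    · rw [Nat.add_sub_cancel, ← Module.End.mul_apply, ← pow_succ']
      module

/-- Nonnegativity of the products `ω_1 ⋯ ω_m` forces `β ≥ 0` or `β = -1 / (k - 1)`: if `β < 0` then
`ω_m < 0` for large `m`, so some earlier `ω_k` has to vanish. -/
lemma meixner_parameter_cases {β : ℝ} {a : ℕ → ℝ} (h0 : a 0 = 1) (hnn : ∀ m, 0 ≤ a m)
    (hrec : ∀ m, a (m + 1) = meixnerOmega β (m + 1) * a m) :
    0 ≤ β ∨ ∃ k : ℕ, 2 ≤ k ∧ β * ((k : ℝ) - 1) = -1 := by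
  by_contra! hcon
  obtain ⟨hβ, hk⟩ := hcon
  have hω : ∀ m : ℕ, meixnerOmega β (m + 1) = (m + 1) * (1 + β * m) := fun m => by
    rw [meixnerOmega_eq]; push_cast; ring
  -- by the choice of `β` no factor vanishes, so all products are positive
  have hpos : ∀ m, 0 < a m := by
    intro m
    induction m with
    | zero => rw [h0]; exact one_pos
    | succ m ih =>
      refine lt_of_le_of_ne (hnn _) fun h => ?_
      rw [hrec, hω] at h
      have h1 : (m : ℝ) + 1 ≠ 0 := by positivity
      have h2 : 1 + β * m = 0 := by
        rcases mul_eq_zero.1 h.symm with h | h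
        · exact (mul_eq_zero.1 h).resolve_left h1
        · exact absurd h ih.ne'
      rcases m with _ | m
      · simp at h2
      · refine hk (m + 2) (by omega) ?_
        push_cast at h2 ⊢
        linarith
  obtain ⟨n, hn⟩ := exists_nat_gt (-1 / β)
  have h1 : 1 + β * n < 0 := by
    rw [div_lt_iff_of_neg hβ] at hn
    linarith
  have h2 := hrec n
  rw [hω] at h2
  have h3 := hpos n
  have h4 := hpos (n + 1)
  have h5 : ((n : ℝ) + 1) * (1 + β * n) < 0 := mul_neg_of_pos_of_neg (by positivity) h1
  rw [h2] at h4
  exact absurd h4 (not_lt.2 (mul_nonpos_of_nonpos_of_nonneg h5.le h3.le))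

end Ladder

/-! ### Commutation relations -/

section Relations

variable {E : Type*} [NormedAddCommGroup E] [InnerProductSpace ℝ E]
variable {ι : Type*} [Fintype ι] {X : ι → Module.End ℝ E} {φ : E}

lemma IsMeixnerVector.commutator_mem (hX : IsMeixnerVector X φ) (ε δ : SignType) (i j : ι) :
    apc X φ ε i * apc X φ δ j - apc X φ δ j * apc X φ ε i ∈ apcSpan X φ :=
  hX _ (apc_mem_apcSpan X φ ε i) _ (apc_mem_apcSpan X φ δ j)

lemma IsMeixnerVector.creation_comm (hX : IsMeixnerVector X φ) (i j : ι) :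
    apc X φ 1 i * apc X φ 1 j = apc X φ 1 j * apc X φ 1 i :=
  sub_eq_zero.1 (eq_zero_of_hasDegree_two (hX.commutator_mem 1 1 i j)
    (hasDegree_commutator 1 1 i j))

/-- The elements of degree `0` of `W` are symmetric. -/
lemma inner_degree_zero_left (hs : ∀ i, (X i).IsSymmetric) (γ : ℝ) (c : ι → ℝ)
    (u v : cyclicSpace X φ) :
    ⟪(γ • (1 : Module.End ℝ (cyclicSpace X φ)) + ∑ i, c i • apc X φ 0 i) u, v⟫_ℝ
      = ⟪u, (γ • (1 : Module.End ℝ (cyclicSpace X φ)) + ∑ i, c i • apc X φ 0 i) v⟫_ℝ := by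
  simp only [LinearMap.add_apply, LinearMap.smul_apply, Module.End.one_apply, LinearMap.sum_apply,
    inner_add_left, inner_add_right, sum_inner, inner_sum, inner_smul_left, inner_smul_right,
    inner_apc_left hs 0, conj_trivial, neg_zero]

/-- The commutator of two preservation operators is skew-adjoint, and self-adjoint as an element of
degree `0` of `W`; so it vanishes. -/
lemma IsMeixnerVector.preservation_comm (hs : ∀ i, (X i).IsSymmetric) (hX : IsMeixnerVector X φ)
    (i j : ι) : apc X φ 0 i * apc X φ 0 j = apc X φ 0 j * apc X φ 0 i := by
  obtain ⟨γ, c, h⟩ := exists_eq_of_hasDegree_zero (hX.commutator_mem 0 0 i j)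
    (hasDegree_commutator 0 0 i j)
  have hsym := inner_degree_zero_left (φ := φ) hs γ c
  rw [← h] at hsym
  have hz := fun i u v => inner_apc_left (φ := φ) hs 0 i u v
  simp only [neg_zero] at hz
  refine sub_eq_zero.1 (LinearMap.ext fun u => ?_)
  refine ext_inner_right ℝ fun v => ?_
  have h1 := hsym u v
  simp only [LinearMap.sub_apply, Module.End.mul_apply, inner_sub_left, inner_sub_right, hz] at h1 ⊢
  simp only [LinearMap.zero_apply, inner_zero_left]
  linarith

end Relations

section Diagonal

variable {E : Type*} [NormedAddCommGroup E] [InnerProductSpace ℝ E]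

/-- A centered Meixner random vector such that `X_0 φ`, `X_1 φ` are orthonormal and are common
eigenvectors of the preservation operators: `a_i^0 X_j φ = l i j • X_j φ`. -/
structure IsDiagonalMeixner (X : Fin 2 → Module.End ℝ E) (φ : E) (l : Fin 2 → Fin 2 → ℝ) :
    Prop where
  symm : ∀ i, (X i).IsSymmetric
  centered : IsCentered X φ
  meixner : IsMeixnerVector X φ
  norm : ‖φ‖ = 1
  orthonormal : ∀ i j, ⟪X i φ, X j φ⟫_ℝ = if i = j then 1 else 0
  eigen : ∀ i j, apc X φ 0 i (apc X φ 1 j (cyclicVac X φ)) = l i j • apc X φ 1 j (cyclicVac X φ)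

namespace IsDiagonalMeixner

variable {X : Fin 2 → Module.End ℝ E} {φ : E} {l : Fin 2 → Fin 2 → ℝ}

lemma inner_creation_vac (h : IsDiagonalMeixner X φ l) (i j : Fin 2) :
    ⟪apc X φ 1 i (cyclicVac X φ), apc X φ 1 j (cyclicVac X φ)⟫_ℝ = if i = j then 1 else 0 := by
  rw [Submodule.coe_inner, apc_one_vac h.centered, apc_one_vac h.centered, h.orthonormal]

lemma inner_vac (h : IsDiagonalMeixner X φ l) : ⟪cyclicVac X φ, cyclicVac X φ⟫_ℝ = 1 := by
  rw [Submodule.coe_inner, real_inner_self_eq_norm_sq, h.norm, one_pow]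

/-- `[a_i^0, a_j^+] = l i j • a_j^+`: the commutator is a combination of the creation operators,
whose coefficients are read off from the action on the vacuum. -/
lemma preservation_creation (h : IsDiagonalMeixner X φ l) (i j : Fin 2) :
    apc X φ 0 i * apc X φ 1 j - apc X φ 1 j * apc X φ 0 i = l i j • apc X φ 1 j := by
  obtain ⟨c, hc⟩ := exists_eq_of_hasDegree_one (h.meixner.commutator_mem 0 1 i j)
    (hasDegree_commutator 0 1 i j)
  have h1 := LinearMap.congr_fun hc (cyclicVac X φ)
  simp only [LinearMap.sub_apply, Module.End.mul_apply, apc_zero_vac h.centered, map_zero,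
    sub_zero, h.eigen, LinearMap.sum_apply, LinearMap.smul_apply] at h1
  have h2 : ∀ k, c k = if j = k then l i j else 0 := by
    intro k
    have h3 := congrArg (fun x => ⟪x, apc X φ 1 k (cyclicVac X φ)⟫_ℝ) h1
    simp only [sum_inner, inner_smul_left, h.inner_creation_vac, conj_trivial, mul_ite, mul_one,
      mul_zero, Finset.sum_ite_eq', Finset.mem_univ, if_true] at h3
    exact h3.symm
  rw [hc]
  simp [h2, ite_smul]

/-- `[a_i^-, a_j^+] = δ_{ij} I + ∑ k, c k • a_k^0`. -/
lemma annihilation_creation (h : IsDiagonalMeixner X φ l) (i j : Fin 2) : ∃ c : Fin 2 → ℝ,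
    apc X φ (-1) i * apc X φ 1 j - apc X φ 1 j * apc X φ (-1) i
      = (if i = j then (1 : ℝ) else 0) • (1 : Module.End ℝ (cyclicSpace X φ))
        + ∑ k, c k • apc X φ 0 k := by
  obtain ⟨γ, c, hc⟩ := exists_eq_of_hasDegree_zero (h.meixner.commutator_mem (-1) 1 i j)
    (by simpa using hasDegree_commutator (X := X) (φ := φ) (-1) 1 i j)
  refine ⟨c, ?_⟩
  have h1 := LinearMap.congr_fun hc (cyclicVac X φ)
  simp only [LinearMap.sub_apply, Module.End.mul_apply, apc_neg_one_vac, map_zero,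
    sub_zero, LinearMap.sum_apply, LinearMap.smul_apply, LinearMap.add_apply,
    Module.End.one_apply, apc_zero_vac h.centered, smul_zero, Finset.sum_const_zero,
    add_zero] at h1
  have h2 := congrArg (fun x => ⟪x, cyclicVac X φ⟫_ℝ) h1
  beta_reduce at h2
  rw [inner_apc_left h.symm, neg_neg, h.inner_creation_vac, inner_smul_left, h.inner_vac,
    conj_trivial, mul_one] at h2
  rw [hc, ← h2]
  simp only [eq_comm]

/-- The coefficients `c` in `[a_i^-, a_j^+] = δ_{ij} I + ∑ k, c k • a_k^0`; they are chosen,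
since `I` and the preservation operators may be linearly dependent. -/
def coeff (h : IsDiagonalMeixner X φ l) (i j : Fin 2) : Fin 2 → ℝ :=
  (h.annihilation_creation i j).choose

lemma annihilation_creation_eq (h : IsDiagonalMeixner X φ l) (i j : Fin 2) :
    apc X φ (-1) i * apc X φ 1 j - apc X φ 1 j * apc X φ (-1) i
      = (if i = j then (1 : ℝ) else 0) • (1 : Module.End ℝ (cyclicSpace X φ))
        + ∑ k, h.coeff i j k • apc X φ 0 k :=
  (h.annihilation_creation i j).choose_spec

/-- `[[a_i^-, a_j^+], a_m^+]` is a multiple of `a_m^+`. -/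
lemma commutator_commutator (h : IsDiagonalMeixner X φ l) (i j m : Fin 2) :
    (apc X φ (-1) i * apc X φ 1 j - apc X φ 1 j * apc X φ (-1) i) * apc X φ 1 m
      - apc X φ 1 m * (apc X φ (-1) i * apc X φ 1 j - apc X φ 1 j * apc X φ (-1) i)
      = (∑ k, h.coeff i j k * l k m) • apc X φ 1 m := by
  rw [h.annihilation_creation_eq, Finset.sum_smul]
  simp only [mul_smul, ← h.preservation_creation, add_mul, mul_add, smul_mul_assoc, one_mul,
    mul_smul_comm, mul_one, Finset.sum_mul, Finset.mul_sum, smul_sub, Finset.sum_sub_distrib]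
  abel

/-- By the Jacobi identity and the commutation of the creation operators,
`[[a_i^-, a_j^+], a_m^+] = [[a_i^-, a_m^+], a_j^+]`; for `j ≠ m` both sides vanish. -/
lemma coeff_orthogonal (h : IsDiagonalMeixner X φ l) (i : Fin 2) {j m : Fin 2} (hjm : j ≠ m) :
    ∑ k, h.coeff i j k * l k m = 0 := by
  have h1 := h.commutator_commutator i j m
  have h2 := h.commutator_commutator i m j
  have hcomm := h.meixner.creation_comm j m
  have h3 : (∑ k, h.coeff i j k * l k m) • apc X φ 1 m
      = (∑ k, h.coeff i m k * l k j) • apc X φ 1 j := by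
    rw [← h1, ← h2]
    have e1 : ∀ A B C : Module.End ℝ (cyclicSpace X φ), B * C = C * B →
        (A * B - B * A) * C - C * (A * B - B * A) = (A * C - C * A) * B - B * (A * C - C * A) := by
      intro A B C hBC
      have e2 : A * B * C = A * C * B := by rw [mul_assoc, hBC, mul_assoc]
      have e3 : C * (B * A) = B * (C * A) := by rw [← mul_assoc, ← hBC, mul_assoc]
      rw [sub_mul, mul_sub, sub_mul, mul_sub, e2, e3, mul_assoc B A C, mul_assoc C A B]
      abel
    exact e1 _ _ _ hcomm
  have h4 := congrArg (fun T : Module.End ℝ (cyclicSpace X φ) =>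
    ⟪T (cyclicVac X φ), apc X φ 1 m (cyclicVac X φ)⟫_ℝ) h3
  simpa only [LinearMap.smul_apply, inner_smul_left, h.inner_creation_vac, conj_trivial, if_true,
    if_neg hjm, mul_one, mul_zero] using h4

/-- `[a_i^-, a_j^+] = [a_j^-, a_i^+]`: the two sides are adjoint to each other, and the elements of
degree `0` of `W` are symmetric. -/
lemma commutator_symm (h : IsDiagonalMeixner X φ l) (i j : Fin 2) :
    apc X φ (-1) i * apc X φ 1 j - apc X φ 1 j * apc X φ (-1) i
      = apc X φ (-1) j * apc X φ 1 i - apc X φ 1 i * apc X φ (-1) j := by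
  have hsym := inner_degree_zero_left (φ := φ) h.symm (if i = j then (1 : ℝ) else 0) (h.coeff i j)
  rw [← h.annihilation_creation_eq] at hsym
  refine LinearMap.ext fun u => ext_inner_right ℝ fun v => ?_
  rw [hsym]
  have h1 := fun i u v => inner_apc_left (φ := φ) h.symm (-1) i u v
  have h2 := fun i u v => inner_apc_left (φ := φ) h.symm 1 i u v
  simp only [neg_neg] at h1
  simp only [LinearMap.sub_apply, Module.End.mul_apply, inner_sub_left, inner_sub_right, h1, h2]

end IsDiagonalMeixner

end Diagonal

/-! ### The vectors obtained from the vacuum by creation operators -/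

/-- The vectors `(a_0^+)^m (a_1^+)^n φ`. -/
def creationGrid {E : Type*} [NormedAddCommGroup E] [InnerProductSpace ℝ E]
    (X : Fin 2 → Module.End ℝ E) (φ : E) (m n : ℕ) : cyclicSpace X φ :=
  (apc X φ 1 0 ^ m) ((apc X φ 1 1 ^ n) (cyclicVac X φ))

namespace IsDiagonalMeixner

variable {E : Type*} [NormedAddCommGroup E] [InnerProductSpace ℝ E]
variable {X : Fin 2 → Module.End ℝ E} {φ : E} {l : Fin 2 → Fin 2 → ℝ}

/-- The chosen coefficients of the equal operators `[a_i^-, a_j^+]` and `[a_j^-, a_i^+]` may differ,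
but these sums are determined by the commutators with `a_m^+`. -/
lemma coeff_symm (h : IsDiagonalMeixner X φ l) (i j m : Fin 2) :
    ∑ k, h.coeff i j k * l k m = ∑ k, h.coeff j i k * l k m := by
  have h1 := h.commutator_commutator i j m
  rw [h.commutator_symm i j, h.commutator_commutator j i m] at h1
  have h4 := congrArg (fun T : Module.End ℝ (cyclicSpace X φ) =>
    ⟪T (cyclicVac X φ), apc X φ 1 m (cyclicVac X φ)⟫_ℝ) h1
  simpa only [LinearMap.smul_apply, inner_smul_left, h.inner_creation_vac, conj_trivial, if_true,
    mul_one] using h4.symm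

/-- For `i ≠ j` the operator `[a_i^-, a_j^+]` commutes with both creation operators. -/
lemma coeff_eq_zero (h : IsDiagonalMeixner X φ l) {i j : Fin 2} (hij : i ≠ j) (m : Fin 2) :
    ∑ k, h.coeff i j k * l k m = 0 := by
  by_cases hjm : j = m
  · rw [h.coeff_symm]
    exact h.coeff_orthogonal j (hjm ▸ hij)
  · exact h.coeff_orthogonal i hjm

lemma creationGrid_comm (h : IsDiagonalMeixner X φ l) (m n : ℕ) :
    creationGrid X φ m n = (apc X φ 1 1 ^ n) ((apc X φ 1 0 ^ m) (cyclicVac X φ)) := by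
  have hc : Commute (apc X φ 1 0) (apc X φ 1 1) := h.meixner.creation_comm 0 1
  rw [creationGrid, ← Module.End.mul_apply, ← Module.End.mul_apply, (hc.pow_pow m n).eq]

lemma creation_zero_grid (m n : ℕ) :
    apc X φ 1 0 (creationGrid X φ m n) = creationGrid X φ (m + 1) n := by
  rw [creationGrid, creationGrid, pow_succ', Module.End.mul_apply]

lemma creation_one_grid (h : IsDiagonalMeixner X φ l) (m n : ℕ) :
    apc X φ 1 1 (creationGrid X φ m n) = creationGrid X φ m (n + 1) := by
  rw [h.creationGrid_comm, h.creationGrid_comm, pow_succ', Module.End.mul_apply]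

lemma preservation_grid (h : IsDiagonalMeixner X φ l) (i : Fin 2) (m n : ℕ) :
    apc X φ 0 i (creationGrid X φ m n) = (l i 0 * m + l i 1 * n) • creationGrid X φ m n := by
  rw [creationGrid, apply_pow_of_commutator (h.preservation_creation i 0),
    apply_pow_of_commutator (h.preservation_creation i 1), apc_zero_vac h.centered, map_zero,
    zero_add, map_smul]
  module

lemma commutator_grid (h : IsDiagonalMeixner X φ l) (i j : Fin 2) (m n : ℕ) :
    apc X φ (-1) i (apc X φ 1 j (creationGrid X φ m n))
      = apc X φ 1 j (apc X φ (-1) i (creationGrid X φ m n))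
        + ((if i = j then (1 : ℝ) else 0) + (∑ k, h.coeff i j k * l k 0) * m
          + (∑ k, h.coeff i j k * l k 1) * n) • creationGrid X φ m n := by
  have h1 := LinearMap.congr_fun (h.annihilation_creation_eq i j) (creationGrid X φ m n)
  simp only [LinearMap.sub_apply, Module.End.mul_apply, LinearMap.add_apply, LinearMap.smul_apply,
    Module.End.one_apply, LinearMap.sum_apply, h.preservation_grid] at h1
  rw [sub_eq_iff_eq_add'.1 h1]
  simp only [Fin.sum_univ_two]
  module

/-- The parameter `β` of the `i`-th variable: `[[a_i^-, a_i^+], a_i^+] = 2 β a_i^+`. -/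
def parameter (h : IsDiagonalMeixner X φ l) (i : Fin 2) : ℝ :=
  (∑ k, h.coeff i i k * l k i) / 2

lemma annihilation_zero_grid (h : IsDiagonalMeixner X φ l) (m n : ℕ) :
    apc X φ (-1) 0 (creationGrid X φ m n)
      = meixnerOmega (h.parameter 0) m • creationGrid X φ (m - 1) n := by
  refine lowering_apply (apc_neg_one_vac 0) (fun m n => ?_) (fun n => ?_) m n
  · have := h.commutator_grid 0 0 m n
    rw [h.coeff_orthogonal 0 (show (0 : Fin 2) ≠ 1 by decide), if_pos rfl] at this
    rw [creationGrid] at this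
    rw [this, parameter]
    module
  · have := h.commutator_grid 0 1 0 n
    rw [h.coeff_eq_zero (by decide), h.coeff_eq_zero (by decide), if_neg (by decide)] at this
    simpa [creationGrid] using this

lemma annihilation_one_grid (h : IsDiagonalMeixner X φ l) (m n : ℕ) :
    apc X φ (-1) 1 (creationGrid X φ m n)
      = meixnerOmega (h.parameter 1) n • creationGrid X φ m (n - 1) := by
  rw [h.creationGrid_comm, h.creationGrid_comm]
  refine lowering_apply (apc_neg_one_vac 1) (fun n m => ?_) (fun m => ?_) n m
  · have := h.commutator_grid 1 1 m n
    rw [h.coeff_orthogonal 1 (show (1 : Fin 2) ≠ 0 by decide), if_pos rfl] at this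
    rw [h.creationGrid_comm] at this
    rw [this, parameter]
    module
  · have := h.commutator_grid 1 0 m 0
    rw [h.coeff_eq_zero (by decide), h.coeff_eq_zero (by decide), if_neg (by decide)] at this
    simpa [creationGrid] using this

lemma inner_grid_vac (m n : ℕ) (h : IsDiagonalMeixner X φ l) (hmn : m + n ≠ 0) :
    ⟪(creationGrid X φ m n : E), φ⟫_ℝ = 0 := by
  rcases m with _ | m
  · rcases n with _ | n
    · exact absurd rfl hmn
    · rw [← h.creation_one_grid]
      exact inner_apc_one_vac 1 _
  · rw [← creation_zero_grid]
    exact inner_apc_one_vac 0 _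

/-- The squared norms of the vectors `(a_i^+)^m φ` are the products `ω_1 ⋯ ω_m`, which are therefore
nonnegative; so there is a Meixner distribution with the parameter `β` of the `i`-th variable. -/
lemma exists_meixner (h : IsDiagonalMeixner X φ l) (i : Fin 2) :
    ∃ μ f, IsMeixnerML μ 1 0 (h.parameter i) 1 ∧ IsMeixnerSequence μ (h.parameter i) f := by
  have key : 0 ≤ h.parameter i ∨ ∃ k : ℕ, 2 ≤ k ∧ h.parameter i * ((k : ℝ) - 1) = -1 := by
    have hzero : creationGrid X φ 0 0 = cyclicVac X φ := rfl
    fin_cases i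
    · refine meixner_parameter_cases
        (a := fun m => ⟪creationGrid X φ m 0, creationGrid X φ m 0⟫_ℝ) ?_
        (fun m => real_inner_self_nonneg) fun m => ?_
      · rw [hzero, h.inner_vac]
      · nth_rewrite 1 [← creation_zero_grid]
        rw [inner_apc_left h.symm, h.annihilation_zero_grid, inner_smul_right, Nat.add_sub_cancel]
        rfl
    · refine meixner_parameter_cases
        (a := fun m => ⟪creationGrid X φ 0 m, creationGrid X φ 0 m⟫_ℝ) ?_
        (fun m => real_inner_self_nonneg) fun m => ?_
      · rw [hzero, h.inner_vac]
      · nth_rewrite 1 [← h.creation_one_grid]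
        rw [inner_apc_left h.symm, h.annihilation_one_grid, inner_smul_right, Nat.add_sub_cancel]
        rfl
  rcases key with hβ | ⟨k, hk, hβ⟩
  · exact exists_meixner_of_nonneg hβ
  · exact exists_meixner_of_finite hk hβ

/-- The random vector and its model act in the same way on the vectors obtained by applying creation
operators to the vacuum. -/
theorem exists_momentEqual (h : IsDiagonalMeixner X φ l) :
    ∃ M : MixedMeixner, MomentEqual X φ M.pair M.vac := by
  obtain ⟨μT, f, hT, hf⟩ := h.exists_meixner 0
  obtain ⟨μZ, g, hZ, hg⟩ := h.exists_meixner 1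
  have h0 : h.parameter 0 = (h.coeff 0 0 0 * l 0 0 + h.coeff 0 0 1 * l 1 0) / 2 := by
    rw [parameter, Fin.sum_univ_two]
  have h1 : h.parameter 1 = (h.coeff 1 1 0 * l 0 1 + h.coeff 1 1 1 * l 1 1) / 2 := by
    rw [parameter, Fin.sum_univ_two]
  -- the coefficients of the model are read off from the eigenvalues and from `[a_i^-, a_i^+]`
  let M : MixedMeixner :=
    { c := h.coeff 0 0 0, d := h.coeff 0 0 1, j := h.coeff 1 1 0, k := h.coeff 1 1 1
      p := l 0 0, r := l 1 0, s := l 0 1, v := l 1 1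
      μ := ![μT, μZ]
      orth₁ := by
        simpa [Fin.sum_univ_two] using h.coeff_orthogonal 0 (show (0 : Fin 2) ≠ 1 by decide)
      orth₂ := by
        simpa [Fin.sum_univ_two] using h.coeff_orthogonal 1 (show (1 : Fin 2) ≠ 0 by decide)
      meixnerT := h0 ▸ hT
      meixnerZ := h1 ▸ hZ }
  obtain ⟨e, he, hvac, hp0, hp1⟩ := M.exists_grid (f := f) (g := g) (h0 ▸ hf) (h1 ▸ hg)
  refine ⟨M, momentEqual_of_relation
    (Submodule.span ℝ (Set.range fun q : ℕ × ℕ => ((creationGrid X φ q.1 q.2 : E), e q.1 q.2)))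
    (Submodule.subset_span ⟨(0, 0), ?_⟩) (fun i => ?_) ?_⟩
  · rw [← he]; rfl
  · set R := Submodule.span ℝ
      (Set.range fun q : ℕ × ℕ => ((creationGrid X φ q.1 q.2 : E), e q.1 q.2)) with hR
    have hmem : ∀ m n, ((creationGrid X φ m n : E), e m n) ∈ R :=
      fun m n => Submodule.subset_span ⟨(m, n), rfl⟩
    suffices hle : R ≤ R.comap ((X i).prodMap (M.pair i)) from fun x hx => hle hx
    conv_lhs => rw [hR]
    rw [Submodule.span_le]
    rintro _ ⟨⟨m, n⟩, rfl⟩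
    change (X i (creationGrid X φ m n : E), M.pair i (e m n)) ∈ R
    rw [← apc_add_add h.symm i]
    fin_cases i
    · have := R.add_mem (R.add_mem (hmem (m + 1) n)
        (R.smul_mem (l 0 0 * m + l 0 1 * n) (hmem m n)))
        (R.smul_mem (meixnerOmega (h.parameter 0) m) (hmem (m - 1) n))
      convert this using 1
      simp only [Prod.smul_mk, Prod.mk_add_mk]
      refine Prod.ext ?_ ?_
      · simp only [LinearMap.add_apply, Fin.zero_eta, creation_zero_grid, h.preservation_grid,
          h.annihilation_zero_grid, Submodule.coe_add, Submodule.coe_smul]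
        abel
      · rw [h0]; exact hp0 m n
    · have := R.add_mem (R.add_mem (hmem m (n + 1))
        (R.smul_mem (l 1 0 * m + l 1 1 * n) (hmem m n)))
        (R.smul_mem (meixnerOmega (h.parameter 1) n) (hmem m (n - 1)))
      convert this using 1
      simp only [Prod.smul_mk, Prod.mk_add_mk]
      refine Prod.ext ?_ ?_
      · simp only [LinearMap.add_apply, Fin.mk_one, h.creation_one_grid, h.preservation_grid,
          h.annihilation_one_grid, Submodule.coe_add, Submodule.coe_smul]
        abel
      · rw [h1]; exact hp1 m n
  · intro x hx
    induction hx using Submodule.span_induction with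
    | mem x hx =>
      obtain ⟨⟨m, n⟩, rfl⟩ := hx
      by_cases hmn : m + n = 0
      · obtain ⟨rfl, rfl⟩ : m = 0 ∧ n = 0 := by omega
        change ⟪φ, φ⟫_ℝ = ⟪e 0 0, M.vac⟫_ℝ
        rw [he, real_inner_self_eq_norm_sq, real_inner_self_eq_norm_sq, h.norm, M.norm_vac]
      · exact (inner_grid_vac m n h hmn).trans (hvac m n hmn).symm
    | zero => simp
    | add x y _ _ hx hy => simp only [Prod.fst_add, Prod.snd_add, inner_add_left, hx, hy]
    | smul r x _ hx => simp only [Prod.smul_fst, Prod.smul_snd, inner_smul_left, hx]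

end IsDiagonalMeixner

/-! ### Diagonalizing the preservation operators -/

/-- Two commuting symmetric operators on a plane have a common orthonormal eigenbasis: an eigenbasis
of the first one, or of the second one if the first one is scalar. -/
lemma exists_common_eigenbasis {V : Type*} [NormedAddCommGroup V] [InnerProductSpace ℝ V]
    [FiniteDimensional ℝ V] (hV : Module.finrank ℝ V = 2) (A : Fin 2 → Module.End ℝ V)
    (hA : ∀ i, (A i).IsSymmetric) (hcomm : Commute (A 0) (A 1)) :
    ∃ (u : OrthonormalBasis (Fin 2) ℝ V) (c : Fin 2 → Fin 2 → ℝ),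
      ∀ i j, A i (u j) = c i j • u j := by
  have hu : ∀ i j, A i ((hA i).eigenvectorBasis hV j)
      = (hA i).eigenvalues hV j • (hA i).eigenvectorBasis hV j :=
    fun i j => (hA i).apply_eigenvectorBasis hV j
  by_cases hne : (hA 0).eigenvalues hV 0 = (hA 0).eigenvalues hV 1
  · have hscal : A 0 = (hA 0).eigenvalues hV 0 • LinearMap.id := by
      refine ((hA 0).eigenvectorBasis hV).toBasis.ext fun j => ?_
      fin_cases j
      · simp
      · simp [hne]
    refine ⟨(hA 1).eigenvectorBasis hV,
      ![fun _ => (hA 0).eigenvalues hV 0, (hA 1).eigenvalues hV], fun i j => ?_⟩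
    fin_cases i
    · exact LinearMap.congr_fun hscal _
    · exact hu 1 j
  · set u := (hA 0).eigenvectorBasis hV with hu_def
    have hoff : ∀ i j, i ≠ j → ⟪u i, A 1 (u j)⟫_ℝ = 0 := by
      intro i j hij
      have h1 : ⟪u i, A 0 (A 1 (u j))⟫_ℝ = (hA 0).eigenvalues hV j * ⟪u i, A 1 (u j)⟫_ℝ := by
        rw [← Module.End.mul_apply, hcomm.eq, Module.End.mul_apply, hu, map_smul, inner_smul_right]
      have h2 : ⟪u i, A 0 (A 1 (u j))⟫_ℝ = (hA 0).eigenvalues hV i * ⟪u i, A 1 (u j)⟫_ℝ := by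
        rw [← hA 0, hu, inner_smul_left]
        rfl
      have h3 : (hA 0).eigenvalues hV i ≠ (hA 0).eigenvalues hV j := by
        fin_cases i <;> fin_cases j
        · exact absurd rfl hij
        · exact hne
        · exact fun h => hne h.symm
        · exact absurd rfl hij
      by_contra hz
      exact h3 (mul_right_cancel₀ hz (h2.symm.trans h1))
    refine ⟨u, ![(hA 0).eigenvalues hV, fun j => ⟪u j, A 1 (u j)⟫_ℝ], fun i j => ?_⟩
    fin_cases i
    · exact hu 0 j
    · change A 1 (u j) = ⟪u j, A 1 (u j)⟫_ℝ • u j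
      conv_lhs => rw [← u.sum_repr' (A 1 (u j))]
      exact Finset.sum_eq_single j (fun i _ hij => by rw [hoff i j hij, zero_smul]) (by simp)

lemma exists_generalLinear_of_bases {V ι : Type*} [AddCommGroup V] [Module ℝ V] [Fintype ι]
    [DecidableEq ι] (b u : Module.Basis ι ℝ V) :
    ∃ S : GL ι ℝ, ∀ i, ∑ j, (S : Matrix ι ι ℝ) i j • b j = u i :=
  ⟨⟨(b.toMatrix u).transpose, (u.toMatrix b).transpose,
    by rw [← Matrix.transpose_mul, Module.Basis.toMatrix_mul_toMatrix_flip, Matrix.transpose_one],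
    by rw [← Matrix.transpose_mul, Module.Basis.toMatrix_mul_toMatrix_flip,
      Matrix.transpose_one]⟩, fun i => b.sum_toMatrix_smul_self u i⟩

/-- Two commuting symmetric operators that preserve the plane spanned by `x 0`, `x 1` have a common
orthonormal eigenbasis there. -/
lemma exists_common_eigenbasis_span {V : Type*} [NormedAddCommGroup V] [InnerProductSpace ℝ V]
    {x : Fin 2 → V} (hx : LinearIndependent ℝ x) (T : Fin 2 → Module.End ℝ V)
    (hT : ∀ i, (T i).IsSymmetric) (hcomm : T 0 * T 1 = T 1 * T 0)
    (hinv : ∀ i j, T i (x j) ∈ Submodule.span ℝ (Set.range x)) :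
    ∃ (S : GL (Fin 2) ℝ) (u : Fin 2 → V) (c : Fin 2 → Fin 2 → ℝ),
      (∀ i, u i = ∑ j, (S : Matrix (Fin 2) (Fin 2) ℝ) i j • x j) ∧
      (∀ i j, ⟪u i, u j⟫_ℝ = if i = j then 1 else 0) ∧ ∀ i j, T i (u j) = c i j • u j := by
  obtain ⟨K, b, hb, hK⟩ : ∃ (K : Submodule ℝ V) (b : Module.Basis (Fin 2) ℝ K),
      (∀ j, (b j : V) = x j) ∧ K = Submodule.span ℝ (Set.range x) :=
    ⟨_, Module.Basis.span hx, fun j => congrArg Subtype.val (Module.Basis.span_apply hx j), rfl⟩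
  have hinv : ∀ i, ∀ y ∈ K, T i y ∈ K := by
    intro i
    suffices h : K ≤ K.comap (T i) from fun y hy => h hy
    conv_lhs => rw [hK]
    rw [Submodule.span_le]
    rintro _ ⟨j, rfl⟩
    rw [SetLike.mem_coe, Submodule.mem_comap, hK]
    exact hinv i j
  have : FiniteDimensional ℝ K := b.finiteDimensional_of_finite
  have hdim : Module.finrank ℝ K = 2 := by rw [Module.finrank_eq_card_basis b, Fintype.card_fin]
  obtain ⟨u, c, hu⟩ := exists_common_eigenbasis (V := K) hdim (fun i => (T i).restrict (hinv i))
    (fun i => (hT i).restrict_invariant (hinv i))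
    (LinearMap.ext fun y => Subtype.ext (LinearMap.congr_fun hcomm (y : V)))
  obtain ⟨S, hS⟩ := exists_generalLinear_of_bases b u.toBasis
  refine ⟨S, fun i => u i, c, fun i => ?_, fun i j => orthonormal_iff_ite.1 u.orthonormal i j,
    fun i j => congrArg Subtype.val (hu i j)⟩
  have h1 := congrArg (fun y : K => (y : V)) (hS i)
  simp only [Submodule.coe_sum, Submodule.coe_smul, hb, u.coe_toBasis] at h1
  exact h1.symm

/-- The preservation operators of a Meixner random vector are commuting symmetric operators of the
plane spanned by the `X_i φ`, so they have a common orthonormal eigenbasis there. -/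
lemma exists_preservation_eigenbasis {E : Type*} [NormedAddCommGroup E] [InnerProductSpace ℝ E]
    {X : Fin 2 → Module.End ℝ E} {φ : E} (hs : ∀ i, (X i).IsSymmetric)
    (hc : IsCentered X φ) (hnd : IsNondegenerate X φ) (hX : IsMeixnerVector X φ) :
    ∃ (S : GL (Fin 2) ℝ) (u : Fin 2 → cyclicSpace X φ) (c : Fin 2 → Fin 2 → ℝ),
      (∀ i, u i = ∑ j, (S : Matrix (Fin 2) (Fin 2) ℝ) i j • apc X φ 1 j (cyclicVac X φ)) ∧
      (∀ i j, ⟪u i, u j⟫_ℝ = if i = j then 1 else 0) ∧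
      ∀ i j, apc X φ 0 i (u j) = c i j • u j := by
  refine exists_common_eigenbasis_span (x := fun j => apc X φ 1 j (cyclicVac X φ)) ?_ (apc X φ 0)
    (fun i => inner_apc_left hs 0 i) (hX.preservation_comm hs 0 1) fun i j => ?_
  · refine LinearIndependent.of_comp (cyclicSpace X φ).subtype ?_
    have h := hnd.comp Fin.succ (Fin.succ_injective 2)
    have heq : ![φ, X 0 φ, X 1 φ] ∘ Fin.succ = (cyclicSpace X φ).subtype ∘
        fun j => apc X φ 1 j (cyclicVac X φ) := by
      funext j
      rw [Function.comp_apply, Function.comp_apply, Submodule.subtype_apply, apc_one_vac hc]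
      fin_cases j <;> rfl
    rwa [heq] at h
  · obtain ⟨c, h⟩ := exists_eq_of_hasDegree_one (hX.commutator_mem 0 1 i j)
      (hasDegree_commutator 0 1 i j)
    have h1 := LinearMap.congr_fun h (cyclicVac X φ)
    simp only [LinearMap.sub_apply, Module.End.mul_apply, apc_zero_vac hc, map_zero, sub_zero,
      LinearMap.sum_apply, LinearMap.smul_apply] at h1
    rw [h1]
    exact Submodule.sum_mem _ fun k _ => Submodule.smul_mem _ _ (Submodule.subset_span ⟨k, rfl⟩)

/-- A linear transformation, not orthogonal in general, brings every Meixner random vector to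
diagonal form. -/
lemma exists_isDiagonalMeixner {E : Type*} [NormedAddCommGroup E] [InnerProductSpace ℝ E]
    {X : Fin 2 → Module.End ℝ E} {φ : E} (hs : ∀ i, (X i).IsSymmetric) (hφ : ‖φ‖ = 1)
    (hc : IsCentered X φ) (hnd : IsNondegenerate X φ) (hX : IsMeixnerVector X φ) :
    ∃ (S : GL (Fin 2) ℝ) (l : Fin 2 → Fin 2 → ℝ),
      IsDiagonalMeixner (linTransform (S : Matrix (Fin 2) (Fin 2) ℝ) X) φ l := by
  obtain ⟨S, u, c, hSu, horth, hu⟩ := exists_preservation_eigenbasis hs hc hnd hX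
  have hc' := isCentered_linTransform hc (S : Matrix (Fin 2) (Fin 2) ℝ)
  have hSu : ∀ i, linTransform (S : Matrix (Fin 2) (Fin 2) ℝ) X i φ = u i := fun i => by
    rw [linTransform_apply, hSu]
    simp only [Submodule.coe_sum, Submodule.coe_smul, apc_one_vac hc]
  refine ⟨S, fun i j => ∑ k, (S : Matrix (Fin 2) (Fin 2) ℝ) i k * c k j,
    isSymmetric_linTransform hs _, hc', isMeixnerVector_linTransform hs S hX, hφ,
    fun i j => ?_, fun i j => ?_⟩
  · rw [hSu, hSu, ← Submodule.coe_inner, horth]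
  · have hmem : (u j : E) ∈ cyclicSpace (linTransform (S : Matrix (Fin 2) (Fin 2) ℝ) X) φ := by
      rw [cyclicSpace_linTransform]
      exact (u j).2
    have h1 : apc (linTransform (S : Matrix (Fin 2) (Fin 2) ℝ) X) φ 1 j (cyclicVac _ φ)
        = ⟨(u j : E), hmem⟩ := by
      apply Subtype.ext
      rw [apc_one_vac hc', hSu]
    rw [h1]
    apply Subtype.ext
    rw [apc_linTransform, Submodule.coe_smul, Finset.sum_smul]
    simp only [hu, Submodule.coe_smul, mul_smul]

end

theorem mainTheorem1 {H : Type*} [NormedAddCommGroup H] [InnerProductSpace ℝ H] [CompleteSpace H]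
    (D : Submodule ℝ H) (φ : D) (hφ : ‖φ‖ = 1)
    (X : Fin 2 → Module.End ℝ D) (hsymm : ∀ i, (X i).IsSymmetric)
    (hcent : IsCentered X φ) (hnd : IsNondegenerate X φ) (hX : IsMeixnerVector X φ) :
    (∃ (S : GL (Fin 2) ℝ) (M : MixedMeixner),
      MomentEqual (linTransform (S : Matrix (Fin 2) (Fin 2) ℝ) X) φ M.pair M.vac ∧
      ∃ hM : IsMeixnerVector M.pair M.vac, Nonempty (apcLie hX ≃ₗ⁅ℝ⁆ apcLie hM)) ∧
    (∀ (S : GL (Fin 2) ℝ) (M : MixedMeixner),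
      MomentEqual (linTransform (S : Matrix (Fin 2) (Fin 2) ℝ) X) φ M.pair M.vac ↔
      ∃ (hM : IsMeixnerVector M.pair M.vac) (e : apcLie hX ≃ₗ⁅ℝ⁆ apcLie hM),
        e (apcLie.one hX) = apcLie.one hM ∧
        ∀ (ε : SignType) (i : Fin 2),
          ∑ j, (S : Matrix (Fin 2) (Fin 2) ℝ) i j • e (apcLie.op hX ε j) = apcLie.op hM ε i) := by
  refine ⟨?_, fun S M => ⟨fun h => ?_, ?_⟩⟩
  · obtain ⟨S, l, hS⟩ := exists_isDiagonalMeixner hsymm hφ hcent hnd hX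
    obtain ⟨M, hM⟩ := hS.exists_momentEqual
    obtain ⟨hM', e, -, -⟩ := exists_lieEquiv_of_momentEqual hsymm M.pair_isSymmetric S hM hX
    exact ⟨S, M, hM, hM', ⟨e⟩⟩
  · exact exists_lieEquiv_of_momentEqual hsymm M.pair_isSymmetric S h hX
  · rintro ⟨hM, e, hone, hop⟩
    exact momentEqual_of_lieEquiv hsymm M.pair_isSymmetric hcent M.pair_isCentered hφ M.norm_vac
      S hX hM e hone hop
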